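/- An oriented matroid $\mathcal M$ on $E=[n]=\{1,\dots,n\}$ is given by its set of signed circuits; it is uniform of rank $r$ if $r$ is the size of a largest subset of $E$ containing no circuit and every circuit has exactly $r+1$ elements. For $R\subseteq E$, the reorientation ${}_{-R}\mathcal M$ is obtained by reversing the signs of the elements of $R$ in all circuits, and the reorientation class $[\mathcal M]$ is the set of all reorientations ${}_{-R}\mathcal M$, $R\subseteq E$. $\mathcal M$ is $k$-neighborly if every circuit has more than $k$ positive and more than $k$ negative elements, and $f_{\mathcal M}(r,n,k)$ denotes the number of subsets $R\subseteq E$ such that ${}_{-R}\mathcal M$ is $k$-neighborly, where $r$ is the rank of $\mathcal M$. The alternating oriented matroid $C_r(n)$ is the uniform oriented matroid of rank $r$ on $[n]$ all of whose circuits alternate in sign along the natural order, and $c_r(n,k)=f_{C_r(n)}(r,n,k)$. A Lawrence oriented matroid (LOM) of rank $r$ on $[n]$ is a uniform oriented matroid of rank $r$ having a chirotope $\chi$ with $\chi(j_1,\dots,j_r)=\prod_{i=1}^r a_{i,j_i}$ for all $j_1<\dots<j_r$, for some $r\times n$ matrix $(a_{i,j})$ with entries in $\{+1,-1\}$. **Theorem.**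 Let $\mathcal M\notin[C_9(n)]$ be a rank $9$ LOM on $[n]$. Then: (a) if $n=12$, then $f_{\mathcal M}(9,12,2)\le c_9(12,2)$, and among the reorientation classes of such $\mathcal M$ there are exactly $511$ with $f_{\mathcal M}(9,12,2)=c_9(12,2)$; (b) if $n=12$, then $f_{\mathcal M}(9,12,3)\le c_9(12,3)$, and among the reorientation classes of such $\mathcal M$ there are exactly $511$ with $f_{\mathcal M}(9,12,3)=c_9(12,3)$; (c) if $n=13$, then $f_{\mathcal M}(9,13,3)\le c_9(13,3)$, and among the reorientation classes of such $\mathcal M$ there are exactly $1023$ with $f_{\mathcal M}(9,13,3)=c_9(13,3)$. -/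

import Mathlib

open Finset

/-- An oriented matroid on the finite ground set `E`, given by its signed circuits. -/
@[ext]
structure OrientedMatroid (E : Type*) where
  /-- The set of signed circuits. -/
  circuits : Set (E → SignType)
  zero_notMem : (0 : E → SignType) ∉ circuits
  neg_mem : ∀ X ∈ circuits, -X ∈ circuits
  incomparable : ∀ X ∈ circuits, ∀ Y ∈ circuits,
    (∀ e, X e ≠ 0 → Y e ≠ 0) → X = Y ∨ X = -Y
  /-- Weak elimination. -/
  elimination : ∀ X ∈ circuits, ∀ Y ∈ circuits, X ≠ -Y → ∀ e, X e = 1 → Y e = -1 →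
    ∃ Z ∈ circuits, Z e = 0 ∧ ∀ f, (Z f = 1 → X f = 1 ∨ Y f = 1) ∧
      (Z f = -1 → X f = -1 ∨ Y f = -1)

namespace OrientedMatroid

/-- The sign vector obtained from `X` by reversing the signs of the elements of `R`. -/
def reorientVec {E : Type*} [DecidableEq E] (R : Finset E) (X : E → SignType) : E → SignType :=
  fun e => if e ∈ R then -X e else X e

theorem reorientVec_reorientVec {E : Type*} [DecidableEq E] (R : Finset E) (X : E → SignType) :
    reorientVec R (reorientVec R X) = X := by
  funext e
  simp only [reorientVec]
  split_ifs <;> simp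

theorem reorientVec_neg {E : Type*} [DecidableEq E] (R : Finset E) (X : E → SignType) :
    reorientVec R (-X) = -reorientVec R X := by
  funext e
  simp only [reorientVec, Pi.neg_apply]
  split_ifs <;> simp

theorem reorientVec_ne_zero {E : Type*} [DecidableEq E] (R : Finset E) (X : E → SignType)
    (e : E) : reorientVec R X e ≠ 0 ↔ X e ≠ 0 := by
  simp only [reorientVec]
  split_ifs
  · generalize X e = a
    revert a
    decide
  · rfl

/-- Weak elimination in a sign-symmetric form. -/
theorem elimination_symm {E : Type*} (M : OrientedMatroid E) (X Y : E → SignType)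
    (hX : X ∈ M.circuits) (hY : Y ∈ M.circuits) (hXY : X ≠ -Y) (e : E) (h0 : X e ≠ 0)
    (he : Y e = -X e) :
    ∃ Z ∈ M.circuits, Z e = 0 ∧ ∀ f, Z f ≠ 0 → Z f = X f ∨ Z f = Y f := by
  have key : ∀ z x y : SignType, (z = 1 → x = 1 ∨ y = 1) → (z = -1 → x = -1 ∨ y = -1) →
      z ≠ 0 → z = x ∨ z = y := by decide
  have hc : ∀ x : SignType, x ≠ 0 → x = 1 ∨ x = -1 := by decide
  rcases hc _ h0 with h | h
  · obtain ⟨Z, hZ, hZe, hZf⟩ := M.elimination X hX Y hY hXY e h (by rw [he, h])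
    exact ⟨Z, hZ, hZe, fun f => key _ _ _ (hZf f).1 (hZf f).2⟩
  · obtain ⟨Z, hZ, hZe, hZf⟩ := M.elimination Y hY X hX
      (fun h' => hXY (by rw [h', neg_neg])) e (by rw [he, h]; rfl) h
    exact ⟨Z, hZ, hZe, fun f hf => (key _ _ _ (hZf f).1 (hZf f).2 hf).symm⟩

/-- The reorientation of `M` on the set `R`. -/
def reorient {E : Type*} [DecidableEq E] (M : OrientedMatroid E) (R : Finset E) :
    OrientedMatroid E where
  circuits := {X | reorientVec R X ∈ M.circuits}
  zero_notMem h := by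
    have h0 : reorientVec R (0 : E → SignType) = 0 := by
      funext e
      simp [reorientVec]
    rw [Set.mem_ofPred_eq, h0] at h
    exact M.zero_notMem h
  neg_mem X hX := by
    rw [Set.mem_ofPred_eq, reorientVec_neg]
    exact M.neg_mem _ hX
  incomparable X hX Y hY h := by
    have h1 := M.incomparable _ hX _ hY (fun e he => by
      rw [reorientVec_ne_zero] at he ⊢
      exact h e he)
    rcases h1 with h1 | h1
    · left
      rw [← reorientVec_reorientVec R X, h1, reorientVec_reorientVec]
    · right
      rw [← reorientVec_reorientVec R X, h1, ← reorientVec_neg, reorientVec_reorientVec]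
  elimination X hX Y hY hXY e hXe hYe := by
    obtain ⟨Z, hZ, hZe, hZf⟩ := M.elimination_symm _ _ hX hY
      (fun h => hXY (by
        rw [← reorientVec_reorientVec R X, h, ← reorientVec_neg, reorientVec_reorientVec])) e
      (by rw [reorientVec_ne_zero, hXe]; decide)
      (by simp only [reorientVec, hXe, hYe]; split_ifs <;> rfl)
    refine ⟨reorientVec R Z, ?_, ?_, fun f => ?_⟩
    · rw [Set.mem_ofPred_eq, reorientVec_reorientVec]
      exact hZ
    · simp [reorientVec, hZe]
    · have h := hZf f
      simp only [reorientVec] at h ⊢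
      revert h
      generalize X f = x
      generalize Y f = y
      generalize Z f = z
      split_ifs
      · revert x y z
        decide
      · revert x y z
        decide

/-- The reorientation class `[M]`: all oriented matroids that are reorientations of `M`. -/
def reorientationClass {E : Type*} [DecidableEq E] (M : OrientedMatroid E) :
    Set (OrientedMatroid E) :=
  {M' | ∃ R : Finset E, M' = M.reorient R}

/-- `M` is `k`-neighborly: every circuit has more than `k` positive and more than `k` negative
elements. -/
def IsNeighborly {E : Type*} [Fintype E] (M : OrientedMatroid E) (k : ℕ) : Prop :=
  ∀ X ∈ M.circuits, k < #{e | X e = 1} ∧ k < #{e | X e = -1}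

/-- `f_M(r, n, k)`: the number of sets `R` such that the reorientation of `M` on `R` is
`k`-neighborly. -/
noncomputable def numNeighborly {E : Type*} [Fintype E] [DecidableEq E]
    (M : OrientedMatroid E) (k : ℕ) : ℕ :=
  {R : Finset E | (M.reorient R).IsNeighborly k}.ncard

/-- `S` contains no circuit. -/
def Indep {E : Type*} (M : OrientedMatroid E) (S : Finset E) : Prop :=
  ∀ X ∈ M.circuits, ∃ e, X e ≠ 0 ∧ e ∉ S

/-- Bases are the maximal sets that contain no circuit. -/
def IsBase {E : Type*} (M : OrientedMatroid E) (B : Finset E) : Prop :=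
  Maximal M.Indep B

/-- `M` has rank `r`: `r` is the size of a largest set that contains no circuit. -/
def HasRank {E : Type*} (M : OrientedMatroid E) (r : ℕ) : Prop :=
  IsGreatest {m : ℕ | ∃ S : Finset E, M.Indep S ∧ #S = m} r

/-- `M` is uniform of rank `r`. -/
def IsUniform {E : Type*} [Fintype E] (M : OrientedMatroid E) (r : ℕ) : Prop :=
  M.HasRank r ∧ ∀ X ∈ M.circuits, #{e | X e ≠ 0} = r + 1

/-- `χ` is a basis orientation (chirotope) of `M`: an alternating sign map on `r`-tuples whose
nonzero values are at the ordered bases of `M`, and which satisfies the pivoting rule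
`χ(f, x₂, …, x_r) = - X(e) X(f) χ(e, x₂, …, x_r)` for any two ordered bases that differ in one
position, where `X` is a circuit with support inside `{e, f, x₂, …, x_r}`. -/
structure IsBasisOrientation {E : Type*} [DecidableEq E] (M : OrientedMatroid E) {r : ℕ}
    (χ : (Fin r → E) → SignType) : Prop where
  alternating : ∀ (x : Fin r → E) (i j : Fin r), i ≠ j → χ (x ∘ Equiv.swap i j) = -χ x
  ne_zero_iff : ∀ x : Fin r → E,
    χ x ≠ 0 ↔ Function.Injective x ∧ M.IsBase (univ.image x)
  pivot : ∀ (x : Fin r → E) (i : Fin r) (f : E), f ≠ x i →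
    χ x ≠ 0 → χ (Function.update x i f) ≠ 0 →
    ∀ X ∈ M.circuits, (∀ g, X g ≠ 0 → g = f ∨ g ∈ Set.range x) →
      χ (Function.update x i f) = -(X (x i) * X f) * χ x

/-- `M` is a Lawrence oriented matroid of rank `r` on the ordered set of `n` elements: a uniform
oriented matroid with a chirotope `χ` such that `χ(j₁, …, j_r) = ∏ a_{i, j_i}` for all
`j₁ < ⋯ < j_r`, for some `r × n` matrix `A = (a_{i,j})` with entries `±1`. -/
def IsLOM {n : ℕ} (M : OrientedMatroid (Fin n)) (r : ℕ) : Prop :=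
  M.IsUniform r ∧ ∃ (A : Matrix (Fin r) (Fin n) SignType) (χ : (Fin r → Fin n) → SignType),
    (∀ i j, A i j ≠ 0) ∧ M.IsBasisOrientation χ ∧
    ∀ j : Fin r → Fin n, StrictMono j → χ j = ∏ i, A i (j i)

/-- `X` is an alternating sign vector with support `{s₀ < s₁ < ⋯ < s_r}`. -/
def IsAlternatingVec (r n : ℕ) (X : Fin n → SignType) : Prop :=
  ∃ s : Fin (r + 1) → Fin n, StrictMono s ∧ (∀ e, X e ≠ 0 ↔ e ∈ Set.range s) ∧
    ∀ i : Fin r, X (s i.succ) = -X (s i.castSucc)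

/-- The same with indices in `ℕ` and an explicit sign. -/
theorem IsAlternatingVec.exists_nat {r n : ℕ} {X : Fin n → SignType}
    (h : IsAlternatingVec r n X) :
    ∃ (s : ℕ → Fin n) (a : SignType), a ≠ 0 ∧ (∀ i j, i < j → j ≤ r → s i < s j) ∧
      (∀ e, X e ≠ 0 ↔ ∃ i ≤ r, s i = e) ∧ ∀ i ≤ r, X (s i) = a * (-1) ^ i := by
  obtain ⟨s, hs, hsup, halt⟩ := h
  have hv : ∀ i, i ≤ r → min i r = i := fun i hi => min_eq_left hi
  refine ⟨fun i => s ⟨min i r, by omega⟩, X (s 0), (hsup _).2 ⟨0, rfl⟩, ?_, ?_, ?_⟩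
  · intro i j hij hj
    apply hs
    rw [Fin.mk_lt_mk]
    omega
  · intro e
    rw [hsup]
    constructor
    · rintro ⟨i, rfl⟩
      have e0 : (⟨min (i : ℕ) r, by omega⟩ : Fin (r + 1)) = i := by
        ext
        simp only
        omega
      refine ⟨i, by omega, ?_⟩
      simp only
      rw [e0]
    · rintro ⟨i, -, rfl⟩
      exact ⟨_, rfl⟩
  · intro i
    induction i with
    | zero => intro _; simp
    | succ i ih =>
      intro hi
      have h1 := halt ⟨i, by omega⟩
      have h2 := ih (by omega)
      have e1 : (⟨min (i + 1) r, by omega⟩ : Fin (r + 1)) = Fin.succ ⟨i, by omega⟩ := by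
        ext
        simp only [Fin.val_succ]
        omega
      have e2 : (⟨min i r, by omega⟩ : Fin (r + 1)) = Fin.castSucc ⟨i, by omega⟩ := by
        ext
        simp only [Fin.val_castSucc]
        omega
      simp only [e2] at h2
      simp only [e1]
      rw [h1, h2, pow_succ]
      simp

/-- An increasing sequence `u` of length `r + 1` carries an alternating sign vector. -/
theorem exists_isAlternatingVec {r n : ℕ} (u : ℕ → Fin n) (a : SignType) (ha : a ≠ 0)
    (hu : ∀ i, i < r → u i < u (i + 1)) :
    ∃ Z, IsAlternatingVec r n Z ∧ ∀ f, Z f ≠ 0 → ∃ i ≤ r, f = u i ∧ Z f = a * (-1) ^ i := by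
  classical
  have hmono : StrictMono (fun i : Fin (r + 1) => u i) := by
    rw [Fin.strictMono_iff_lt_succ]
    intro i
    exact hu i i.2
  have hne : ∀ i : ℕ, a * (-1) ^ i ≠ 0 := fun i =>
    mul_ne_zero ha (pow_ne_zero _ (by decide))
  let Z : Fin n → SignType := fun f =>
    if h : ∃ i : Fin (r + 1), u i = f then a * (-1) ^ (h.choose : ℕ) else 0
  have hZ : ∀ i : Fin (r + 1), Z (u i) = a * (-1) ^ (i : ℕ) := by
    intro i
    have h : ∃ j : Fin (r + 1), u j = u i := ⟨i, rfl⟩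
    have h2 : h.choose = i := hmono.injective h.choose_spec
    simp only [Z]
    rw [dif_pos h, h2]
  have hZ0 : ∀ f, Z f ≠ 0 → ∃ i : Fin (r + 1), u i = f := by
    intro f hf
    by_contra h
    exact hf (dif_neg h)
  refine ⟨Z, ⟨fun i => u i, hmono, ?_, ?_⟩, ?_⟩
  · intro e
    constructor
    · exact hZ0 e
    · rintro ⟨i, rfl⟩
      simp only
      rw [hZ]
      exact hne i
  · intro i
    simp only
    rw [hZ, hZ, Fin.val_succ, Fin.val_castSucc, pow_succ]
    simp
  · intro f hf
    obtain ⟨i, rfl⟩ := hZ0 f hf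
    exact ⟨i, by omega, rfl, hZ i⟩

/-- Elimination for alternating sign vectors when the common element comes later in `Y`. -/
theorem alternating_elim_aux {r n : ℕ} {X Y : Fin n → SignType} {s t : ℕ → Fin n}
    {a b : SignType} (hb : b ≠ 0)
    (hs : ∀ i j, i < j → j ≤ r → s i < s j) (ht : ∀ i j, i < j → j ≤ r → t i < t j)
    (hX : ∀ i ≤ r, X (s i) = a * (-1) ^ i) (hY : ∀ i ≤ r, Y (t i) = b * (-1) ^ i)
    {p q : ℕ} (hp : p < q) (hq : q ≤ r) (hpq : s p = t q)
    (he : b * (-1) ^ q = -(a * (-1) ^ p)) :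
    ∃ Z, IsAlternatingVec r n Z ∧ Z (s p) = 0 ∧ ∀ f, Z f ≠ 0 → Z f = X f ∨ Z f = Y f := by
  let u : ℕ → Fin n := fun i => if i < q then t i else s (i - q + p + 1)
  obtain ⟨Z, hZ, hZu⟩ := exists_isAlternatingVec (r := r) u b hb (by
    intro i hi
    simp only [u]
    split_ifs with h1 h2 h2
    · exact ht _ _ (by omega) (by omega)
    · calc t i < t q := ht _ _ h1 hq
        _ = s p := hpq.symm
        _ < _ := hs _ _ (by omega) (by omega)
    · omega
    · exact hs _ _ (by omega) (by omega))
  refine ⟨Z, hZ, ?_, ?_⟩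
  · by_contra h
    obtain ⟨i, hi, h1, -⟩ := hZu _ h
    simp only [u] at h1
    split_ifs at h1 with h2
    · rw [hpq] at h1
      exact (ht _ _ h2 hq).ne' h1
    · exact (hs p (i - q + p + 1) (by omega) (by omega)).ne h1
  · intro f hf
    obtain ⟨i, hi, rfl, h2⟩ := hZu f hf
    rw [h2]
    simp only [u]
    split_ifs with h3
    · right
      rw [hY i hi]
    · left
      rw [hX _ (by omega)]
      have e1 : i = q + (i - q) := by omega
      have e2 : i - q + p + 1 = p + ((i - q) + 1) := by omega
      rw [e2]
      conv_lhs => rw [e1]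
      rw [pow_add, pow_add, ← mul_assoc, ← mul_assoc, he, pow_succ]
      simp

/-- Elimination for alternating sign vectors when the common element has the same position in
both. -/
theorem alternating_elim_aux' {r n : ℕ} {X Y : Fin n → SignType} {s t : ℕ → Fin n}
    {a b : SignType} (ha : a ≠ 0)
    (hs : ∀ i j, i < j → j ≤ r → s i < s j) (ht : ∀ i j, i < j → j ≤ r → t i < t j)
    (hX : ∀ i ≤ r, X (s i) = a * (-1) ^ i) (hY : ∀ i ≤ r, Y (t i) = b * (-1) ^ i)
    {p d : ℕ} (hp : p ≤ r) (hpq : s p = t p) (hd : d ≤ r) (hsd : s d < t d) (he : b = -a) :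
    ∃ Z, IsAlternatingVec r n Z ∧ Z (s p) = 0 ∧ ∀ f, Z f ≠ 0 → Z f = X f ∨ Z f = Y f := by
  have hdp : d ≠ p := by
    rintro rfl
    rw [hpq] at hsd
    exact lt_irrefl _ hsd
  rcases lt_or_gt_of_ne hdp with hlt | hgt
  · let u : ℕ → Fin n := fun i => if i ≤ d then s i else if i ≤ p then t (i - 1) else s i
    obtain ⟨Z, hZ, hZu⟩ := exists_isAlternatingVec (r := r) u a ha (by
      intro i hi
      simp only [u]
      split_ifs with h1 h2 h3 h4 h5 h6
      · exact hs _ _ (by omega) (by omega)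
      · have : i = d := by omega
        subst this
        simpa using hsd
      · omega
      · omega
      · exact ht _ _ (by omega) (by omega)
      · have : i = p := by omega
        subst this
        calc t (i - 1) < t i := ht _ _ (by omega) hp
          _ = s i := hpq.symm
          _ < _ := hs _ _ (by omega) (by omega)
      · omega
      · omega
      · exact hs _ _ (by omega) (by omega))
    refine ⟨Z, hZ, ?_, ?_⟩
    · by_contra h
      obtain ⟨i, hi, h1, -⟩ := hZu _ h
      simp only [u] at h1
      split_ifs at h1 with h2 h3
      · exact (hs i p (by omega) hp).ne' h1
      · rw [hpq] at h1
        exact (ht (i - 1) p (by omega) hp).ne' h1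
      · exact (hs p i (by omega) hi).ne h1
    · intro f hf
      obtain ⟨i, hi, rfl, h2⟩ := hZu f hf
      rw [h2]
      simp only [u]
      split_ifs with h3 h4
      · left
        rw [hX i hi]
      · right
        rw [hY _ (by omega), he]
        have e1 : i = (i - 1) + 1 := by omega
        conv_lhs => rw [e1, pow_succ]
        simp
      · left
        rw [hX i hi]
  · let u : ℕ → Fin n := fun i => if i < p then t i else if i < d then s (i + 1) else t i
    obtain ⟨Z, hZ, hZu⟩ := exists_isAlternatingVec (r := r) u b
      (by
        have hneg : ∀ x : SignType, x ≠ 0 → -x ≠ 0 := by decide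
        rw [he]
        exact hneg a ha) (by
      intro i hi
      simp only [u]
      split_ifs with h1 h2 h3 h4 h5 h6
      · exact ht _ _ (by omega) (by omega)
      · calc t i < t p := ht _ _ (by omega) hp
          _ = s p := hpq.symm
          _ < _ := hs _ _ (by omega) (by omega)
      · omega
      · omega
      · exact hs _ _ (by omega) (by omega)
      · have : i + 1 = d := by omega
        rw [this]
        exact hsd
      · omega
      · omega
      · exact ht _ _ (by omega) (by omega))
    refine ⟨Z, hZ, ?_, ?_⟩
    · by_contra h
      obtain ⟨i, hi, h1, -⟩ := hZu _ h
      simp only [u] at h1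
      split_ifs at h1 with h2 h3
      · rw [hpq] at h1
        exact (ht i p (by omega) hp).ne' h1
      · exact (hs p (i + 1) (by omega) (by omega)).ne h1
      · rw [hpq] at h1
        exact (ht p i (by omega) hi).ne h1
    · intro f hf
      obtain ⟨i, hi, rfl, h2⟩ := hZu f hf
      rw [h2]
      simp only [u]
      split_ifs with h3 h4
      · right
        rw [hY i hi]
      · left
        rw [hX _ (by omega), he, pow_succ]
        simp
      · right
        rw [hY i hi]

/-- The alternating oriented matroid `C_r(n)`: its circuits are all the alternating sign vectors
with support of size `r + 1`. -/
def alternating (r n : ℕ) : OrientedMatroid (Fin n) where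
  circuits := {X | IsAlternatingVec r n X}
  zero_notMem := by
    rintro ⟨s, -, h, -⟩
    exact (h (s 0)).2 ⟨0, rfl⟩ rfl
  neg_mem := by
    rintro X ⟨s, hs, h, halt⟩
    refine ⟨s, hs, fun e => ?_, fun i => ?_⟩
    · rw [← h, Pi.neg_apply]
      generalize X e = a
      revert a
      decide
    · simp [halt]
  incomparable := by
    rintro X ⟨s, hs, h, halt⟩ Y ⟨t, ht, h', halt'⟩ hXY
    have hsub : Set.range s ⊆ Set.range t := fun e he => (h' e).1 (hXY e ((h e).2 he))
    have hst : Set.range s = Set.range t := by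
      apply Set.eq_of_subset_of_ncard_le hsub _ (Set.finite_range t)
      rw [← Set.image_univ, ← Set.image_univ, Set.ncard_image_of_injective _ hs.injective,
        Set.ncard_image_of_injective _ ht.injective]
    obtain rfl : s = t := (hs.range_inj ht).1 hst
    have hc : ∀ x y : SignType, x ≠ 0 → y ≠ 0 → x = y ∨ x = -y := by decide
    rcases hc (X (s 0)) (Y (s 0)) ((h _).2 ⟨0, rfl⟩) ((h' _).2 ⟨0, rfl⟩) with h0 | h0
    · left
      have hall : ∀ i, X (s i) = Y (s i) := by
        intro i
        induction i using Fin.induction with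
        | zero => exact h0
        | succ i ih => rw [halt, halt', ih]
      funext e
      by_cases he : e ∈ Set.range s
      · obtain ⟨i, rfl⟩ := he
        exact hall i
      · have h1 := mt (h e).1 he
        have h2 := mt (h' e).1 he
        push Not at h1 h2
        rw [h1, h2]
    · right
      have hall : ∀ i, X (s i) = -Y (s i) := by
        intro i
        induction i using Fin.induction with
        | zero => exact h0
        | succ i ih => rw [halt, halt', ih]
      funext e
      by_cases he : e ∈ Set.range s
      · obtain ⟨i, rfl⟩ := he
        exact hall i
      · have h1 := mt (h e).1 he
        have h2 := mt (h' e).1 he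
        push Not at h1 h2
        rw [Pi.neg_apply, h1, h2]
        rfl
  elimination := by
    intro X hX Y hY hXY e hXe hYe
    obtain ⟨s, a, ha, hs, hsup, hXs⟩ := IsAlternatingVec.exists_nat hX
    obtain ⟨t, b, hb, ht, htup, hYt⟩ := IsAlternatingVec.exists_nat hY
    obtain ⟨p, hp, hpe⟩ := (hsup e).1 (by rw [hXe]; decide)
    obtain ⟨q, hq, hqe⟩ := (htup e).1 (by rw [hYe]; decide)
    have h1 : a * (-1) ^ p = 1 := by rw [← hXs p hp, hpe, hXe]
    have h2 : b * (-1) ^ q = -1 := by rw [← hYt q hq, hqe, hYe]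
    have key : ∃ Z, IsAlternatingVec r n Z ∧ Z e = 0 ∧
        ∀ f, Z f ≠ 0 → Z f = X f ∨ Z f = Y f := by
      rcases lt_trichotomy p q with hlt | heq | hgt
      · have := alternating_elim_aux hb hs ht hXs hYt hlt hq (hpe.trans hqe.symm)
          (by rw [h1, h2])
        rwa [hpe] at this
      · subst heq
        have hab : b = -a := by
          have hk : ∀ x y c : SignType, x * c = 1 → y * c = -1 → y = -x := by decide
          exact hk _ _ _ h1 h2
        have hex : ∃ d ≤ r, s d ≠ t d := by
          by_contra hno
          push Not at hno
          apply hXY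
          funext f
          rw [Pi.neg_apply]
          by_cases hf : X f = 0
          · have : Y f = 0 := by
              by_contra hy
              obtain ⟨i, hi, rfl⟩ := (htup f).1 hy
              exact (hsup _).2 ⟨i, hi, hno i hi⟩ hf
            rw [hf, this]
            rfl
          · obtain ⟨i, hi, rfl⟩ := (hsup f).1 hf
            rw [hXs i hi, hno i hi, hYt i hi, hab]
            simp
        obtain ⟨d, hd, hne⟩ := hex
        rcases lt_or_gt_of_ne hne with hl | hg
        · have := alternating_elim_aux' ha hs ht hXs hYt hp (hpe.trans hqe.symm) hd hl hab
          rwa [hpe] at this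
        · obtain ⟨Z, hZ, hZe, hZf⟩ := alternating_elim_aux' hb ht hs hYt hXs hp
            (hqe.trans hpe.symm) hd hg (by rw [hab, neg_neg])
          rw [hqe] at hZe
          exact ⟨Z, hZ, hZe, fun f hf => (hZf f hf).symm⟩
      · obtain ⟨Z, hZ, hZe, hZf⟩ := alternating_elim_aux ha ht hs hYt hXs hgt hp
          (hqe.trans hpe.symm) (by rw [h1, h2]; rfl)
        rw [hqe] at hZe
        exact ⟨Z, hZ, hZe, fun f hf => (hZf f hf).symm⟩
    obtain ⟨Z, hZ, hZe, hZf⟩ := key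
    refine ⟨Z, hZ, hZe, fun f => ?_⟩
    have h := hZf f
    revert h
    generalize X f = x
    generalize Y f = y
    generalize Z f = z
    revert x y z
    decide

/-- `c_r(n, k)`: the number of `k`-neighborly reorientations of `C_r(n)`. -/
noncomputable def cyclicCount (r n k : ℕ) : ℕ := (alternating r n).numNeighborly k

/-- The reorientation classes, other than that of `C_r(n)`, of rank `r` Lawrence oriented
matroids on `n` elements with exactly `c_r(n, k)` `k`-neighborly reorientations. -/
def extremalClasses (r n k : ℕ) : Set (Set (OrientedMatroid (Fin n))) :=
  {K | ∃ M : OrientedMatroid (Fin n), M.IsLOM r ∧ M ∉ (alternating r n).reorientationClass ∧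
    M.numNeighborly k = cyclicCount r n k ∧ K = M.reorientationClass}

end OrientedMatroid

/-!
A Lawrence oriented matroid of rank `9` on `n = 10 + q` elements is described by a sign matrix `a`
with rows `0, …, 8`. By the pivoting rule (`circuits_of_isBasisOrientation`) its circuits are
supported on all sets `x 0 < ⋯ < x 9`, and neighboring elements of a circuit satisfy
`X (x (m + 1)) = - a m (x m) * a m (x (m + 1)) * X (x m)`. So scaling rows of `a` changes nothing,
scaling columns reorients, and only the entries with `i ≤ c ≤ i + q + 1` in row `i` matter. Hence
`f_M(9, n, k)` is the number of column scalings for which every circuit has at most `9 - k` elements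
of each sign (`numNeighborly_eq_goodCount`), and the reorientation class is determined by, and
determines, the products of entries over the `2 × 2` squares in that band
(`exists_scaling_of_square_eq`, `square_eq_of_isLawrenceVec_iff`).

In each of the three cases the number of good scalings is at most its value for the alternating
oriented matroid, with equality exactly if all squares in a column agree (`SquaresAgree`). This is
established by evaluating a program on all matrices up to scaling and symmetry. The program scans
the columns and keeps track of which pairs, of a number of chosen elements with the number of
positive ones among them, occur with which pending sign. It is run for `2 ^ 13` matrices at once,
and for several column scalings, by encoding sets of matrices and scalings as the binary digits of
natural numbers (`boardCheck`, correct by `goodCount_of_boardCheck`).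

* For `n = 12` a matrix in normal form has `16` free entries, which gives eight runs.
* For `n = 13` there are `24` free entries. Flipping the odd rows in one of the first columns
  permutes the sets of states that are reached after four columns (`columnMasks_triangle`), so it
  changes some squares but not the number of good scalings. Together with the symmetry under a half
  turn of the matrix this allows to prescribe most squares near both ends (`exists_hasReducedEnds`).

If all squares in a column agree, then up to scaling the matrix is constant in some columns and
alternates along the others (`exists_columnSet`). Such a matrix belongs to the alternating oriented
matroid with its elements renamed: the columns that alternate are moved behind the others in reverse
order (`folded`). There are `q + 7` columns with squares, so this gives `2 ^ (q + 7)` classes,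
distinct by their squares (`columnSet_injective`), and one of them is the alternating class.
-/

/-! ### Bit-parallel dynamic programming -/

/-- Adds a new top index bit on which the bitset `x`, indexed by `s` bits, does not depend. -/
def dupBits (s x : ℕ) : ℕ := x ||| x <<< 2 ^ s

/-- The full bitset over the indices with `s` bits. -/
def oneBits : ℕ → ℕ
  | 0 => 1
  | s + 1 => dupBits s (oneBits s)

/-- The bitset of the indices with `s + 1` bits whose top bit is set. -/
def newBit (s : ℕ) : ℕ := oneBits s <<< 2 ^ s

/-- The bitset of the indices with `k` bits whose bit `j` is set. -/
def varBits : ℕ → ℕ → ℕ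
  | 0, _ => 0
  | k + 1, j => bif j == k then newBit k else dupBits k (varBits k j)

/-- Adds `m` top index bits. -/
def liftBits (s : ℕ) : ℕ → ℕ → ℕ
  | 0, x => x
  | m + 1, x => dupBits (s + m) (liftBits s m x)

/-- The elements of the bitset `g` at which the bitsets `a` and `b` differ. -/
def diffOn (g a b : ℕ) : ℕ := (a ^^^ b) &&& g

/-- The recursion of `appendRow`; the carry `s` is the bitset of the indices at which the
previous entry gives a pattern with a positive last element. -/
def appendGo (g h : ℕ) : ℕ → List (ℕ × ℕ) → List (ℕ × ℕ)
  | s, [] => [(diffOn h s 0, s ^^^ diffOn h s 0)]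
  | s, ab :: l =>
    ((ab.2 ^^^ diffOn g ab.1 ab.2) ^^^ diffOn h s (ab.2 ^^^ diffOn g ab.1 ab.2),
      s ^^^ diffOn h s (ab.2 ^^^ diffOn g ab.1 ab.2)) ::
      appendGo g h (ab.1 ^^^ diffOn g ab.1 ab.2) l

/-- The effect of choosing a column on a row of the state. A row is a list whose `j`-th entry
consists of two bitsets: the indices at which there is a pattern with the `j`-th number of
positive elements and pending sign `false`, or `true`. A chosen element is positive if the pending
sign agrees with the bit of `g`; the new pending sign is the exclusive or of its sign and the bit
of `h`. The number of positive elements stays the same or increases by one, so the result has one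
more entry. -/
def appendRow (g h : ℕ) : List (ℕ × ℕ) → List (ℕ × ℕ)
  | [] => []
  | ab :: l => appendGo g h 0 (ab :: l)

/-- The union of two rows, entry by entry. -/
def orRow : List (ℕ × ℕ) → List (ℕ × ℕ) → List (ℕ × ℕ)
  | [], l => l
  | a :: l, [] => a :: l
  | a :: l, b :: l' => (a.1 ||| b.1, a.2 ||| b.2) :: orRow l l'

/-- The indices that occur in the first or in the last entry of a row. -/
def rowEnds (l : List (ℕ × ℕ)) : ℕ :=
  ((l.getD 0 (0, 0)).1 ||| (l.getD 0 (0, 0)).2) |||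
    ((l.getD (l.length - 1) (0, 0)).1 ||| (l.getD (l.length - 1) (0, 0)).2)

/-- A row without its first and its last entry. -/
def rowMiddle (l : List (ℕ × ℕ)) : List (ℕ × ℕ) := l.tail.dropLast

/-- The data of a column that concern the patterns with a given number `t` of chosen elements. The
column may be skipped if `keep` holds, as enough columns remain to complete the pattern. If `trim`
holds, then after one more choice the extreme numbers of positive elements are unbalanced.
The entries of the column in the rows of the previous and of the next pair of neighbors in a
circuit are the bitsets `cur` and `next`. -/
structure Cell where
  keep : Bool
  trim : Bool
  cur : ℕ
  next : ℕ

/-- The row of the balanced patterns obtained by choosing the column. -/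
def Cell.advance (m : Cell) (s : List (ℕ × ℕ)) : List (ℕ × ℕ) :=
  bif m.trim then rowMiddle (appendRow m.cur m.next s) else appendRow m.cur m.next s

/-- The state after a column: each row is the union of the patterns that skip the column and of
those from the row before, passed in as `prev`, that choose it. -/
def stepRows : List (ℕ × ℕ) → List Cell → List (List (ℕ × ℕ)) → List (List (ℕ × ℕ))
  | prev, m :: ms, s :: ss =>
    orRow (bif m.keep then s else []) prev :: stepRows (m.advance s) ms ss
  | _, [], _ => []
  | _, _ :: _, [] => []

/-- The indices at which choosing the column leads to an unbalanced pattern. -/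
def stepDead : List Cell → List (List (ℕ × ℕ)) → ℕ
  | m :: ms, s :: ss =>
    (bif m.trim then rowEnds (appendRow m.cur m.next s) else 0) ||| stepDead ms ss
  | [], _ => 0
  | _ :: _, [] => 0

/-- The column scaled at the indices in `x`. -/
def Cell.flip (x : ℕ) (m : Cell) : Cell :=
  { m with cur := m.cur ^^^ x, next := m.next ^^^ x }

/-- The column, with `i` more top index bits. -/
def Cell.lift (k i : ℕ) (m : Cell) : Cell :=
  { m with cur := liftBits k i m.cur, next := liftBits k i m.next }

/-- The state, with one more top index bit. -/
def dupState (s : ℕ) (st : List (List (ℕ × ℕ))) : List (List (ℕ × ℕ)) :=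
  st.map (List.map fun ab => (dupBits s ab.1, dupBits s ab.2))

/-- Simultaneous binary addition, with carry. A list of bitsets stands for the function whose value
at an index has the binary digits given by the bitsets, from the lowest digit on. -/
def addPlanes : ℕ → List ℕ → List ℕ → List ℕ
  | c, a :: x, b :: y => (a ^^^ b ^^^ c) :: addPlanes ((a &&& b) ||| (c &&& (a ^^^ b))) x y
  | c, [], _ => [c]
  | c, _ :: _, [] => [c]

/-- The sum over the two values of the top index bit. -/
def foldTop (s : ℕ) (pl : List ℕ) : List ℕ :=
  addPlanes 0 (pl.map fun x => x &&& oneBits s) (pl.map fun x => x >>> 2 ^ s)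

/-- The number of scalings of the remaining columns without unbalanced patterns, at all indices
with `k + i` bits at once. The lower `k` bits select the sign matrix. The next `d` columns
are scaled by a new index bit, over which the result is summed; for later columns the two scalings
are run one after the other, which bounds the size of the bitsets. -/
def runPlanes (k : ℕ) : ℕ → ℕ → List (List Cell) → ℕ → List (List (ℕ × ℕ)) → List ℕ
  | i, _, [], dead, _ => [dead ^^^ oneBits (k + i)]
  | i, 0, col :: cols, dead, st =>
    addPlanes 0
      (runPlanes k i 0 cols (dead ||| stepDead (col.map (Cell.lift k i)) st)
        (stepRows [] (col.map (Cell.lift k i)) st))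
      (runPlanes k i 0 cols
        (dead ||| stepDead (col.map fun m => (m.lift k i).flip (oneBits (k + i))) st)
        (stepRows [] (col.map fun m => (m.lift k i).flip (oneBits (k + i))) st))
  | i, d + 1, col :: cols, dead, st =>
    foldTop (k + i) (runPlanes k (i + 1) d cols
      (dupBits (k + i) dead |||
        stepDead (col.map fun m => (m.lift k (i + 1)).flip (newBit (k + i))) (dupState (k + i) st))
      (stepRows [] (col.map fun m => (m.lift k (i + 1)).flip (newBit (k + i)))
        (dupState (k + i) st)))

/-- The family of matrices `a` below a row of zeros, so that the first element of a circuit obeys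
the same rule as the others. -/
def rowEntry (a : ℕ → ℕ → ℕ) : ℕ → ℕ → ℕ
  | 0, _ => 0
  | t + 1, c => a t c

/-- The data of column `c` for the patterns with `t` chosen elements, for circuits of `10` elements
among `10 + q` with at most `N` elements of each sign. -/
def cell (q N : ℕ) (a : ℕ → ℕ → ℕ) (c t : ℕ) : Cell :=
  ⟨Nat.ble (c + 1) (t + q), Nat.ble N t, rowEntry a t c, rowEntry a (t + 1) c⟩

/-- The data of column `c` for all numbers of chosen elements. -/
def column (q N : ℕ) (a : ℕ → ℕ → ℕ) (c : ℕ) : List Cell :=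
  (List.range 10).map (cell q N a c)

/-- The number of column scalings, with the first column not scaled, under which all circuits have
at most `N` elements of each sign, for all matrices of the family `a`. -/
def countPlanes (q N k d : ℕ) (a : ℕ → ℕ → ℕ) : List ℕ :=
  runPlanes k 0 d ((List.range' 1 (9 + q)).map (column q N a))
    (stepDead (column q N a 0) ([(oneBits k, 0)] :: List.replicate 9 []))
    (stepRows [] (column q N a 0) ([(oneBits k, 0)] :: List.replicate 9 []))

/-- The indices at which a number given by its digits exceeds `C`, and those at which it
equals `C`. The accumulators hold the results of comparing the lower digits. -/
def cmpPlanes : ℕ → List ℕ → ℕ → ℕ → ℕ × ℕ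
  | _, [], gt, eq => (gt, eq)
  | C, x :: l, gt, eq =>
    bif C.testBit 0 then cmpPlanes (C / 2) l (gt &&& x) (eq &&& x)
    else cmpPlanes (C / 2) l (gt ||| x) (eq ^^^ (eq &&& x))

/-- The matrices of the family with an odd number of `true` entries in rows `i`, `i + 1` and columns
`c`, `c + 1`. -/
def squareBits (a : ℕ → ℕ → ℕ) (i c : ℕ) : ℕ :=
  (a i c ^^^ a (i + 1) c) ^^^ (a i (c + 1) ^^^ a (i + 1) (c + 1))

/-- The matrices of the family for which some vertically adjacent squares differ. -/
def breakBits (q : ℕ) (a : ℕ → ℕ → ℕ) : ℕ :=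
  ((List.range 7).map fun i => ((List.range (q - 1)).map fun j =>
    squareBits a i (i + j + 2) ^^^ squareBits a (i + 1) (i + j + 2)).foldr (· ||| ·) 0).foldr
      (· ||| ·) 0

/-- No matrix of the family `a` has more than `C` scalings counted by `countPlanes`, and exactly
those with agreeing squares have `C`. -/
def boardCheck (q N k d C : ℕ) (a : ℕ → ℕ → ℕ) : Bool :=
  let r := cmpPlanes C (countPlanes q N k d a) 0 (oneBits k)
  r.1 == 0 && r.2 ^^^ breakBits q a == oneBits k

/-! ### Sign patterns of the circuits, column by column -/

/-- All completions of a partial sign pattern have at most `N` elements of each sign. The columns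
from `c` on have scalings given by the list; `t` elements have been chosen, `p` of them
positive, and `Y` is the exclusive or of the sign of the last one and its scaled entry in the
matrix row that links it to the next one. A pattern with fewer than `10` elements is no circuit and
is ignored. -/
def AllBalanced (N : ℕ) (g : ℕ → ℕ → Bool) : List Bool → ℕ → ℕ → ℕ → Bool → Prop
  | [], _, t, p, _ => t = 10 → p ≤ N ∧ 10 ≤ p + N
  | e :: es, c, t, p, Y => AllBalanced N g es (c + 1) t p Y ∧
      (t < 10 → AllBalanced N g es (c + 1) (t + 1) (p + (!(Y ^^ g t c ^^ e)).toNat)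
        (!(Y ^^ g t c ^^ e) ^^ g (t + 1) c ^^ e))

theorem allBalanced_of_short {N : ℕ} {g : ℕ → ℕ → Bool} {es : List Bool} {c t p : ℕ} {Y : Bool}
    (h : t + es.length < 10) : AllBalanced N g es c t p Y := by
  induction es generalizing c t p Y with
  | nil => intro h'; simp at h; omega
  | cons e es ih =>
    simp only [List.length_cons] at h
    exact ⟨ih (by omega), fun _ => ih (by omega)⟩

theorem allBalanced_ten_iff {N : ℕ} {g : ℕ → ℕ → Bool} {es : List Bool} {c p : ℕ} {Y : Bool} :
    AllBalanced N g es c 10 p Y ↔ p ≤ N ∧ 10 ≤ p + N := by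
  induction es generalizing c with
  | nil => simp [AllBalanced]
  | cons e es ih => simp [AllBalanced, ih]

/-- A partial sign pattern with too many entries of one sign that can still be completed has an
unbalanced completion. -/
theorem not_allBalanced_of_unbalanced {N : ℕ} {g : ℕ → ℕ → Bool} {es : List Bool} {c t p : ℕ}
    {Y : Bool} (h : N < p ∨ p + N < t) (ht : t ≤ 10) (hes : 10 ≤ t + es.length) :
    ¬ AllBalanced N g es c t p Y := by
  induction es generalizing c t p Y with
  | nil =>
    intro h'
    simp only [List.length_nil] at hes
    have := h' (by omega)
    omega
  | cons e es ih =>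
    simp only [List.length_cons] at hes
    rintro ⟨h1, h2⟩
    rcases ht.lt_or_eq with ht' | rfl
    · refine ih ?_ (by omega) (by omega) (h2 ht')
      have := Bool.toNat_le (!(Y ^^ g t c ^^ e))
      omega
    · exact ih h le_rfl (by omega) h1

/-! ### Correctness of the bit-parallel program -/

theorem dupBits_lt {s x : ℕ} (h : x < 2 ^ 2 ^ s) : dupBits s x < 2 ^ 2 ^ (s + 1) := by
  have h2 : 2 ^ (s + 1) = 2 ^ s + 2 ^ s := by ring
  rw [h2]
  apply Nat.or_lt_two_pow
  · exact h.trans_le (Nat.pow_le_pow_right (by norm_num) (Nat.le_add_right _ _))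
  · rw [Nat.shiftLeft_eq, pow_add]
    exact Nat.mul_lt_mul_of_pos_right h (by positivity)

theorem testBit_dupBits {s x y : ℕ} (h : x < 2 ^ 2 ^ s) (hy : y < 2 ^ (s + 1)) :
    (dupBits s x).testBit y = x.testBit (y % 2 ^ s) := by
  have h2 : 2 ^ (s + 1) = 2 ^ s + 2 ^ s := by ring
  rw [dupBits, Nat.testBit_or, Nat.testBit_shiftLeft]
  rcases lt_or_ge y (2 ^ s) with hlt | hge
  · rw [Nat.mod_eq_of_lt hlt]
    simp [hlt]
  · have h3 : y % 2 ^ s = y - 2 ^ s := by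
      rw [Nat.mod_eq_sub_mod hge, Nat.mod_eq_of_lt (by omega)]
    rw [h3, Nat.testBit_lt_two_pow (h.trans_le (Nat.pow_le_pow_right (by norm_num) hge))]
    simp [hge]

theorem oneBits_lt (s : ℕ) : oneBits s < 2 ^ 2 ^ s := by
  induction s with
  | zero => simp [oneBits]
  | succ s ih => exact dupBits_lt ih

theorem testBit_oneBits {s y : ℕ} (hy : y < 2 ^ s) : (oneBits s).testBit y = true := by
  induction s generalizing y with
  | zero =>
    obtain rfl : y = 0 := by simpa using hy
    rfl
  | succ s ih =>
    rw [oneBits, testBit_dupBits (oneBits_lt s) hy]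
    exact ih (Nat.mod_lt _ (by positivity))

theorem newBit_lt (s : ℕ) : newBit s < 2 ^ 2 ^ (s + 1) := by
  have h2 : 2 ^ (s + 1) = 2 ^ s + 2 ^ s := by ring
  rw [h2, newBit, Nat.shiftLeft_eq, pow_add]
  exact Nat.mul_lt_mul_of_pos_right (oneBits_lt s) (by positivity)

theorem testBit_newBit {s y : ℕ} (hy : y < 2 ^ (s + 1)) :
    (newBit s).testBit y = y.testBit s := by
  have h2 : 2 ^ (s + 1) = 2 ^ s + 2 ^ s := by ring
  rw [newBit, Nat.testBit_shiftLeft]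
  rcases lt_or_ge y (2 ^ s) with hlt | hge
  · rw [Nat.testBit_lt_two_pow hlt]
    simp [hlt]
  · rw [testBit_oneBits (by omega)]
    have : y.testBit s = true := by
      rw [Nat.testBit_eq_decide_div_mod_eq]
      have : y / 2 ^ s = 1 := by
        rw [Nat.div_eq_iff (by positivity)]
        omega
      simp [this]
    simp [hge, this]

theorem varBits_lt (k j : ℕ) : varBits k j < 2 ^ 2 ^ k := by
  induction k with
  | zero => simp [varBits]
  | succ k ih =>
    rw [varBits]
    rcases h : j == k
    · exact dupBits_lt ih
    · exact newBit_lt k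

theorem testBit_varBits {k j y : ℕ} (hj : j < k) (hy : y < 2 ^ k) :
    (varBits k j).testBit y = y.testBit j := by
  induction k generalizing y with
  | zero => omega
  | succ k ih =>
    rw [varBits]
    by_cases h : j = k
    · subst h
      simp [testBit_newBit hy]
    · have : (j == k) = false := by simpa using h
      rw [this, cond_false, testBit_dupBits (varBits_lt k j) hy,
        ih (by omega) (Nat.mod_lt _ (by positivity)), Nat.testBit_mod_two_pow]
      simp
      omega

theorem liftBits_lt {s x : ℕ} (h : x < 2 ^ 2 ^ s) (m : ℕ) : liftBits s m x < 2 ^ 2 ^ (s + m) := by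
  induction m with
  | zero => exact h
  | succ m ih => exact dupBits_lt ih

theorem testBit_liftBits {s x y m : ℕ} (h : x < 2 ^ 2 ^ s) (hy : y < 2 ^ (s + m)) :
    (liftBits s m x).testBit y = x.testBit (y % 2 ^ s) := by
  induction m generalizing y with
  | zero => rw [liftBits, Nat.mod_eq_of_lt (by simpa using hy)]
  | succ m ih =>
    rw [liftBits, testBit_dupBits (liftBits_lt h m) hy, ih (Nat.mod_lt _ (by positivity)),
      Nat.mod_mod_of_dvd _ (pow_dvd_pow 2 (by omega))]

/-- The bit at index `y` of the set of patterns with `j`-th number of positive entries and pending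
sign `Y`. -/
def rowBit (l : List (ℕ × ℕ)) (j : ℕ) (Y : Bool) (y : ℕ) : Bool :=
  (bif Y then (l.getD j (0, 0)).2 else (l.getD j (0, 0)).1).testBit y

@[simp] theorem rowBit_nil (j : ℕ) (Y : Bool) (y : ℕ) : rowBit [] j Y y = false := by
  cases Y <;> simp [rowBit]

@[simp] theorem rowBit_cons_zero (a : ℕ × ℕ) (l : List (ℕ × ℕ)) (Y : Bool) (y : ℕ) :
    rowBit (a :: l) 0 Y y = (bif Y then a.2 else a.1).testBit y := by
  simp [rowBit]

@[simp] theorem rowBit_cons_succ (a : ℕ × ℕ) (l : List (ℕ × ℕ)) (j : ℕ) (Y : Bool) (y : ℕ) :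
    rowBit (a :: l) (j + 1) Y y = rowBit l j Y y := by
  simp [rowBit]

theorem lt_length_of_rowBit {l : List (ℕ × ℕ)} {j : ℕ} {Y : Bool} {y : ℕ}
    (h : rowBit l j Y y = true) : j < l.length := by
  by_contra hj
  rw [rowBit, List.getD_eq_default _ _ (by omega)] at h
  cases Y <;> simp at h

theorem rowBit_appendGo (g h s : ℕ) (l : List (ℕ × ℕ)) (j : ℕ) (Y : Bool) (y : ℕ) :
    rowBit (appendGo g h s l) j Y y =
      if Y = h.testBit y then rowBit l j (!g.testBit y) y
      else if j = 0 then s.testBit y else rowBit l (j - 1) (g.testBit y) y := by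
  induction l generalizing s j with
  | nil =>
    cases j with
    | zero => cases Y <;> cases hh : h.testBit y <;> simp [appendGo, diffOn, hh]
    | succ j => simp [appendGo]
  | cons a l ih =>
    cases j with
    | zero =>
      cases Y <;> cases hh : h.testBit y <;> cases hg : g.testBit y <;>
        simp [appendGo, diffOn, hh, hg] <;>
        cases a.1.testBit y <;> cases a.2.testBit y <;> cases s.testBit y <;> rfl
    | succ j =>
      rw [appendGo, rowBit_cons_succ, ih]
      cases j with
      | zero => cases hg : g.testBit y <;> simp [diffOn, hg]
      | succ j => simp

theorem rowBit_appendRow (g h : ℕ) (l : List (ℕ × ℕ)) (j : ℕ) (Y : Bool) (y : ℕ) :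
    rowBit (appendRow g h l) j Y y =
      if Y = h.testBit y then rowBit l j (!g.testBit y) y
      else if j = 0 then false else rowBit l (j - 1) (g.testBit y) y := by
  cases l with
  | nil => simp [appendRow]
  | cons a l => rw [appendRow, rowBit_appendGo]; simp

theorem rowBit_orRow (l l' : List (ℕ × ℕ)) (j : ℕ) (Y : Bool) (y : ℕ) :
    rowBit (orRow l l') j Y y = (rowBit l j Y y || rowBit l' j Y y) := by
  induction l generalizing l' j with
  | nil => simp [orRow]
  | cons a l ih =>
    cases l' with
    | nil => simp [orRow]
    | cons b l' =>
      cases j with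
      | zero => cases Y <;> simp [orRow]
      | succ j => simp [orRow, ih]

theorem length_appendGo (g h s : ℕ) (l : List (ℕ × ℕ)) :
    (appendGo g h s l).length = l.length + 1 := by
  induction l generalizing s with
  | nil => rfl
  | cons a l ih => simp [appendGo, ih]

theorem length_appendRow (g h : ℕ) (l : List (ℕ × ℕ)) :
    (appendRow g h l).length = if l.length = 0 then 0 else l.length + 1 := by
  cases l with
  | nil => rfl
  | cons a l => simp [appendRow, length_appendGo]

theorem length_orRow (l l' : List (ℕ × ℕ)) :
    (orRow l l').length = max l.length l'.length := by
  induction l generalizing l' with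
  | nil => simp [orRow]
  | cons a l ih =>
    cases l' with
    | nil => simp [orRow]
    | cons b l' => simp [orRow, ih]

theorem testBit_rowEnds {l : List (ℕ × ℕ)} {y : ℕ} :
    (rowEnds l).testBit y = true ↔
      ∃ Y, rowBit l 0 Y y = true ∨ rowBit l (l.length - 1) Y y = true := by
  simp only [rowEnds, rowBit, Nat.testBit_or, Bool.or_eq_true, Bool.exists_bool, cond_true,
    cond_false]
  tauto

theorem rowBit_rowMiddle (l : List (ℕ × ℕ)) (j : ℕ) (Y : Bool) (y : ℕ) :
    rowBit (rowMiddle l) j Y y = (decide (j + 2 < l.length) && rowBit l (j + 1) Y y) := by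
  cases l with
  | nil => simp [rowMiddle]
  | cons a l =>
    simp only [rowMiddle, List.tail_cons, rowBit_cons_succ, List.length_cons]
    by_cases hj : j + 2 < l.length + 1
    · have : j < l.length - 1 := by omega
      simp [rowBit, List.getD_eq_getElem?_getD, hj, this,
        List.getElem?_eq_getElem (show j < l.length by omega)]
    · have : rowBit l.dropLast j Y y = false := by
        by_contra h
        have := lt_length_of_rowBit (by simpa using h)
        simp at this
        omega
      simp [this, hj]

theorem length_stepRows (prev : List (ℕ × ℕ)) (ms : List Cell) (ss : List (List (ℕ × ℕ)))
    (h : ms.length = ss.length) : (stepRows prev ms ss).length = ss.length := by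
  induction ms generalizing prev ss with
  | nil => cases ss <;> simp_all [stepRows]
  | cons m ms ih =>
    cases ss with
    | nil => simp at h
    | cons s ss => simp [stepRows, ih _ ss (by simpa using h)]

theorem getD_stepRows (prev : List (ℕ × ℕ)) (ms : List Cell) (ss : List (List (ℕ × ℕ)))
    (h : ms.length = ss.length) (t : ℕ) (ht : t < ms.length) :
    (stepRows prev ms ss).getD t [] = orRow (bif ms[t].keep then ss.getD t [] else [])
      (if h0 : t = 0 then prev else ms[t - 1].advance (ss.getD (t - 1) [])) := by
  induction ms generalizing prev ss t with
  | nil => simp at ht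
  | cons m ms ih =>
    cases ss with
    | nil => simp at h
    | cons s ss =>
      cases t with
      | zero => simp [stepRows]
      | succ t =>
        have := ih (m.advance s) ss (by simpa using h) t (by simpa using ht)
        simp only [stepRows, List.getD_cons_succ, List.getElem_cons_succ, Nat.add_sub_cancel,
          Nat.add_eq_zero_iff, one_ne_zero, and_false, dif_neg, not_false_eq_true]
        rw [this]
        cases t <;> simp

theorem testBit_stepDead (ms : List Cell) (ss : List (List (ℕ × ℕ)))
    (h : ms.length = ss.length) (y : ℕ) :
    (stepDead ms ss).testBit y = true ↔ ∃ (t : ℕ) (ht : t < ms.length), ms[t].trim = true ∧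
      (rowEnds (appendRow ms[t].cur ms[t].next (ss.getD t []))).testBit y = true := by
  induction ms generalizing ss with
  | nil => simp [stepDead]
  | cons m ms ih =>
    cases ss with
    | nil => simp at h
    | cons s ss =>
      rw [stepDead, Nat.testBit_or, Bool.or_eq_true, ih ss (by simpa using h)]
      constructor
      · rintro (h1 | ⟨t, ht, h1⟩)
        · refine ⟨0, by simp, ?_⟩
          cases hm : m.trim <;> simp_all
        · exact ⟨t + 1, by simpa using ht, by simpa using h1⟩
      · rintro ⟨t, ht, h1⟩
        cases t with
        | zero =>
          left
          simp at h1
          simp [h1]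
        | succ t => exact Or.inr ⟨t, by simpa using ht, by simpa using h1⟩

/-- At index `y` the state contains the pattern with `t` chosen elements, `p` of them positive, and
pending sign `Y`. -/
def StateMem (N : ℕ) (st : List (List (ℕ × ℕ))) (y t p : ℕ) (Y : Bool) : Prop :=
  ∃ j, p = j + (t - N) ∧ rowBit (st.getD t []) j Y y = true

/-- The shape of a state: row `t` is empty or has one entry for each balanced number of positive
elements. -/
def StateShape (N : ℕ) (st : List (List (ℕ × ℕ))) : Prop :=
  st.length = 10 ∧ ∀ t, (st.getD t []).length = 0 ∨
    (st.getD t []).length = if t ≤ N then t + 1 else 2 * N + 1 - t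

theorem length_advance {N t : ℕ} (hN : 5 ≤ N) (ht : t < 10) {m : Cell} (hm : m.trim = true ↔ N ≤ t)
    {l : List (ℕ × ℕ)} (hl : l.length = 0 ∨ l.length = if t ≤ N then t + 1 else 2 * N + 1 - t) :
    (m.advance l).length = 0 ∨
      (m.advance l).length = if t + 1 ≤ N then t + 1 + 1 else 2 * N + 1 - (t + 1) := by
  rw [Cell.advance]
  cases h : m.trim
  · have : ¬ N ≤ t := by rw [← hm, h]; simp
    simp only [cond_false, length_appendRow]
    split_ifs at hl ⊢ <;> omega
  · have := hm.1 h
    simp only [cond_true, rowMiddle, List.length_dropLast, List.length_tail, length_appendRow]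
    split_ifs at hl ⊢ <;> omega

theorem StateShape.step {N : ℕ} (hN : 5 ≤ N) {F : ℕ → Cell}
    (hF : ∀ t < 10, (F t).trim = true ↔ N ≤ t) {st : List (List (ℕ × ℕ))} (hst : StateShape N st) :
    StateShape N (stepRows [] ((List.range 10).map F) st) := by
  have hlen : ((List.range 10).map F).length = st.length := by simp [hst.1]
  refine ⟨by rw [length_stepRows _ _ _ hlen, hst.1], fun t => ?_⟩
  rcases lt_or_ge t 10 with ht | ht
  · rw [getD_stepRows _ _ _ hlen t (by simpa using ht), length_orRow]
    simp only [List.getElem_map, List.getElem_range]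
    have h1 : (bif (F t).keep then st.getD t [] else []).length = 0 ∨
        (bif (F t).keep then st.getD t [] else []).length =
          if t ≤ N then t + 1 else 2 * N + 1 - t := by
      cases (F t).keep
      · simp
      · exact hst.2 t
    split_ifs with h0 h2 h2
    · subst h0
      simpa using h1
    · omega
    · have h3 := length_advance hN (by omega) (hF (t - 1) (by omega)) (hst.2 (t - 1))
      rw [show t - 1 + 1 = t by omega, if_pos h2] at h3
      rw [if_pos h2] at h1
      omega
    · have h3 := length_advance hN (by omega) (hF (t - 1) (by omega)) (hst.2 (t - 1))
      rw [show t - 1 + 1 = t by omega, if_neg h2] at h3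
      rw [if_neg h2] at h1
      omega
  · left
    rw [List.getD_eq_default]
    · rfl
    · rw [length_stepRows _ _ _ hlen, hst.1]
      exact ht

/-- One column of the dynamic program, at the index `y` of the bitsets. -/
theorem step_correct {q N c y : ℕ} (hN : 5 ≤ N) {g : ℕ → ℕ → Bool} {e : Bool} {es : List Bool}
    (hes : c + 1 + es.length = 10 + q) {F : ℕ → Cell}
    (hkeep : ∀ t < 10, (F t).keep = true ↔ c + 1 ≤ t + q)
    (htrim : ∀ t < 10, (F t).trim = true ↔ N ≤ t)
    (hcur : ∀ t < 10, (F t).cur.testBit y = (g t c ^^ e))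
    (hnext : ∀ t < 10, (F t).next.testBit y = (g (t + 1) c ^^ e))
    {st : List (List (ℕ × ℕ))} (hst : StateShape N st) (hlow : ∀ t, t + q < c → st.getD t [] = []) :
    (∀ t p Y, StateMem N st y t p Y → AllBalanced N g (e :: es) c t p Y) ↔
      (stepDead ((List.range 10).map F) st).testBit y = false ∧
      ∀ t p Y, StateMem N (stepRows [] ((List.range 10).map F) st) y t p Y →
        AllBalanced N g es (c + 1) t p Y := by
  have hlen : ((List.range 10).map F).length = st.length := by simp [hst.1]
  have hlt : ∀ {t p Y}, StateMem N st y t p Y → t < 10 := by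
    rintro t p Y ⟨j, -, hj⟩
    by_contra ht
    rw [List.getD_eq_default _ _ (by rw [hst.1]; omega)] at hj
    simp at hj
  have hwin : ∀ {t j Y}, rowBit (st.getD t []) j Y y = true → c ≤ t + q := by
    intro t j Y hj
    by_contra ht
    rw [hlow t (by omega)] at hj
    simp at hj
  -- The patterns obtained by choosing column `c`.
  have happ : ∀ t < 10, ∀ j Y, rowBit (appendRow (F t).cur (F t).next (st.getD t [])) j Y y = true ↔
      ∃ j' Y', rowBit (st.getD t []) j' Y' y = true ∧ j = j' + (!(Y' ^^ g t c ^^ e)).toNat ∧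
        Y = (!(Y' ^^ g t c ^^ e) ^^ g (t + 1) c ^^ e) := by
    intro t ht j Y
    rw [rowBit_appendRow, hcur t ht, hnext t ht]
    generalize g t c = a
    generalize g (t + 1) c = b
    constructor
    · intro h
      split_ifs at h with h1 h2
      · refine ⟨j, _, h, ?_, ?_⟩
        · cases a <;> cases e <;> simp
        · rw [h1]; cases a <;> cases e <;> simp
      · refine ⟨j - 1, _, h, ?_, ?_⟩
        · cases a <;> cases e <;> simp <;> omega
        · revert h1; cases a <;> cases e <;> cases b <;> cases Y <;> simp
    · rintro ⟨j', Y', h, rfl, rfl⟩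
      revert h
      cases Y' <;> cases a <;> cases b <;> cases e <;> simp
  have hdead := testBit_stepDead ((List.range 10).map F) st hlen y
  have hget := getD_stepRows [] ((List.range 10).map F) st hlen
  simp only [List.getElem_map, List.getElem_range, List.length_map, List.length_range] at hdead hget
  constructor
  · intro hall
    have hall' : ∀ t < 10, ∀ j Y,
        rowBit (appendRow (F t).cur (F t).next (st.getD t [])) j Y y = true →
        AllBalanced N g es (c + 1) (t + 1) (j + (t - N)) Y := by
      intro t ht j Y h
      obtain ⟨j', Y', h1, rfl, rfl⟩ := (happ t ht j Y).1 h
      have := (hall t (j' + (t - N)) Y' ⟨j', rfl, h1⟩).2 ht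
      rwa [show j' + (!(Y' ^^ g t c ^^ e)).toNat + (t - N)
        = j' + (t - N) + (!(Y' ^^ g t c ^^ e)).toNat by omega]
    constructor
    · rw [← Bool.not_eq_true, hdead]
      rintro ⟨t, ht, htr, hends⟩
      rw [htrim t ht] at htr
      obtain ⟨Y, h | h⟩ := testBit_rowEnds.1 hends
      · have hw : c ≤ t + q := by
          obtain ⟨j', Y', h1, -, -⟩ := (happ t ht _ Y).1 h
          exact hwin h1
        refine not_allBalanced_of_unbalanced ?_ (by omega) (by omega) (hall' t ht _ Y h)
        omega
      · have hw : c ≤ t + q := by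
          obtain ⟨j', Y', h1, -, -⟩ := (happ t ht _ Y).1 h
          exact hwin h1
        have hl := lt_length_of_rowBit h
        refine not_allBalanced_of_unbalanced ?_ (by omega) (by omega) (hall' t ht _ Y h)
        rw [length_appendRow] at hl ⊢
        have := hst.2 t
        split_ifs at * <;> omega
    · rintro t p Y ⟨j, rfl, h⟩
      have ht : t < 10 := by
        by_contra ht
        rw [List.getD_eq_default _ _ (by rw [length_stepRows _ _ _ hlen, hst.1]; omega)] at h
        simp at h
      rw [hget t ht, rowBit_orRow, Bool.or_eq_true] at h
      rcases h with h | h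
      · cases hk : (F t).keep
        · simp [hk] at h
        · rw [hk, cond_true] at h
          exact (hall t _ Y ⟨j, rfl, h⟩).1
      · split_ifs at h with h0
        · simp at h
        · obtain ⟨t, rfl⟩ : ∃ t', t = t' + 1 := ⟨t - 1, by omega⟩
          rw [Nat.add_sub_cancel, Cell.advance] at h
          cases htr : (F t).trim
          · have : ¬ N ≤ t := by rw [← htrim t (by omega), htr]; simp
            rw [htr, cond_false] at h
            have := hall' t (by omega) j Y h
            rwa [show t - N = t + 1 - N by omega] at this
          · have := (htrim t (by omega)).1 htr
            rw [htr, cond_true, rowBit_rowMiddle, Bool.and_eq_true] at h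
            have := hall' t (by omega) _ Y h.2
            rwa [show j + 1 + (t - N) = j + (t + 1 - N) by omega] at this
  · rintro ⟨hd, hall⟩ t p Y ⟨j, rfl, h⟩
    have ht := hlt ⟨j, rfl, h⟩
    refine ⟨?_, fun _ => ?_⟩
    · by_cases hk : c + 1 ≤ t + q
      · refine hall t _ Y ⟨j, rfl, ?_⟩
        rw [hget t ht, rowBit_orRow, (hkeep t ht).2 hk, cond_true, h, Bool.true_or]
      · exact allBalanced_of_short (by omega)
    · have h1 := (happ t ht _ _).2 ⟨j, Y, h, rfl, rfl⟩
      generalize (!(Y ^^ g t c ^^ e) ^^ g (t + 1) c ^^ e) = Y1 at h1 ⊢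
      generalize (!(Y ^^ g t c ^^ e)).toNat = u at h1 ⊢
      cases htr : (F t).trim
      · have hlt' : ¬ N ≤ t := by rw [← htrim t (by omega), htr]; simp
        rcases eq_or_ne t 9 with rfl | h9
        · rw [allBalanced_ten_iff]
          have hl := lt_length_of_rowBit h1
          rw [length_appendRow] at hl
          have := hst.2 9
          split_ifs at * <;> omega
        · refine hall (t + 1) _ Y1 ⟨j + u, by omega, ?_⟩
          rw [hget (t + 1) (by omega), rowBit_orRow, dif_neg (by omega), Nat.add_sub_cancel,
            Cell.advance, htr, cond_false, h1, Bool.or_true]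
      · have htr' := (htrim t ht).1 htr
        have hends : ¬ (rowEnds (appendRow (F t).cur (F t).next (st.getD t []))).testBit y = true :=
          fun h2 => by rw [hdead.2 ⟨t, ht, htr, h2⟩] at hd; simp at hd
        have hl := lt_length_of_rowBit h1
        rw [testBit_rowEnds] at hends
        push Not at hends
        have h0 : j + u ≠ 0 := fun h0 => by
          rw [h0] at h1
          exact (hends Y1).1 h1
        have h2 : j + u ≠ (appendRow (F t).cur (F t).next (st.getD t [])).length - 1 := fun h0 => by
          rw [h0] at h1
          exact (hends Y1).2 h1
        rcases eq_or_ne t 9 with rfl | h9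
        · rw [allBalanced_ten_iff]
          rw [length_appendRow] at hl h2
          have := hst.2 9
          split_ifs at * <;> omega
        · refine hall (t + 1) _ Y1 ⟨j + u - 1, by omega, ?_⟩
          rw [hget (t + 1) (by omega), rowBit_orRow, dif_neg (by omega), Nat.add_sub_cancel,
            Cell.advance, htr, cond_true, rowBit_rowMiddle, show j + u - 1 + 1 = j + u by omega, h1,
            Bool.and_true, Bool.or_eq_true, decide_eq_true_eq]
          right
          omega

/-- All bitsets of the state live on the indices with `s` bits. -/
def StateLt (s : ℕ) (st : List (List (ℕ × ℕ))) : Prop :=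
  ∀ l ∈ st, ∀ ab ∈ l, ab.1 < 2 ^ 2 ^ s ∧ ab.2 < 2 ^ 2 ^ s

theorem diffOn_lt {s : ℕ} {g a b : ℕ} (ha : a < 2 ^ s) (hb : b < 2 ^ s) : diffOn g a b < 2 ^ s :=
  Nat.and_le_left.trans_lt (Nat.xor_lt_two_pow ha hb)

theorem appendGo_lt {s g h : ℕ} {x : ℕ} {l : List (ℕ × ℕ)} (hx : x < 2 ^ s)
    (hl : ∀ ab ∈ l, ab.1 < 2 ^ s ∧ ab.2 < 2 ^ s) :
    ∀ ab ∈ appendGo g h x l, ab.1 < 2 ^ s ∧ ab.2 < 2 ^ s := by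
  induction l generalizing x with
  | nil =>
    have h0 : 0 < 2 ^ s := by positivity
    simp only [appendGo, List.mem_singleton, forall_eq]
    exact ⟨diffOn_lt hx h0, Nat.xor_lt_two_pow hx (diffOn_lt hx h0)⟩
  | cons b l ih =>
    obtain ⟨⟨h1, h2⟩, hl'⟩ := List.forall_mem_cons.1 hl
    have h3 := diffOn_lt (g := g) h1 h2
    have h4 := Nat.xor_lt_two_pow h2 h3
    have h5 := diffOn_lt (g := h) hx h4
    rw [appendGo, List.forall_mem_cons]
    exact ⟨⟨Nat.xor_lt_two_pow h4 h5, Nat.xor_lt_two_pow hx h5⟩,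
      ih (Nat.xor_lt_two_pow h1 h3) hl'⟩

theorem appendRow_lt {s g h : ℕ} {l : List (ℕ × ℕ)}
    (hl : ∀ ab ∈ l, ab.1 < 2 ^ s ∧ ab.2 < 2 ^ s) :
    ∀ ab ∈ appendRow g h l, ab.1 < 2 ^ s ∧ ab.2 < 2 ^ s := by
  cases l with
  | nil => simp [appendRow]
  | cons b l => exact appendGo_lt (by positivity) hl

theorem orRow_lt {s : ℕ} {l l' : List (ℕ × ℕ)} (hl : ∀ ab ∈ l, ab.1 < 2 ^ s ∧ ab.2 < 2 ^ s)
    (hl' : ∀ ab ∈ l', ab.1 < 2 ^ s ∧ ab.2 < 2 ^ s) :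
    ∀ ab ∈ orRow l l', ab.1 < 2 ^ s ∧ ab.2 < 2 ^ s := by
  induction l generalizing l' with
  | nil => simpa [orRow] using hl'
  | cons a l ih =>
    cases l' with
    | nil => simpa [orRow] using hl
    | cons b l' =>
      obtain ⟨⟨h1, h2⟩, h3⟩ := List.forall_mem_cons.1 hl
      obtain ⟨⟨h4, h5⟩, h6⟩ := List.forall_mem_cons.1 hl'
      rw [orRow, List.forall_mem_cons]
      exact ⟨⟨Nat.or_lt_two_pow h1 h4, Nat.or_lt_two_pow h2 h5⟩, ih h3 h6⟩

theorem advance_lt {s : ℕ} {m : Cell} {l : List (ℕ × ℕ)}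
    (hl : ∀ ab ∈ l, ab.1 < 2 ^ s ∧ ab.2 < 2 ^ s) :
    ∀ ab ∈ m.advance l, ab.1 < 2 ^ s ∧ ab.2 < 2 ^ s := by
  intro ab hab
  have h := appendRow_lt (g := m.cur) (h := m.next) hl
  rw [Cell.advance] at hab
  cases hm : m.trim
  · rw [hm] at hab
    exact h ab hab
  · rw [hm] at hab
    exact h ab (List.mem_of_mem_tail (List.mem_of_mem_dropLast hab))

theorem StateLt.step {s : ℕ} {prev : List (ℕ × ℕ)} {ms : List Cell} {st : List (List (ℕ × ℕ))}
    (hp : ∀ ab ∈ prev, ab.1 < 2 ^ 2 ^ s ∧ ab.2 < 2 ^ 2 ^ s) (hst : StateLt s st) :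
    StateLt s (stepRows prev ms st) := by
  induction ms generalizing prev st with
  | nil => simp [stepRows, StateLt]
  | cons m ms ih =>
    cases st with
    | nil => simp [stepRows, StateLt]
    | cons l st =>
      obtain ⟨h1, h2⟩ := List.forall_mem_cons.1 hst
      rw [stepRows]
      refine List.forall_mem_cons.2 ⟨orRow_lt ?_ hp, ih (advance_lt h1) h2⟩
      cases m.keep
      · simp
      · exact h1

theorem rowEnds_lt {s : ℕ} {l : List (ℕ × ℕ)} (hl : ∀ ab ∈ l, ab.1 < 2 ^ s ∧ ab.2 < 2 ^ s) :
    rowEnds l < 2 ^ s := by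
  have h : ∀ i, (l.getD i (0, 0)).1 < 2 ^ s ∧ (l.getD i (0, 0)).2 < 2 ^ s := by
    intro i
    rcases lt_or_ge i l.length with hi | hi
    · rw [List.getD_eq_getElem _ _ hi]
      exact hl _ (List.getElem_mem hi)
    · rw [List.getD_eq_default _ _ hi]
      simp
  exact Nat.or_lt_two_pow (Nat.or_lt_two_pow (h _).1 (h _).2) (Nat.or_lt_two_pow (h _).1 (h _).2)

theorem stepDead_lt {s : ℕ} {ms : List Cell} {st : List (List (ℕ × ℕ))} (hst : StateLt s st) :
    stepDead ms st < 2 ^ 2 ^ s := by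
  induction ms generalizing st with
  | nil => simp [stepDead]
  | cons m ms ih =>
    cases st with
    | nil => simp [stepDead]
    | cons l st =>
      obtain ⟨h1, h2⟩ := List.forall_mem_cons.1 hst
      rw [stepDead]
      refine Nat.or_lt_two_pow ?_ (ih h2)
      cases m.trim
      · simp
      · exact rowEnds_lt (appendRow_lt h1)

theorem getD_map_dup (s : ℕ) (st : List (List (ℕ × ℕ))) (t : ℕ) :
    (dupState s st).getD t [] =
      (st.getD t []).map fun ab => (dupBits s ab.1, dupBits s ab.2) := by
  rw [dupState, List.getD_eq_getElem?_getD, List.getElem?_map, List.getD_eq_getElem?_getD]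
  cases st[t]? <;> simp

theorem rowBit_map_dup {s : ℕ} {l : List (ℕ × ℕ)}
    (hl : ∀ ab ∈ l, ab.1 < 2 ^ 2 ^ s ∧ ab.2 < 2 ^ 2 ^ s) {y : ℕ} (hy : y < 2 ^ (s + 1)) (j : ℕ)
    (Y : Bool) :
    rowBit (l.map fun ab => (dupBits s ab.1, dupBits s ab.2)) j Y y = rowBit l j Y (y % 2 ^ s) := by
  rcases lt_or_ge j l.length with hj | hj
  · have h := hl _ (List.getElem_mem hj)
    rw [rowBit, rowBit, List.getD_eq_getElem _ _ (by simpa using hj), List.getD_eq_getElem _ _ hj]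
    cases Y
    · simp [testBit_dupBits h.1 hy]
    · simp [testBit_dupBits h.2 hy]
  · rw [rowBit, rowBit, List.getD_eq_default _ _ (by simpa using hj), List.getD_eq_default _ _ hj]
    cases Y <;> simp

theorem stateMem_map_dup {N s : ℕ} {st : List (List (ℕ × ℕ))} (hst : StateLt s st) {y : ℕ}
    (hy : y < 2 ^ (s + 1)) {t p : ℕ} {Y : Bool} :
    StateMem N (dupState s st) y t p Y ↔
      StateMem N st (y % 2 ^ s) t p Y := by
  unfold StateMem
  have h : ∀ ab ∈ st.getD t [], ab.1 < 2 ^ 2 ^ s ∧ ab.2 < 2 ^ 2 ^ s := by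
    rcases lt_or_ge t st.length with ht | ht
    · rw [List.getD_eq_getElem _ _ ht]
      exact hst _ (List.getElem_mem ht)
    · rw [List.getD_eq_default _ _ ht]
      simp
  simp only [getD_map_dup, rowBit_map_dup h hy]

theorem StateLt.map_dup {s : ℕ} {st : List (List (ℕ × ℕ))} (hst : StateLt s st) :
    StateLt (s + 1) (dupState s st) := by
  simp only [StateLt, dupState, List.forall_mem_map]
  exact fun l hl ab hab => ⟨dupBits_lt (hst l hl ab hab).1, dupBits_lt (hst l hl ab hab).2⟩

theorem StateShape.map_dup {N s : ℕ} {st : List (List (ℕ × ℕ))} (hst : StateShape N st) :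
    StateShape N (dupState s st) := by
  refine ⟨by simpa [dupState] using hst.1, fun t => ?_⟩
  rw [getD_map_dup, List.length_map]
  exact hst.2 t

/-- Patterns that lag too far behind to be completed are absent from the state. -/
theorem stepRows_low {F : ℕ → Cell} {st : List (List (ℕ × ℕ))} (h10 : st.length = 10) {q c : ℕ}
    (hkeep : ∀ t < 10, (F t).keep = true ↔ c + 1 ≤ t + q)
    (hlow : ∀ t, t + q < c → st.getD t [] = []) (t : ℕ) (ht : t + q < c + 1) :
    (stepRows [] ((List.range 10).map F) st).getD t [] = [] := by
  have hlen : ((List.range 10).map F).length = st.length := by simp [h10]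
  rcases lt_or_ge t 10 with h | h
  · rw [getD_stepRows _ _ _ hlen t (by simpa using h)]
    have hk : (F t).keep = false := by
      rw [← Bool.not_eq_true, hkeep t h]
      omega
    simp only [List.getElem_map, List.getElem_range, hk, cond_false, orRow]
    split_ifs with h0
    · rfl
    · rw [hlow (t - 1) (by omega), Cell.advance]
      cases (F (t - 1)).trim <;> rfl
  · rw [List.getD_eq_default]
    rw [length_stepRows _ _ _ hlen, h10]
    exact h

/-- The value at `y` of the function whose binary digits are given by a list of bitsets. -/
def planeValue : List ℕ → ℕ → ℕ
  | [], _ => 0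
  | x :: l, y => (x.testBit y).toNat + 2 * planeValue l y

theorem planeValue_addPlanes {u v : List ℕ} (h : u.length = v.length) (c y : ℕ) :
    planeValue (addPlanes c u v) y = planeValue u y + planeValue v y + (c.testBit y).toNat := by
  induction u generalizing v c with
  | nil => cases v <;> simp_all [addPlanes, planeValue]
  | cons a u ih =>
    cases v with
    | nil => simp at h
    | cons b v =>
      simp only [addPlanes, planeValue, ih (v := v) (by simpa using h), Nat.testBit_xor,
        Nat.testBit_or, Nat.testBit_and]
      cases a.testBit y <;> cases b.testBit y <;> cases c.testBit y <;> simp <;> ring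

theorem length_addPlanes {u v : List ℕ} (h : u.length = v.length) (c : ℕ) :
    (addPlanes c u v).length = u.length + 1 := by
  induction u generalizing v c with
  | nil => cases v <;> simp_all [addPlanes]
  | cons a u ih =>
    cases v with
    | nil => simp at h
    | cons b v => simp [addPlanes, ih (v := v) (by simpa using h)]

theorem planeValue_map {u : List ℕ} {f : ℕ → ℕ} {y z : ℕ}
    (h : ∀ x, (f x).testBit y = x.testBit z) : planeValue (u.map f) y = planeValue u z := by
  induction u with
  | nil => rfl
  | cons a u ih => simp [planeValue, ih, h]

theorem length_foldTop (s : ℕ) (u : List ℕ) : (foldTop s u).length = u.length + 1 := by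
  rw [foldTop, length_addPlanes (by simp), List.length_map]

theorem planeValue_foldTop {s y : ℕ} (hy : y < 2 ^ s) (u : List ℕ) :
    planeValue (foldTop s u) y = planeValue u y + planeValue u (2 ^ s + y) := by
  rw [foldTop, planeValue_addPlanes (by simp), planeValue_map (z := y),
    planeValue_map (z := 2 ^ s + y)]
  · simp
  · intro x
    rw [Nat.testBit_shiftRight]
  · intro x
    rw [Nat.testBit_and, testBit_oneBits hy, Bool.and_true]

theorem length_runPlanes (k : ℕ) (cols : List (List Cell)) (i d dead : ℕ)
    (st : List (List (ℕ × ℕ))) :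
    (runPlanes k i d cols dead st).length = cols.length + 1 := by
  induction cols generalizing i d dead st with
  | nil => simp [runPlanes]
  | cons col cols ih =>
    cases d with
    | zero => rw [runPlanes, length_addPlanes (by rw [ih, ih]), ih, List.length_cons]
    | succ d => rw [runPlanes, length_foldTop, ih, List.length_cons]

theorem card_filter_cons {m : ℕ} (P : Bool → (Fin m → Bool) → Prop) [∀ e v, Decidable (P e v)]
    [DecidablePred fun v : Fin (m + 1) → Bool => P (v 0) fun i => v i.succ] :
    #{v : Fin (m + 1) → Bool | P (v 0) fun i => v i.succ} =
      #{v : Fin m → Bool | P false v} + #{v : Fin m → Bool | P true v} := by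
  have h : #{w : Bool × (Fin m → Bool) | P w.1 w.2} =
      #{v : Fin m → Bool | P false v} + #{v : Fin m → Bool | P true v} := by
    simp only [Finset.card_filter, Fintype.sum_prod_type, Fintype.sum_bool]
    rw [add_comm]
  rw [← h]
  refine Finset.card_bij' (fun v _ => (v 0, fun i => v i.succ)) (fun w _ => Fin.cons w.1 w.2)
    ?_ ?_ ?_ ?_
  · intro v hv
    simpa using hv
  · intro w hw
    simpa using hw
  · intro v _
    exact Fin.cons_self_tail v
  · intro w _
    simp

/-- The scalings `es` of the columns from `c` on have only balanced completions of the state `st`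
on the board and for the earlier column scalings with index `y`, and these are not dead yet. -/
def Completes (N k : ℕ) (a : ℕ → ℕ → ℕ) (c : ℕ) (es : List Bool) (dead : ℕ)
    (st : List (List (ℕ × ℕ))) (y : ℕ) : Prop :=
  dead.testBit y = false ∧ ∀ t p Y, StateMem N st y t p Y →
    AllBalanced N (fun t c => (rowEntry a t c).testBit (y % 2 ^ k)) es c t p Y

/-- One column of the program. The transformation `f` of the column describes its scaling, by `e` at
the index considered; the index may change from `y` to `y'` when a bit is added. -/
theorem completes_step {q N k c dead dead' y y' : ℕ} {es : List Bool} {a : ℕ → ℕ → ℕ} {e : Bool}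
    (hN : 5 ≤ N) (hc : c + (es.length + 1) = 10 + q) {f : Cell → Cell}
    (hf : ∀ m, (f m).keep = m.keep ∧ (f m).trim = m.trim)
    (hbit : ∀ t, (f (cell q N a c t)).cur.testBit y' =
        ((rowEntry a t c).testBit (y % 2 ^ k) ^^ e) ∧
      (f (cell q N a c t)).next.testBit y' = ((rowEntry a (t + 1) c).testBit (y % 2 ^ k) ^^ e))
    {st st' : List (List (ℕ × ℕ))} (hshape : StateShape N st')
    (hlow : ∀ t, t + q < c → st'.getD t [] = [])
    (hst : ∀ t p Y, StateMem N st' y' t p Y ↔ StateMem N st y t p Y)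
    (hdead : dead'.testBit y' = dead.testBit y) (hmod : y' % 2 ^ k = y % 2 ^ k) :
    Completes N k a (c + 1) es (dead' ||| stepDead ((column q N a c).map f) st')
      (stepRows [] ((column q N a c).map f) st') y' ↔ Completes N k a c (e :: es) dead st y := by
  have hstep := step_correct (c := c) (y := y') hN
    (g := fun t c => (rowEntry a t c).testBit (y % 2 ^ k)) (e := e)
    (es := es) (by omega) (F := fun t => f (cell q N a c t))
    (fun t _ => by rw [(hf _).1]; simp [cell]) (fun t _ => by rw [(hf _).2]; simp [cell])
    (fun t _ => (hbit t).1) (fun t _ => (hbit t).2) hshape hlow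
  have hcol : (column q N a c).map f = (List.range 10).map fun t => f (cell q N a c t) := by
    simp [column]
  rw [Completes, hcol, Nat.testBit_or, Bool.or_eq_false_iff, and_assoc, hmod, hdead]
  refine and_congr_right fun _ => hstep.symm.trans ?_
  simp only [hst]

/-- What `runPlanes` needs to know about a state before column `c`. -/
structure IsState (q N s c dead : ℕ) (st : List (List (ℕ × ℕ))) : Prop where
  shape : StateShape N st
  lt : StateLt s st
  dead_lt : dead < 2 ^ 2 ^ s
  low : ∀ t, t + q < c → st.getD t [] = []

theorem IsState.step {q N s c dead : ℕ} {st : List (List (ℕ × ℕ))} (h : IsState q N s c dead st)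
    (hN : 5 ≤ N) (a : ℕ → ℕ → ℕ) {f : Cell → Cell}
    (hf : ∀ m, (f m).keep = m.keep ∧ (f m).trim = m.trim) :
    IsState q N s (c + 1) (dead ||| stepDead ((column q N a c).map f) st)
      (stepRows [] ((column q N a c).map f) st) := by
  have hcol : (column q N a c).map f = (List.range 10).map fun t => f (cell q N a c t) := by
    simp [column]
  refine ⟨?_, h.lt.step (by simp), Nat.or_lt_two_pow h.dead_lt (stepDead_lt h.lt), ?_⟩
  · rw [hcol]
    exact h.shape.step hN fun t _ => by rw [(hf _).2]; simp [cell]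
  · rw [hcol]
    exact stepRows_low h.shape.1 (fun t _ => by rw [(hf _).1]; simp [cell]) h.low

theorem IsState.dup {q N s c dead : ℕ} {st : List (List (ℕ × ℕ))} (h : IsState q N s c dead st) :
    IsState q N (s + 1) c (dupBits s dead) (dupState s st) :=
  ⟨h.shape.map_dup, h.lt.map_dup, dupBits_lt h.dead_lt, fun t ht => by
    rw [getD_map_dup, h.low t ht, List.map_nil]⟩

open Classical in
/-- The planes hold the number of column scalings that complete the state. -/
theorem planeValue_runPlanes {q N k : ℕ} (hN : 5 ≤ N) {a : ℕ → ℕ → ℕ}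
    (ha : ∀ t c, a t c < 2 ^ 2 ^ k) (m : ℕ) {i d c dead : ℕ} {st : List (List (ℕ × ℕ))}
    (hc : c + m = 10 + q) (h : IsState q N (k + i) c dead st) {y : ℕ} (hy : y < 2 ^ (k + i)) :
    planeValue (runPlanes k i d ((List.range' c m).map (column q N a)) dead st) y =
      #{v : Fin m → Bool | Completes N k a c (List.ofFn v) dead st y} := by
  have hrow : ∀ t c, rowEntry a t c < 2 ^ 2 ^ k := by
    rintro (_ | t) c
    · simp [rowEntry]
    · exact ha t c
  induction m generalizing i d c dead st y with
  | zero =>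
    have hst : ∀ t p Y, StateMem N st y t p Y →
        AllBalanced N (fun t c => (rowEntry a t c).testBit (y % 2 ^ k)) [] c t p Y := by
      rintro t p Y ⟨j, -, h'⟩ rfl
      rw [List.getD_eq_default _ _ (by rw [h.shape.1])] at h'
      simp at h'
    simp only [List.range'_zero, List.map_nil, runPlanes, planeValue, Nat.testBit_xor,
      testBit_oneBits hy, List.ofFn_zero, Completes, and_iff_left hst]
    cases dead.testBit y <;> simp
  | succ m ih =>
    have hlen : ∀ v : Fin m → Bool, c + ((List.ofFn v).length + 1) = 10 + q := fun v => by
      rw [List.length_ofFn, hc]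
    have hsplit := card_filter_cons fun e (v : Fin m → Bool) =>
      Completes N k a c (e :: List.ofFn v) dead st y
    simp only [List.ofFn_succ]
    rw [hsplit, List.range'_succ, List.map_cons]
    cases d with
    | zero =>
      have hlift : ∀ t c, (liftBits k i (rowEntry a t c)).testBit y =
          (rowEntry a t c).testBit (y % 2 ^ k) := fun t c => testBit_liftBits (hrow t c) hy
      rw [runPlanes, planeValue_addPlanes (by rw [length_runPlanes, length_runPlanes]),
        ih (by omega) (h.step hN a (f := Cell.lift k i) fun _ => ⟨rfl, rfl⟩) hy,
        ih (by omega) (h.step hN a (f := fun m => (m.lift k i).flip (oneBits (k + i)))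
          fun _ => ⟨rfl, rfl⟩) hy, Nat.zero_testBit, Bool.toNat_false,
        add_zero]
      congr 2
      · ext v
        simp only [Finset.mem_filter, Finset.mem_univ, true_and]
        refine completes_step hN (hlen v) (f := Cell.lift k i) (fun _ => ⟨rfl, rfl⟩)
          (fun t => ?_) h.shape h.low (fun _ _ _ => Iff.rfl) rfl rfl
        simp [Cell.lift, cell, hlift]
      · ext v
        simp only [Finset.mem_filter, Finset.mem_univ, true_and]
        refine completes_step hN (hlen v) (f := fun m => (m.lift k i).flip (oneBits (k + i)))
          (fun _ => ⟨rfl, rfl⟩) (fun t => ?_) h.shape h.low (fun _ _ _ => Iff.rfl) rfl rfl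
        simp [Cell.lift, Cell.flip, cell, hlift, testBit_oneBits hy]
    | succ d =>
      have hmod : (2 ^ (k + i) + y) % 2 ^ k = y % 2 ^ k := by
        rw [pow_add, Nat.mul_add_mod]
      have key : ∀ y' < 2 ^ (k + i + 1), y' % 2 ^ (k + i) = y → ∀ v : Fin m → Bool,
          Completes N k a (c + 1) (List.ofFn v) (dupBits (k + i) dead |||
              stepDead ((column q N a c).map fun m => (m.lift k (i + 1)).flip (newBit (k + i)))
                (dupState (k + i) st))
            (stepRows [] ((column q N a c).map fun m =>
              (m.lift k (i + 1)).flip (newBit (k + i))) (dupState (k + i) st)) y' ↔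
          Completes N k a c (y'.testBit (k + i) :: List.ofFn v) dead st y := by
        intro y' hy' hmod' v
        have hmod2 : y' % 2 ^ k = y % 2 ^ k := by
          rw [← hmod', Nat.mod_mod_of_dvd _ (pow_dvd_pow 2 (by omega))]
        refine completes_step hN (hlen v)
          (f := fun m => (m.lift k (i + 1)).flip (newBit (k + i))) (fun _ => ⟨rfl, rfl⟩)
          (fun t => ?_) h.dup.shape h.dup.low (fun t p Y => ?_) ?_ hmod2
        · simp [Cell.lift, Cell.flip, cell, testBit_liftBits (m := i + 1) (hrow _ _) hy',
            testBit_newBit hy', hmod2]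
        · rw [stateMem_map_dup h.lt hy', hmod']
        · rw [testBit_dupBits h.dead_lt hy', hmod']
      have hy1 : y < 2 ^ (k + i + 1) := by rw [pow_succ]; omega
      have hy2 : 2 ^ (k + i) + y < 2 ^ (k + i + 1) := by rw [pow_succ]; omega
      have hstep := h.dup.step hN a (f := fun m => (m.lift k (i + 1)).flip (newBit (k + i)))
        fun _ => ⟨rfl, rfl⟩
      rw [runPlanes, planeValue_foldTop hy,
        ih (i := i + 1) (by omega) hstep hy1, ih (i := i + 1) (by omega) hstep hy2]
      simp only [key y hy1 (Nat.mod_eq_of_lt hy), Nat.testBit_lt_two_pow hy,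
        key _ hy2 (by rw [Nat.add_mod_left, Nat.mod_eq_of_lt hy]),
        Nat.testBit_two_pow_add_eq]
      simp

open Classical in
theorem planeValue_countPlanes {q N k d : ℕ} (hN : 5 ≤ N) {a : ℕ → ℕ → ℕ}
    (ha : ∀ t c, a t c < 2 ^ 2 ^ k) {b : ℕ} (hb : b < 2 ^ k) :
    planeValue (countPlanes q N k d a) b = #{v : Fin (9 + q) → Bool |
      AllBalanced N (fun t c => (rowEntry a t c).testBit b) (false :: List.ofFn v) 0 0 0
        false} := by
  have hget : ∀ t, ([(oneBits k, 0)] :: List.replicate 9 ([] : List (ℕ × ℕ))).getD t [] =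
      if t = 0 then [(oneBits k, 0)] else [] := by
    intro t
    cases t with
    | zero => rfl
    | succ t =>
      rw [List.getD_cons_succ, if_neg (by omega)]
      simp only [List.getD_eq_getElem?_getD, List.getElem?_replicate]
      split_ifs <;> rfl
  have h : IsState q N k 0 0 ([(oneBits k, 0)] :: List.replicate 9 []) := by
    refine ⟨⟨by simp, fun t => ?_⟩, ?_, by positivity, by simp⟩
    · rw [hget]
      split_ifs <;> simp_all
    · have := oneBits_lt k
      simp [StateLt, this]
  have h1 := h.step hN a (f := id) fun _ => ⟨rfl, rfl⟩
  rw [List.map_id, Nat.zero_or] at h1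
  rw [countPlanes, planeValue_runPlanes hN ha (9 + q) (i := 0) (by omega) h1 hb]
  congr 1
  ext v
  simp only [Finset.mem_filter, Finset.mem_univ, true_and]
  have h2 := completes_step (k := k) (c := 0) (dead := 0) (dead' := 0) (y := b) (y' := b) (a := a)
    (es := List.ofFn v) (e := false) hN (by simp; ring) (f := id) (fun _ => ⟨rfl, rfl⟩)
    (fun t => by simp [cell, Nat.mod_eq_of_lt hb]) h.shape h.low (fun _ _ _ => Iff.rfl) rfl rfl
  rw [List.map_id, Nat.zero_or] at h2
  rw [h2, Completes, Nat.mod_eq_of_lt hb]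
  refine ⟨fun h' => h'.2 0 0 false ⟨0, by simp, ?_⟩, fun h' => ⟨by simp, ?_⟩⟩
  · simp [testBit_oneBits hb]
  · rintro t p Y ⟨j, rfl, hj⟩
    rw [hget] at hj
    split_ifs at hj with h0
    · subst h0
      rcases j with _ | j
      · cases Y
        · simpa using h'
        · simp at hj
      · simp at hj
    · simp at hj

theorem testBit_cmpPlanes {C : ℕ} {u : List ℕ} (hC : C < 2 ^ u.length) (gt eq y : ℕ) :
    ((cmpPlanes C u gt eq).1.testBit y = true ↔
      C < planeValue u y ∨ planeValue u y = C ∧ gt.testBit y = true) ∧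
    ((cmpPlanes C u gt eq).2.testBit y = true ↔ planeValue u y = C ∧ eq.testBit y = true) := by
  induction u generalizing C gt eq with
  | nil =>
    obtain rfl : C = 0 := by simpa using hC
    simp [cmpPlanes, planeValue]
  | cons x u ih =>
    have hC' : C / 2 < 2 ^ u.length := by
      rw [List.length_cons, pow_succ] at hC
      omega
    have hdiv := Nat.div_add_mod C 2
    rw [cmpPlanes, Nat.testBit_zero]
    rcases Nat.mod_two_eq_zero_or_one C with h0 | h0
    · rw [h0]
      simp only [zero_ne_one, decide_false, cond_false, (ih hC' _ _).1, (ih hC' _ _).2,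
        Nat.testBit_or, Nat.testBit_xor, Nat.testBit_and, planeValue]
      cases x.testBit y <;> cases gt.testBit y <;> cases eq.testBit y <;> simp <;> omega
    · rw [h0]
      simp only [decide_true, cond_true, (ih hC' _ _).1, (ih hC' _ _).2,
        Nat.testBit_and, planeValue]
      cases x.testBit y <;> cases gt.testBit y <;> cases eq.testBit y <;> simp <;> omega

theorem testBit_foldr_lor {ι : Type*} (l : List ι) (f : ι → ℕ) (y : ℕ) :
    ((l.map f).foldr (· ||| ·) 0).testBit y = true ↔ ∃ i ∈ l, (f i).testBit y = true := by
  induction l with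
  | nil => simp
  | cons a l ih => simp [ih]

/-- The product of the signs at four entries of a sign matrix in rows `i`, `i + 1` and columns
`c`, `c + 1`, as a Boolean. -/
def square (a : ℕ → ℕ → Bool) (i c : ℕ) : Bool :=
  (a i c ^^ a (i + 1) c) ^^ (a i (c + 1) ^^ a (i + 1) (c + 1))

/-- Vertically adjacent squares agree, in the part of the matrix that matters. -/
def SquaresAgree (q : ℕ) (a : ℕ → ℕ → Bool) : Prop :=
  ∀ i c, i < 7 → i + 2 ≤ c → c ≤ i + q → square a i c = square a (i + 1) c

theorem testBit_breakBits (q : ℕ) (a : ℕ → ℕ → ℕ) (y : ℕ) :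
    (breakBits q a).testBit y = false ↔ SquaresAgree q fun t c => (a t c).testBit y := by
  have key : ∀ u v : Bool, ¬((u ^^ v) = true) ↔ u = v := by decide
  have hsq : ∀ i c, square (fun t c => (a t c).testBit y) i c = (squareBits a i c).testBit y := by
    intro i c
    simp only [square, squareBits, Nat.testBit_xor]
  rw [← Bool.not_eq_true, breakBits, testBit_foldr_lor]
  simp only [testBit_foldr_lor, List.mem_range, Nat.testBit_xor, SquaresAgree, hsq, not_exists,
    not_and, key]
  constructor
  · intro h i c hi h1 h2
    have := h i hi (c - i - 2) (by omega)
    rwa [show i + (c - i - 2) + 2 = c by omega] at this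
  · intro h i hi j hj
    exact h i (i + j + 2) hi (by omega) (by omega)

/-- What a successful run of `boardCheck` says about the board with index `b`. -/
theorem of_boardCheck {q N k d C : ℕ} (hC : C < 2 ^ (10 + q)) {a : ℕ → ℕ → ℕ}
    (h : boardCheck q N k d C a = true) {b : ℕ} (hb : b < 2 ^ k)
    {count : ℕ} (hcount : planeValue (countPlanes q N k d a) b = count) :
    count ≤ C ∧ (count = C ↔ SquaresAgree q fun t c => (a t c).testBit b) := by
  rw [← hcount]
  have hlen : C < 2 ^ (countPlanes q N k d a).length := by
    rw [countPlanes, length_runPlanes]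
    simpa [show 9 + q + 1 = 10 + q by ring] using hC
  obtain ⟨h1, h2⟩ := testBit_cmpPlanes hlen 0 (oneBits k) b
  simp only [boardCheck, Bool.and_eq_true, beq_iff_eq] at h
  rw [h.1] at h1
  have h3 := congrArg (Nat.testBit · b) h.2
  simp only [Nat.testBit_xor, testBit_oneBits hb] at h3
  rw [testBit_oneBits hb] at h2
  simp only [Nat.zero_testBit, Bool.false_eq_true, and_false, or_false, false_iff, not_lt] at h1
  refine ⟨h1, ?_⟩
  rw [← testBit_breakBits]
  simp only [and_true] at h2
  rw [← h2]
  revert h3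
  cases (breakBits q a).testBit b <;> simp

/-! ### Sign matrices and their good reorientations -/

/-- Extension of a Boolean vector by `false`. -/
def extendVec {n : ℕ} (v : Fin n → Bool) (c : ℕ) : Bool :=
  if h : c < n then v ⟨c, h⟩ else false

theorem extendVec_of_lt {n : ℕ} (v : Fin n → Bool) {c : ℕ} (h : c < n) :
    extendVec v c = v ⟨c, h⟩ := dif_pos h

/-- Every circuit of the Lawrence oriented matroid on `n` elements with sign matrix `a` has at
most `N` elements of each sign. The elements of the circuit are `x 0 < ⋯ < x 9`, with signs
`s 0, …, s 9`; `true` stands for a negative matrix entry and for a positive element. -/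
def IsGood (n N : ℕ) (a : ℕ → ℕ → Bool) : Prop :=
  ∀ (x : ℕ → ℕ) (s : ℕ → Bool), (∀ m m', m < m' → m' < 10 → x m < x m') → x 9 < n →
    (∀ m < 9, s (m + 1) = !((s m ^^ a m (x m)) ^^ a m (x (m + 1)))) →
    #{m ∈ range 10 | s m = true} ≤ N ∧ 10 ≤ #{m ∈ range 10 | s m = true} + N

open Classical in
/-- The number of column scalings that make the sign matrix `a` good. -/
noncomputable def goodCount (n N : ℕ) (a : ℕ → ℕ → Bool) : ℕ :=
  #{v : Fin n → Bool | IsGood n N fun i c => a i c ^^ extendVec v c}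

/-- Position `m` of an increasing sequence of length `10` leaves room for the others. -/
theorem index_bounds {n : ℕ} {x : ℕ → ℕ} (hx : ∀ m m', m < m' → m' < 10 → x m < x m')
    (hn : x 9 < n) {m : ℕ} (hm : m < 10) : m ≤ x m ∧ x m + 10 ≤ n + m := by
  constructor
  · induction m with
    | zero => exact Nat.zero_le _
    | succ m ih => have := ih (by omega); have := hx m (m + 1) (by omega) hm; omega
  · have : ∀ d ≤ 9, x (9 - d) + d + 1 ≤ n := by
      intro d
      induction d with
      | zero => intro _; simpa using hn
      | succ d ih =>
        intro hd
        have := ih (by omega)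
        have := hx (9 - (d + 1)) (9 - d) (by omega) (by omega)
        omega
    have := this (9 - m) (by omega)
    rw [show 9 - (9 - m) = m by omega] at this
    omega

theorem IsGood.congr {q N : ℕ} {a b : ℕ → ℕ → Bool} (h : IsGood (10 + q) N a)
    (hab : ∀ i c, i ≤ 8 → i ≤ c → c ≤ i + q + 1 → a i c = b i c) : IsGood (10 + q) N b := by
  intro x s hx hn hs
  refine h x s hx hn fun m hm => ?_
  have h1 := index_bounds hx hn (m := m) (by omega)
  have h2 := index_bounds hx hn (m := m + 1) (by omega)
  rw [hs m hm, hab m (x m) (by omega) (by omega) (by omega),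
    hab m (x (m + 1)) (by omega) (by omega) (by omega)]

theorem isGood_congr {q N : ℕ} {a b : ℕ → ℕ → Bool}
    (hab : ∀ i c, i ≤ 8 → i ≤ c → c ≤ i + q + 1 → a i c = b i c) :
    IsGood (10 + q) N a ↔ IsGood (10 + q) N b :=
  ⟨fun h => h.congr hab, fun h => h.congr fun i c h1 h2 h3 => (hab i c h1 h2 h3).symm⟩

theorem isGood_row_scale {n N : ℕ} {a : ℕ → ℕ → Bool} (ρ : ℕ → Bool) :
    IsGood n N (fun i c => a i c ^^ ρ i) ↔ IsGood n N a := by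
  have key : ∀ s u v r : Bool, ((s ^^ (u ^^ r)) ^^ (v ^^ r)) = ((s ^^ u) ^^ v) := by decide
  simp only [IsGood, key]

theorem goodCount_congr {q N : ℕ} {a b : ℕ → ℕ → Bool}
    (hab : ∀ i c, i ≤ 8 → i ≤ c → c ≤ i + q + 1 → a i c = b i c) :
    goodCount (10 + q) N a = goodCount (10 + q) N b := by
  classical
  unfold goodCount
  congr 1
  ext v
  simp only [Finset.mem_filter, Finset.mem_univ, true_and]
  exact isGood_congr fun i c h1 h2 h3 => by rw [hab i c h1 h2 h3]

theorem goodCount_scale {q N : ℕ} {a : ℕ → ℕ → Bool} (ρ σ : ℕ → Bool) :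
    goodCount (10 + q) N (fun i c => (a i c ^^ ρ i) ^^ σ c) = goodCount (10 + q) N a := by
  classical
  unfold goodCount
  have key : ∀ v : Fin (10 + q) → Bool,
      IsGood (10 + q) N (fun i c => ((a i c ^^ ρ i) ^^ σ c) ^^ extendVec v c) ↔
        IsGood (10 + q) N fun i c => a i c ^^ extendVec (fun c => v c ^^ σ c) c := by
    intro v
    rw [← isGood_row_scale (a := fun i c => a i c ^^ extendVec (fun c => v c ^^ σ c) c) ρ]
    refine isGood_congr fun i c h1 h2 h3 => ?_
    rw [extendVec_of_lt _ (show c < 10 + q by omega), extendVec_of_lt _ (show c < 10 + q by omega)]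
    generalize a i c = x1; generalize ρ i = x2; generalize σ c = x3; generalize v _ = x4
    revert x1 x2 x3 x4
    decide
  refine Finset.card_nbij' (fun v c => v c ^^ σ c) (fun v c => v c ^^ σ c) ?_ ?_ ?_ ?_
  · intro v hv
    simpa only [Finset.coe_filter, Finset.mem_univ, true_and, Set.mem_ofPred_eq, key] using hv
  · intro v hv
    simp only [Finset.coe_filter, Finset.mem_univ, true_and, Set.mem_ofPred_eq, key] at hv ⊢
    simpa only [Bool.xor_assoc, Bool.xor_self, Bool.xor_false] using hv
  · intro v _
    simp
  · intro v _
    simp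

/-- The matrix obtained by rotating by a half turn. -/
def rotate (n : ℕ) (a : ℕ → ℕ → Bool) (i c : ℕ) : Bool := a (8 - i) (n - 1 - c)

/-- Reading a circuit backwards turns the matrix by a half turn. -/
theorem IsGood.rotate {q N : ℕ} {a : ℕ → ℕ → Bool} (h : IsGood (10 + q) N a) :
    IsGood (10 + q) N (rotate (10 + q) a) := by
  intro x s hx hn hs
  have hb := fun m hm => index_bounds hx hn (m := m) hm
  have h0 := h (fun m => 10 + q - 1 - x (9 - m)) (fun m => s (9 - m)) ?_ ?_ ?_
  · have hcard : #{m ∈ range 10 | s (9 - m) = true} = #{m ∈ range 10 | s m = true} := by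
      refine Finset.card_nbij' (9 - ·) (9 - ·) ?_ ?_ ?_ ?_
      · intro m hm
        simp only [Finset.coe_filter, Finset.mem_range, Set.mem_ofPred_eq] at hm ⊢
        exact ⟨by omega, hm.2⟩
      · intro m hm
        simp only [Finset.coe_filter, Finset.mem_range, Set.mem_ofPred_eq] at hm ⊢
        refine ⟨by omega, ?_⟩
        rw [show 9 - (9 - m) = m by omega]
        exact hm.2
      · intro m hm
        simp only [Finset.coe_filter, Finset.mem_range, Set.mem_ofPred_eq] at hm
        simp only
        omega
      · intro m hm
        simp only [Finset.coe_filter, Finset.mem_range, Set.mem_ofPred_eq] at hm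
        simp only
        omega
    rwa [hcard] at h0
  · intro m m' hmm hm'
    have h1 := hx (9 - m') (9 - m) (by omega) (by omega)
    have h2 := hb (9 - m) (by omega)
    have h3 := hb (9 - m') (by omega)
    omega
  · omega
  · intro m hm
    have h1 := hs (8 - m) (by omega)
    rw [show 8 - m + 1 = 9 - m by omega, _root_.rotate, _root_.rotate,
      show 8 - (8 - m) = m by omega] at h1
    rw [show 9 - (m + 1) = 8 - m by omega, h1]
    generalize s _ = x1; generalize a _ _ = x2; generalize a _ _ = x3
    revert x1 x2 x3
    decide

theorem isGood_rotate {q N : ℕ} {a : ℕ → ℕ → Bool} :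
    IsGood (10 + q) N (rotate (10 + q) a) ↔ IsGood (10 + q) N a := by
  refine ⟨fun h => ?_, fun h => h.rotate⟩
  refine h.rotate.congr fun i c h1 h2 h3 => ?_
  rw [rotate, rotate]
  congr 1 <;> omega

theorem goodCount_rotate {q N : ℕ} {a : ℕ → ℕ → Bool} :
    goodCount (10 + q) N (rotate (10 + q) a) = goodCount (10 + q) N a := by
  classical
  have key : ∀ v : Fin (10 + q) → Bool,
      IsGood (10 + q) N (fun i c => rotate (10 + q) a i c ^^ extendVec v c) ↔
        IsGood (10 + q) N fun i c => a i c ^^ extendVec (fun c => v c.rev) c := by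
    intro v
    rw [← isGood_rotate (a := fun i c => a i c ^^ extendVec (fun c => v c.rev) c)]
    refine isGood_congr fun i c h1 h2 h3 => ?_
    rw [rotate, rotate, extendVec_of_lt _ (show c < 10 + q by omega),
      extendVec_of_lt _ (show 10 + q - 1 - c < 10 + q by omega)]
    congr 2
    ext
    simp only [Fin.val_rev]
    omega
  unfold goodCount
  refine Finset.card_nbij' (fun v c => v c.rev) (fun v c => v c.rev) ?_ ?_ ?_ ?_
  · intro v hv
    simpa [key] using hv
  · intro v hv
    simpa [key] using hv
  · intro v _
    simp
  · intro v _
    simp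

/-! ### Squares determine a sign matrix up to scaling -/

theorem square_scale {a : ℕ → ℕ → Bool} (ρ σ : ℕ → Bool) (i c : ℕ) :
    square (fun i c => (a i c ^^ ρ i) ^^ σ c) i c = square a i c := by
  simp only [square]
  generalize a i c = x1; generalize a (i + 1) c = x2; generalize a i (c + 1) = x3
  generalize a (i + 1) (c + 1) = x4; generalize ρ i = x5; generalize ρ (i + 1) = x6
  generalize σ c = x7; generalize σ (c + 1) = x8
  revert x1 x2 x3 x4 x5 x6 x7 x8
  decide

/-- Two matrices with the same squares in the band of entries that matter are scalings of each
other there. -/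
theorem exists_scaling_of_square_eq {q : ℕ} {a b : ℕ → ℕ → Bool}
    (h : ∀ i c, i ≤ 7 → i + 1 ≤ c → c ≤ i + q → square a i c = square b i c) :
    ∃ ρ σ : ℕ → Bool, ∀ i c, i ≤ 8 → i ≤ c → c ≤ i + q + 1 →
      b i c = ((a i c ^^ ρ i) ^^ σ c) := by
  -- As all squares of the difference `d` vanish, it is the sum of a row and a column function.
  let d : ℕ → ℕ → Bool := fun i c => a i c ^^ b i c
  let r : ℕ → Bool := fun i => d i (i + 1) ^^ d (i + 1) (i + 1)
  let ρ : ℕ → Bool := fun i => Nat.rec false (fun i x => x ^^ r i) i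
  have hρ : ∀ i, ρ (i + 1) = (ρ i ^^ r i) := fun i => rfl
  have h1 : ∀ i j, i ≤ 7 → j ≤ q → (d i (i + 1 + j) ^^ d (i + 1) (i + 1 + j)) = r i := by
    intro i j hi
    induction j with
    | zero => intro _; rfl
    | succ j ih =>
      intro hj
      rw [← ih (by omega)]
      have := h i (i + 1 + j) hi (by omega) (by omega)
      simp only [square] at this
      simp only [d, ← add_assoc]
      revert this
      generalize a i _ = x1; generalize a (i + 1) _ = x2
      generalize b i _ = x3; generalize b (i + 1) _ = x4
      generalize a i _ = x5; generalize a (i + 1) _ = x6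
      generalize b i _ = x7; generalize b (i + 1) _ = x8
      revert x1 x2 x3 x4 x5 x6 x7 x8
      decide
  have h2 : ∀ i j c, i + j ≤ 8 → i + j ≤ c → c ≤ i + q + 1 →
      (d i c ^^ ρ i) = (d (i + j) c ^^ ρ (i + j)) := by
    intro i j c
    induction j with
    | zero => intros; rfl
    | succ j ih =>
      intro h3 h4 h5
      rw [ih (by omega) (by omega) h5, ← add_assoc, hρ,
        ← h1 (i + j) (c - (i + j + 1)) (by omega) (by omega),
        show i + j + 1 + (c - (i + j + 1)) = c by omega]
      generalize d (i + j) c = x1; generalize d (i + j + 1) c = x2; generalize ρ (i + j) = x3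
      revert x1 x2 x3
      decide
  refine ⟨ρ, fun c => d (min c 8) c ^^ ρ (min c 8), fun i c h3 h4 h5 => ?_⟩
  have := h2 i (min c 8 - i) c (by omega) (by omega) h5
  rw [show i + (min c 8 - i) = min c 8 by omega] at this
  simp only [← this]
  simp only [d]
  generalize a i c = x1; generalize b i c = x2; generalize ρ i = x3
  revert x1 x2 x3
  decide

/-- Scaling makes all the entries along a staircase and in the last row equal to `false`. -/
theorem exists_normal_scaling (a : ℕ → ℕ → Bool) : ∃ ρ σ : ℕ → Bool,
    (∀ i ≤ 8, ((a i i ^^ ρ i) ^^ σ i) = false) ∧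
    (∀ i ≤ 8, ((a i (i + 1) ^^ ρ i) ^^ σ (i + 1)) = false) ∧
    ∀ c, 8 ≤ c → ((a 8 c ^^ ρ 8) ^^ σ c) = false := by
  let σ : ℕ → Bool := fun i => Nat.rec false (fun i x => (a i (i + 1) ^^ a i i) ^^ x) i
  have hσ : ∀ i, σ (i + 1) = ((a i (i + 1) ^^ a i i) ^^ σ i) := fun i => rfl
  have key : ∀ x y z : Bool, ((x ^^ (x ^^ y)) ^^ y) = false ∧
      ((y ^^ (x ^^ z)) ^^ ((y ^^ x) ^^ z)) = false := by decide
  refine ⟨fun i => a i i ^^ σ i, fun c => if c ≤ 8 then σ c else a 8 c ^^ (a 8 8 ^^ σ 8),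
    fun i hi => ?_, fun i hi => ?_, fun c hc => ?_⟩
  · simp only [if_pos hi]
    exact (key _ _ false).1
  · simp only
    split_ifs with h
    · rw [hσ]
      exact (key _ _ _).2
    · obtain rfl : i = 8 := by omega
      simp
  · simp only
    split_ifs with h
    · obtain rfl : c = 8 := by omega
      exact (key _ _ false).1
    · simp

/-! ### Good reorientations and balanced sign patterns -/

/-- The completions of a partial sign pattern, given by the positions and the signs of all its
remaining elements. -/
theorem allBalanced_iff {N : ℕ} {g : ℕ → ℕ → Bool} (ε : ℕ → Bool) (l c t p : ℕ) (Y : Bool)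
    (ht : t ≤ 10) :
    AllBalanced N g ((List.range' c l).map ε) c t p Y ↔
      ∀ (x : ℕ → ℕ) (s : ℕ → Bool), (∀ m m', t ≤ m → m < m' → m' < 10 → x m < x m') →
        (∀ m, t ≤ m → m < 10 → c ≤ x m ∧ x m < c + l) →
        (t < 10 → s t = !((Y ^^ g t (x t)) ^^ ε (x t))) →
        (∀ m, t ≤ m → m < 9 → s (m + 1) =
          !((((s m ^^ g (m + 1) (x m)) ^^ ε (x m)) ^^ g (m + 1) (x (m + 1))) ^^
            ε (x (m + 1)))) →
        p + #{m ∈ Ico t 10 | s m = true} ≤ N ∧ 10 ≤ p + #{m ∈ Ico t 10 | s m = true} + N := by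
  induction l generalizing c t p Y with
  | zero =>
    simp only [List.range'_zero, List.map_nil, AllBalanced]
    rcases ht.lt_or_eq with h | rfl
    · refine ⟨fun _ x s _ h1 => ?_, fun _ h' => by omega⟩
      have := h1 t le_rfl h
      omega
    · simp only [Ico_self, filter_empty, card_empty, add_zero, true_imp_iff]
      refine ⟨fun h x s _ _ _ _ => h, fun h => h (fun _ => 0) (fun _ => false) ?_ ?_ ?_ ?_⟩
      all_goals intros; omega
  | succ l ih =>
    rw [List.range'_succ, List.map_cons, AllBalanced, ih (c + 1) t p Y ht]
    constructor
    · rintro ⟨h1, h2⟩ x s hx hc h0 hs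
      by_cases hxt : t < 10 ∧ x t = c
      · obtain ⟨htt, hxt⟩ := hxt
        have h3 := (ih (c + 1) (t + 1) _ _ htt).1 (h2 htt) x s
          (fun m m' h => hx m m' (by omega)) (fun m h h' => by
            have h4 := hc m (by omega) h'
            have h5 := hx t m le_rfl (by omega) h'
            omega)
          (fun h => by rw [hs t le_rfl (by omega), h0 htt, hxt])
          (fun m h => hs m (by omega))
        have h4 : #{m ∈ Ico t 10 | s m = true} =
            (s t).toNat + #{m ∈ Ico (t + 1) 10 | s m = true} := by
          rw [← Finset.insert_Ico_add_one_left_eq_Ico htt, Finset.filter_insert]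
          cases s t
          · simp
          · simp [add_comm]
        rw [h4, ← add_assoc, h0 htt, hxt]
        exact h3
      · refine h1 x s hx (fun m h h' => ?_) h0 hs
        have h4 := hc m h h'
        have h5 := hc t le_rfl (by omega)
        rcases h.lt_or_eq with h6 | rfl
        · have := hx t m le_rfl h6 h'
          omega
        · omega
    · intro h
      refine ⟨fun x s hx hc => h x s hx fun m h1 h2 => ?_, fun htt => ?_⟩
      · have := hc m h1 h2
        omega
      · rw [ih (c + 1) (t + 1) _ _ htt]
        intro x s hx hc h0 hs
        have h3 := h (fun m => if m = t then c else x m)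
          (fun m => if m = t then !((Y ^^ g t c) ^^ ε c) else s m) ?_ ?_ ?_ ?_
        · have h4 : #{m ∈ Ico t 10 | (if m = t then !((Y ^^ g t c) ^^ ε c) else s m) = true} =
              (!((Y ^^ g t c) ^^ ε c)).toNat + #{m ∈ Ico (t + 1) 10 | s m = true} := by
            rw [← Finset.insert_Ico_add_one_left_eq_Ico htt, Finset.filter_insert,
              Finset.filter_congr (q := fun m => s m = true) (fun m hm => by
                rw [if_neg (by rw [Finset.mem_Ico] at hm; omega)])]
            simp only [if_true]
            cases !((Y ^^ g t c) ^^ ε c)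
            · simp
            · simp [add_comm]
          rwa [h4, ← add_assoc] at h3
        · intro m m' h4 h5 h6
          have h7 := hc m' (by omega) h6
          simp only [if_neg (show m' ≠ t by omega)]
          split_ifs with h8
          · omega
          · exact hx m m' (by omega) h5 h6
        · intro m h4 h5
          split_ifs with h8
          · omega
          · have := hc m (by omega) h5
            omega
        · intro _
          simp
        · intro m h4 h5
          simp only [if_neg (show m + 1 ≠ t by omega)]
          split_ifs with h8
          · subst h8
            exact h0 (by omega)
          · exact hs m (by omega) h5

/-- The matrix `a` below a row of `false`. -/
def padRow (a : ℕ → ℕ → Bool) : ℕ → ℕ → Bool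
  | 0, _ => false
  | t + 1, c => a t c

theorem card_filter_not (s : ℕ → Bool) :
    #{m ∈ range 10 | (!s m) = true} + #{m ∈ range 10 | s m = true} = 10 := by
  have := Finset.card_filter_add_card_filter_not (s := range 10) fun m => s m = true
  rw [Finset.card_range] at this
  simp only [Bool.not_eq_true'] at this ⊢
  simp only [Bool.not_eq_true] at this
  omega

theorem isGood_iff_allBalanced {n N : ℕ} {a : ℕ → ℕ → Bool} (v : Fin n → Bool) :
    IsGood n N (fun i c => a i c ^^ extendVec v c) ↔
      AllBalanced N (padRow a) (List.ofFn v) 0 0 0 false := by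
  have hv : List.ofFn v = (List.range' 0 n).map (extendVec v) := by
    apply List.ext_getElem
    · simp
    · intro i h1 h2
      simp only [List.getElem_ofFn, List.getElem_map, List.getElem_range', zero_add, one_mul]
      rw [extendVec_of_lt]
  rw [hv, allBalanced_iff _ _ _ _ _ _ (by norm_num)]
  simp only [zero_add, Nat.Ico_zero_eq_range, zero_le, true_imp_iff, padRow, Bool.xor_false,
    Bool.false_xor, show (0 : ℕ) < 10 by norm_num]
  have key : ∀ s u e w e' : Bool, (!((s ^^ (u ^^ e)) ^^ (w ^^ e'))) =
      !((((s ^^ u) ^^ e) ^^ w) ^^ e') := by decide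
  constructor
  · intro h x s hx hc _ hs
    exact h x s hx (hc 9 (by norm_num)).2 fun m hm => by rw [hs m hm, key]
  · intro h x s hx hn hs
    have hc : ∀ m < 10, True ∧ x m < n := fun m hm => by
      refine ⟨trivial, ?_⟩
      rcases (show m ≤ 9 by omega).lt_or_eq with h1 | rfl
      · exact (hx m 9 h1 (by norm_num)).trans hn
      · exact hn
    by_cases h0 : s 0 = !extendVec v (x 0)
    · exact h x s hx hc h0 fun m hm => by rw [hs m hm, key]
    · have hnot : ∀ u w e y e' : Bool, (!!((u ^^ (w ^^ e)) ^^ (y ^^ e'))) =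
          !(((((!u) ^^ w) ^^ e) ^^ y) ^^ e') := by decide
      have h1 := h x (fun m => !s m) hx hc
        (by
          revert h0
          generalize s 0 = u; generalize extendVec v (x 0) = w
          revert u w
          decide)
        (fun m hm => by rw [hs m hm, hnot])
      have := card_filter_not s
      omega

/-- Scaling all columns replaces positive elements by negative ones. -/
theorem allBalanced_map_not {N : ℕ} {g : ℕ → ℕ → Bool} {es : List Bool} {c t p : ℕ} {Y : Bool}
    (hp : p ≤ t) :
    AllBalanced N g (es.map not) c t p Y ↔ AllBalanced N g es c t (t - p) Y := by
  induction es generalizing c t p Y with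
  | nil =>
    simp only [List.map_nil, AllBalanced]
    refine imp_congr_right fun h => ?_
    omega
  | cons e es ih =>
    simp only [List.map_cons, AllBalanced, ih hp]
    refine and_congr_right fun _ => imp_congr_right fun _ => ?_
    have key : ∀ y u e : Bool, (!((y ^^ u) ^^ !e)) = ((y ^^ u) ^^ e) ∧
        ((!((y ^^ u) ^^ !e)) ^^ !e) = ((!((y ^^ u) ^^ e)) ^^ e) := by decide
    have hswap : ∀ y u w e : Bool, ((y ^^ u) ^^ !e) = ((y ^^ !e) ^^ u) ∧
        ((y ^^ u) ^^ e) = ((y ^^ e) ^^ u) := by decide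
    have hle := Bool.toNat_le (!((Y ^^ g t c) ^^ !e))
    rw [ih (by omega), (hswap (!((Y ^^ g t c) ^^ !e)) (g (t + 1) c) false e).1, (key _ _ _).2,
      (hswap (!((Y ^^ g t c) ^^ e)) (g (t + 1) c) false e).2]
    have hnum : t + 1 - (p + (!((Y ^^ g t c) ^^ !e)).toNat) =
        t - p + (!((Y ^^ g t c) ^^ e)).toNat := by
      rw [(key _ _ _).1]
      cases (Y ^^ g t c) ^^ e
      · simp only [Bool.toNat_false, Bool.not_false, Bool.toNat_true]; omega
      · simp only [Bool.toNat_true, Bool.not_true, Bool.toNat_false]; omega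
    rw [hnum]

/-- The condition is symmetric in the two signs. -/
theorem allBalanced_compl {N : ℕ} {g : ℕ → ℕ → Bool} {es : List Bool} {c t p : ℕ} {Y : Bool}
    (hp : p ≤ t) :
    AllBalanced N g es c t (t - p) (!Y) ↔ AllBalanced N g es c t p Y := by
  induction es generalizing c t p Y with
  | nil =>
    simp only [AllBalanced]
    refine imp_congr_right fun h => ?_
    omega
  | cons e es ih =>
    simp only [AllBalanced, ih hp]
    refine and_congr_right fun _ => imp_congr_right fun _ => ?_
    have hle := Bool.toNat_le (!((Y ^^ g t c) ^^ e))
    rw [← ih (p := p + _) (by omega)]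
    have hnum : t + 1 - (p + (!((Y ^^ g t c) ^^ e)).toNat) =
        t - p + (!(((!Y) ^^ g t c) ^^ e)).toNat := by
      have : (((!Y) ^^ g t c) ^^ e) = !((Y ^^ g t c) ^^ e) := by
        cases Y <;> simp
      rw [this]
      cases (Y ^^ g t c) ^^ e
      · simp only [Bool.toNat_false, Bool.not_false, Bool.toNat_true, Bool.not_true]; omega
      · simp only [Bool.toNat_true, Bool.not_true, Bool.toNat_false, Bool.not_false]; omega
    have hY : (((!(((!Y) ^^ g t c) ^^ e)) ^^ g (t + 1) c) ^^ e) =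
        !(((!((Y ^^ g t c) ^^ e)) ^^ g (t + 1) c) ^^ e) := by
      cases Y <;> simp
    rw [hnum, hY]

open Classical in
/-- Negating a column scaling reverses all signs, so half of the good scalings start with
`false`. -/
theorem goodCount_eq_two_mul (m N : ℕ) (a : ℕ → ℕ → Bool) :
    goodCount (m + 1) N a =
      2 * #{v : Fin m → Bool | AllBalanced N (padRow a) (false :: List.ofFn v) 0 0 0 false} := by
  have hnot : ∀ v : Fin m → Bool,
      AllBalanced N (padRow a) (true :: List.ofFn v) 0 0 0 false ↔
        AllBalanced N (padRow a) (false :: List.ofFn fun i => !v i) 0 0 0 false := by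
    intro v
    have h := allBalanced_map_not (N := N) (g := padRow a) (es := true :: List.ofFn v) (c := 0)
      (t := 0) (p := 0) (Y := false) le_rfl
    rw [List.map_cons, List.map_ofFn] at h
    exact h.symm
  unfold goodCount
  simp only [isGood_iff_allBalanced, List.ofFn_succ]
  rw [card_filter_cons fun e (v : Fin m → Bool) =>
    AllBalanced N (padRow a) (e :: List.ofFn v) 0 0 0 false, two_mul]
  congr 1
  simp only [hnot]
  refine Finset.card_nbij' (fun v i => !v i) (fun v i => !v i) ?_ ?_ ?_ ?_
  · intro v hv
    simpa using hv
  · intro v hv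
    simpa using hv
  · intro v _
    simp
  · intro v _
    simp

theorem testBit_rowEntry (a : ℕ → ℕ → ℕ) (b : ℕ) :
    (fun t c => (rowEntry a t c).testBit b) = padRow fun i c => (a i c).testBit b := by
  funext t c
  cases t <;> simp [rowEntry, padRow]

/-- What a successful run of `boardCheck` says about the board with index `b`. -/
theorem goodCount_of_boardCheck {q N k d C : ℕ} (hN : 5 ≤ N) (hC : C < 2 ^ (10 + q))
    {a : ℕ → ℕ → ℕ} (ha : ∀ t c, a t c < 2 ^ 2 ^ k) (h : boardCheck q N k d C a = true) {b : ℕ}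
    (hb : b < 2 ^ k) {a' : ℕ → ℕ → Bool}
    (haa : ∀ i c, i ≤ 8 → i ≤ c → c ≤ i + q + 1 → a' i c = (a i c).testBit b) :
    goodCount (10 + q) N a' ≤ 2 * C ∧
      (goodCount (10 + q) N a' = 2 * C ↔ SquaresAgree q a') := by
  classical
  have h1 := of_boardCheck hC h hb (planeValue_countPlanes hN ha hb)
  rw [testBit_rowEntry] at h1
  have h2 : SquaresAgree q a' ↔ SquaresAgree q fun i c => (a i c).testBit b := by
    refine forall₂_congr fun i c => imp_congr_right fun hi => imp_congr_right fun h3 =>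
      imp_congr_right fun h4 => ?_
    simp only [square, haa i c (by omega) (by omega) (by omega),
      haa (i + 1) c (by omega) (by omega) (by omega),
      haa i (c + 1) (by omega) (by omega) (by omega),
      haa (i + 1) (c + 1) (by omega) (by omega) (by omega),
      haa (i + 1 + 1) c (by omega) (by omega) (by omega),
      haa (i + 1 + 1) (c + 1) (by omega) (by omega) (by omega)]
  have h3 := goodCount_eq_two_mul (9 + q) N fun i c => (a i c).testBit b
  rw [show 9 + q + 1 = 10 + q by ring, ← goodCount_congr haa] at h3
  rw [h3, h2, ← h1.2]
  have := h1.1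
  omega

/-! ### Sign matrices in normal form -/

/-- The entries along a staircase and in the last row are `false`. -/
structure IsNormal (a : ℕ → ℕ → Bool) : Prop where
  diag : ∀ i ≤ 8, a i i = false
  next : ∀ i ≤ 8, a i (i + 1) = false
  last : ∀ c, 8 ≤ c → a 8 c = false

theorem squaresAgree_congr {q : ℕ} {a b : ℕ → ℕ → Bool}
    (h : ∀ i c, i ≤ 7 → i + 1 ≤ c → c ≤ i + q → square a i c = square b i c) :
    SquaresAgree q a ↔ SquaresAgree q b := by
  refine forall₂_congr fun i c => imp_congr_right fun hi => imp_congr_right fun h1 =>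
    imp_congr_right fun h2 => ?_
  rw [h i c (by omega) (by omega) (by omega), h (i + 1) c (by omega) (by omega) (by omega)]

/-- The number of good scalings depends on the squares only. -/
theorem goodCount_congr_square {q N : ℕ} {a b : ℕ → ℕ → Bool}
    (h : ∀ i c, i ≤ 7 → i + 1 ≤ c → c ≤ i + q → square a i c = square b i c) :
    goodCount (10 + q) N a = goodCount (10 + q) N b := by
  obtain ⟨ρ, σ, hab⟩ := exists_scaling_of_square_eq h
  rw [goodCount_congr hab, goodCount_scale]

theorem exists_isNormal (a : ℕ → ℕ → Bool) :
    ∃ b, IsNormal b ∧ ∀ i c, square b i c = square a i c := by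
  obtain ⟨ρ, σ, h1, h2, h3⟩ := exists_normal_scaling a
  exact ⟨fun i c => (a i c ^^ ρ i) ^^ σ c, ⟨h1, h2, h3⟩, fun i c => square_scale ρ σ i c⟩

/-- The family of matrices given by bitsets whose rows start at the diagonal. -/
def boardOfRows (L : List (List ℕ)) (i c : ℕ) : ℕ := (L.getD i []).getD (c - i) 0

theorem boardOfRows_lt {L : List (List ℕ)} {B : ℕ} (hB : 0 < B) (h : ∀ l ∈ L, ∀ x ∈ l, x < B)
    (i c : ℕ) : boardOfRows L i c < B := by
  rw [boardOfRows]
  rcases lt_or_ge i L.length with hi | hi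
  · rw [List.getD_eq_getElem _ _ hi]
    rcases lt_or_ge (c - i) L[i].length with hj | hj
    · rw [List.getD_eq_getElem _ _ hj]
      exact h _ (List.getElem_mem hi) _ (List.getElem_mem hj)
    · rwa [List.getD_eq_default _ _ hj]
  · rw [List.getD_eq_default _ _ hi]
    simpa using hB

/-- The constant family. -/
def constBits (k : ℕ) (x : Bool) : ℕ := bif x then oneBits k else 0

theorem constBits_lt (k : ℕ) (x : Bool) : constBits k x < 2 ^ 2 ^ k := by
  cases x
  · simp [constBits]
  · exact oneBits_lt k

theorem testBit_constBits {k b : ℕ} (hb : b < 2 ^ k) (x : Bool) :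
    (constBits k x).testBit b = x := by
  cases x
  · simp [constBits]
  · exact testBit_oneBits hb

/-! ### Twelve elements -/

/-- All matrices in normal form for `12` elements with the entries `f`, `g`, `h` in three places.
The other free entries are index bits. -/
def board12 (f g h : Bool) : ℕ → ℕ → ℕ := boardOfRows
  [[0, 0, varBits 13 0, varBits 13 1], [0, 0, varBits 13 2, varBits 13 3],
    [0, 0, varBits 13 4, varBits 13 5], [0, 0, varBits 13 6, varBits 13 7],
    [0, 0, varBits 13 8, varBits 13 9], [0, 0, varBits 13 10, varBits 13 11],
    [0, 0, varBits 13 12, constBits 13 f], [0, 0, constBits 13 g, constBits 13 h]]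

theorem board12_lt (f g h : Bool) (i c : ℕ) : board12 f g h i c < 2 ^ 2 ^ 13 := by
  refine boardOfRows_lt (by positivity) ?_ i c
  have h0 : 0 < 2 ^ 2 ^ 13 := by positivity
  simp only [List.forall_mem_cons, List.not_mem_nil, false_imp_iff, implies_true, and_true,
    varBits_lt, constBits_lt, h0]

/-- A run of the program for each of the eight families, evaluated by the kernel. -/
theorem board12_check_two (f g h : Bool) : boardCheck 2 7 13 6 747 (board12 f g h) = true := by
  rcases f with _ | _ <;> rcases g with _ | _ <;> rcases h with _ | _ <;> decide +kernel

theorem board12_check_three (f g h : Bool) : boardCheck 2 6 13 6 99 (board12 f g h) = true := by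
  rcases f with _ | _ <;> rcases g with _ | _ <;> rcases h with _ | _ <;> decide +kernel

theorem exists_board12 {a : ℕ → ℕ → Bool} (ha : IsNormal a) : ∃ f g h, ∃ b < 2 ^ 13,
    ∀ i c, i ≤ 8 → i ≤ c → c ≤ i + 2 + 1 → a i c = (board12 f g h i c).testBit b := by
  let v : Fin 13 → Bool := fun j => a (j / 2) (j / 2 + (2 + j % 2))
  have hb : Nat.ofBits v < 2 ^ 13 := Nat.ofBits_lt_two_pow v
  have hv : ∀ j, j < 13 → (varBits 13 j).testBit (Nat.ofBits v) =
      a (j / 2) (j / 2 + (2 + j % 2)) := fun j hj => by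
    rw [testBit_varBits hj hb, Nat.testBit_ofBits_lt v j hj]
  refine ⟨a 6 9, a 7 9, a 7 10, Nat.ofBits v, hb, fun i c hi hic hc => ?_⟩
  obtain ⟨u, rfl⟩ := Nat.exists_eq_add_of_le hic
  rw [board12, boardOfRows, Nat.add_sub_cancel_left]
  rcases hi.lt_or_eq with hi' | rfl
  · have hu : u < 4 := by omega
    interval_cases u
    · rw [add_zero, ha.diag i hi]
      interval_cases i <;> simp
    · rw [ha.next i hi]
      interval_cases i <;> simp
    · interval_cases i <;> simp [hv, testBit_constBits hb]
    · interval_cases i <;> simp [hv, testBit_constBits hb]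
  · rw [ha.last _ hic]
    simp

/-- The bound for `2`-neighborly reorientations: circuits have at most `7` elements of a sign. -/
theorem goodCount_twelve_two (a : ℕ → ℕ → Bool) :
    goodCount 12 7 a ≤ 2 * 747 ∧ (goodCount 12 7 a = 2 * 747 ↔ SquaresAgree 2 a) := by
  obtain ⟨b, hb, hsq⟩ := exists_isNormal a
  obtain ⟨f, g, h, y, hy, hfam⟩ := exists_board12 hb
  have := goodCount_of_boardCheck (by norm_num) (by norm_num) (board12_lt f g h)
    (board12_check_two f g h) hy hfam
  rwa [goodCount_congr_square fun i c _ _ _ => hsq i c,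
    squaresAgree_congr fun i c _ _ _ => hsq i c] at this

/-- The bound for `3`-neighborly reorientations: circuits have at most `6` elements of a sign. -/
theorem goodCount_twelve_three (a : ℕ → ℕ → Bool) :
    goodCount 12 6 a ≤ 2 * 99 ∧ (goodCount 12 6 a = 2 * 99 ↔ SquaresAgree 2 a) := by
  obtain ⟨b, hb, hsq⟩ := exists_isNormal a
  obtain ⟨f, g, h, y, hy, hfam⟩ := exists_board12 hb
  have := goodCount_of_boardCheck (by norm_num) (by norm_num) (board12_lt f g h)
    (board12_check_three f g h) hy hfam
  rwa [goodCount_congr_square fun i c _ _ _ => hsq i c,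
    squaresAgree_congr fun i c _ _ _ => hsq i c] at this

/-! ### A symmetry of the first four columns -/

/-- Flips the entries that lie in an odd row and in a column of `τ`. -/
def altern (τ : ℕ → Bool) (a : ℕ → ℕ → Bool) (i c : ℕ) : Bool :=
  a i c ^^ (Nat.testBit i 0 && τ c)

theorem square_altern (τ : ℕ → Bool) (a : ℕ → ℕ → Bool) (i c : ℕ) :
    square (altern τ a) i c = (square a i c ^^ (τ c ^^ τ (c + 1))) := by
  simp only [square, altern, Nat.testBit_zero, Nat.succ_mod_two_eq_one_iff]
  generalize a i c = x1; generalize a (i + 1) c = x2; generalize a i (c + 1) = x3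
  generalize a (i + 1) (c + 1) = x4; generalize τ c = x5; generalize τ (c + 1) = x6
  rcases Nat.mod_two_eq_zero_or_one i with h | h
  · simp only [h, zero_ne_one, decide_false, decide_true]
    revert x1 x2 x3 x4 x5 x6
    decide
  · simp only [h, one_ne_zero, decide_false, decide_true]
    revert x1 x2 x3 x4 x5 x6
    decide

theorem squaresAgree_altern {q : ℕ} (τ : ℕ → Bool) (a : ℕ → ℕ → Bool) :
    SquaresAgree q (altern τ a) ↔ SquaresAgree q a := by
  simp only [SquaresAgree, square_altern, Bool.xor_left_inj]

/-- The state reached from a state by choosing column `c` with scaling `e`. -/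
def chooseColumn (g : ℕ → ℕ → Bool) (c : ℕ) (e : Bool) (z : ℕ × ℕ × Bool) : ℕ × ℕ × Bool :=
  (z.1 + 1, z.2.1 + (!((z.2.2 ^^ g z.1 c) ^^ e)).toNat,
    (!((z.2.2 ^^ g z.1 c) ^^ e) ^^ g (z.1 + 1) c) ^^ e)

/-- The states reached from a list of states by choosing or skipping the columns from `c` on. -/
def reach (g : ℕ → ℕ → Bool) : List Bool → ℕ → List (ℕ × ℕ × Bool) → List (ℕ × ℕ × Bool)
  | [], _, st => st
  | e :: es, c, st => reach g es (c + 1) (st ++ st.map (chooseColumn g c e))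

theorem forall_reach_iff {N : ℕ} {g : ℕ → ℕ → Bool} (es es' : List Bool) (c : ℕ)
    (st : List (ℕ × ℕ × Bool)) (hst : ∀ z ∈ st, z.1 + es.length ≤ 10) :
    (∀ z ∈ reach g es c st, AllBalanced N g es' (c + es.length) z.1 z.2.1 z.2.2) ↔
      ∀ z ∈ st, AllBalanced N g (es ++ es') c z.1 z.2.1 z.2.2 := by
  induction es generalizing c st with
  | nil => rfl
  | cons e es ih =>
    simp only [List.length_cons] at hst
    have h1 : ∀ z ∈ st ++ st.map (chooseColumn g c e), z.1 + es.length ≤ 10 := by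
      intro z hz
      rcases List.mem_append.1 hz with hz | hz
      · have := hst z hz
        omega
      · obtain ⟨w, hw, rfl⟩ := List.mem_map.1 hz
        have := hst w hw
        simp only [chooseColumn]
        omega
    rw [List.length_cons, show c + (es.length + 1) = c + 1 + es.length by ring, reach, ih _ _ h1]
    simp only [List.mem_append, List.mem_map, or_imp, forall_and, forall_exists_index, and_imp,
      forall_apply_eq_imp_iff₂, List.cons_append, AllBalanced]
    refine and_congr_right fun _ => forall₂_congr fun z hz => ?_
    have := hst z hz
    rw [imp_iff_right (show z.1 < 10 by omega)]
    rfl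

theorem reach_bounds {g : ℕ → ℕ → Bool} {B : ℕ} (es : List Bool) (c : ℕ)
    (st : List (ℕ × ℕ × Bool)) (hst : ∀ z ∈ st, z.2.1 ≤ z.1 ∧ z.1 + es.length ≤ B) :
    ∀ z ∈ reach g es c st, z.2.1 ≤ z.1 ∧ z.1 ≤ B := by
  induction es generalizing c st with
  | nil => simpa [reach] using hst
  | cons e es ih =>
    refine ih _ _ fun z hz => ?_
    simp only [List.length_cons] at hst
    rcases List.mem_append.1 hz with hz | hz
    · have := hst z hz
      omega
    · obtain ⟨w, hw, rfl⟩ := List.mem_map.1 hz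
      have := hst w hw
      have := Bool.toNat_le (!((w.2.2 ^^ g w.1 c) ^^ e))
      simp only [chooseColumn]
      omega

theorem reach_congr {g g' : ℕ → ℕ → Bool} (es : List Bool) (c : ℕ) (st : List (ℕ × ℕ × Bool))
    (hst : ∀ z ∈ st, z.1 ≤ c)
    (hg : ∀ t c', t ≤ c' + 1 → c' < c + es.length → g t c' = g' t c') :
    reach g es c st = reach g' es c st := by
  induction es generalizing c st with
  | nil => rfl
  | cons e es ih =>
    simp only [List.length_cons] at hg
    rw [reach, reach, ih (c + 1) _ ?_ fun t c' h1 h2 => hg t c' h1 (by omega)]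
    · congr 2
      refine List.map_congr_left fun z hz => ?_
      have := hst z hz
      rw [chooseColumn, chooseColumn, hg _ _ (by omega) (by omega), hg _ _ (by omega) (by omega)]
    · intro z hz
      rcases List.mem_append.1 hz with hz | hz
      · have := hst z hz
        omega
      · obtain ⟨w, hw, rfl⟩ := List.mem_map.1 hz
        have := hst w hw
        simp only [chooseColumn]
        omega

/-- The set of states in a list, up to reversal of all signs, as a bitset. -/
def stateMask : List (ℕ × ℕ × Bool) → ℕ
  | [] => 0
  | z :: l => 2 ^ (5 * z.1 + bif z.2.2 then z.1 - z.2.1 else z.2.1) ||| stateMask l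

theorem forall_stateMask_iff {N c : ℕ} {g : ℕ → ℕ → Bool} {es : List Bool}
    {l : List (ℕ × ℕ × Bool)} (hl : ∀ z ∈ l, z.2.1 ≤ z.1 ∧ z.1 ≤ 4) :
    (∀ t p, p ≤ t → t ≤ 4 → (stateMask l).testBit (5 * t + p) = true →
      AllBalanced N g es c t p false) ↔ ∀ z ∈ l, AllBalanced N g es c z.1 z.2.1 z.2.2 := by
  induction l with
  | nil => simp [stateMask]
  | cons z l ih =>
    obtain ⟨⟨h1, h2⟩, h3⟩ := List.forall_mem_cons.1 hl
    rw [List.forall_mem_cons, ← ih h3]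
    simp only [stateMask, Nat.testBit_or, Bool.or_eq_true, or_imp, imp_and, forall_and,
      Nat.testBit_two_pow, decide_eq_true_eq]
    refine and_congr ?_ Iff.rfl
    obtain ⟨t, p, Y⟩ := z
    simp only at h1 h2 ⊢
    have key : ∀ p₀ ≤ t, (∀ t' p', p' ≤ t' → t' ≤ 4 → 5 * t + p₀ = 5 * t' + p' →
        AllBalanced N g es c t' p' false) ↔ AllBalanced N g es c t p₀ false := by
      intro p₀ hp₀
      refine ⟨fun h => h t p₀ hp₀ h2 rfl, fun h t' p' h4 h5 h6 => ?_⟩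
      obtain ⟨rfl, rfl⟩ : t = t' ∧ p₀ = p' := by omega
      exact h
    cases Y
    · exact key p h1
    · rw [cond_true, key _ (Nat.sub_le _ _), ← allBalanced_compl h1, Bool.not_true]

/-- All Boolean lists of length `n`. -/
def boolLists : ℕ → List (List Bool)
  | 0 => [[]]
  | n + 1 => (boolLists n).map (false :: ·) ++ (boolLists n).map (true :: ·)

theorem length_of_mem_boolLists {n : ℕ} {l : List Bool} (h : l ∈ boolLists n) : l.length = n := by
  induction n generalizing l with
  | zero =>
    obtain rfl : l = [] := by simpa [boolLists] using h
    rfl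
  | succ n ih =>
    rw [boolLists, List.mem_append, List.mem_map, List.mem_map] at h
    rcases h with ⟨l, hl, rfl⟩ | ⟨l, hl, rfl⟩
    · rw [List.length_cons, ih hl]
    · rw [List.length_cons, ih hl]

open Classical in
theorem card_filter_eq_sum_boolLists {n m k : ℕ} (hk : k = n + m) (P : List Bool → Prop) :
    #{v : Fin k → Bool | P (List.ofFn v)} =
      ((boolLists n).map fun l => #{w : Fin m → Bool | P (l ++ List.ofFn w)}).sum := by
  induction n generalizing k P with
  | zero =>
    obtain rfl : k = m := by omega
    simp [boolLists]
  | succ n ih =>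
    obtain ⟨k, rfl⟩ : ∃ k', k = k' + 1 := ⟨n + m, by omega⟩
    have hk' : k = n + m := by omega
    simp only [List.ofFn_succ]
    rw [card_filter_cons fun e (v : Fin k → Bool) => P (e :: List.ofFn v),
      ih hk' fun l => P (false :: l), ih hk' fun l => P (true :: l), boolLists, List.map_append,
      List.sum_append, List.map_map, List.map_map]
    rfl

/-- For each scaling of the first four columns, the set of states reached. The number of good
scalings depends on the list of these sets, up to order, and on the other columns only. -/
def columnMasks (a : ℕ → ℕ → Bool) : List ℕ :=
  (boolLists 4).map fun l => stateMask (reach (padRow a) l 0 [(0, 0, false)])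

open Classical in
theorem goodCount_eq_sum_columnMasks (m N : ℕ) (a : ℕ → ℕ → Bool) :
    goodCount (4 + m) N a = ((columnMasks a).map fun x => #{w : Fin m → Bool |
      ∀ t p, p ≤ t → t ≤ 4 → x.testBit (5 * t + p) = true →
        AllBalanced N (padRow a) (List.ofFn w) 4 t p false}).sum := by
  unfold goodCount
  simp only [isGood_iff_allBalanced]
  rw [card_filter_eq_sum_boolLists rfl fun l => AllBalanced N (padRow a) l 0 0 0 false,
    columnMasks, List.map_map]
  congr 1
  refine List.map_congr_left fun l hl => ?_
  have hlen := length_of_mem_boolLists hl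
  simp only [Function.comp]
  congr 1
  ext w
  simp only [Finset.mem_filter, Finset.mem_univ, true_and]
  rw [forall_stateMask_iff (reach_bounds _ _ _ (by simp [hlen]))]
  have := forall_reach_iff (N := N) (g := padRow a) l (List.ofFn w) 0 [(0, 0, false)]
    (by simp [hlen])
  rw [hlen] at this
  simpa using this.symm

theorem allBalanced_congr {N : ℕ} {g g' : ℕ → ℕ → Bool} {es : List Bool} {c t p : ℕ} {Y : Bool}
    (h : ∀ t c', c ≤ c' → g t c' = g' t c') :
    AllBalanced N g es c t p Y ↔ AllBalanced N g' es c t p Y := by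
  induction es generalizing c t p Y with
  | nil => rfl
  | cons e es ih =>
    have ih' : ∀ t p Y, AllBalanced N g es (c + 1) t p Y ↔ AllBalanced N g' es (c + 1) t p Y :=
      fun t p Y => ih fun t c' h' => h t c' (by omega)
    simp only [AllBalanced, h _ c le_rfl, ih']

theorem goodCount_congr_of_perm {m N : ℕ} {a b : ℕ → ℕ → Bool}
    (hab : ∀ i c, 4 ≤ c → a i c = b i c) (h : (columnMasks a).Perm (columnMasks b)) :
    goodCount (4 + m) N a = goodCount (4 + m) N b := by
  classical
  have hpad : ∀ t c, 4 ≤ c → padRow a t c = padRow b t c := by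
    rintro (_ | t) c hc
    · rfl
    · exact hab t c hc
  rw [goodCount_eq_sum_columnMasks, goodCount_eq_sum_columnMasks, (h.map _).sum_eq]
  simp only [allBalanced_congr hpad]

/-- The free entries in the first four columns of a matrix in normal form. -/
def triangle (x y z : Bool) : ℕ → ℕ → Bool
  | 0, 2 => x
  | 0, 3 => y
  | 1, 3 => z
  | _, _ => false

/-- A set of columns among `1`, `2`, `3`. -/
def columnChoice (t₁ t₂ t₃ : Bool) : ℕ → Bool
  | 1 => t₁
  | 2 => t₂
  | 3 => t₃
  | _ => false

/-- Flipping the entries in odd rows of some of the columns `1`, `2`, `3` only permutes the sets of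
states reached, if column `3` is left alone when `x ≠ y`. This is a finite verification. -/
theorem columnMasks_triangle : ∀ x y z t₁ t₂ t₃ : Bool, (t₃ = true → x = y) →
    (columnMasks (altern (columnChoice t₁ t₂ t₃) (triangle x y z))).isPerm
      (columnMasks (triangle x y z)) = true := by
  decide +kernel

theorem columnMasks_congr {a b : ℕ → ℕ → Bool} (h : ∀ i c, i ≤ c → c < 4 → a i c = b i c) :
    columnMasks a = columnMasks b := by
  refine List.map_congr_left fun l hl => ?_
  rw [reach_congr _ _ _ (by simp)]
  rw [length_of_mem_boolLists hl]
  rintro (_ | t) c h1 h2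
  · rfl
  · exact h t c (by omega) (by omega)

theorem goodCount_altern {m N : ℕ} {a : ℕ → ℕ → Bool} (ha : IsNormal a) {t₁ t₂ t₃ : Bool}
    (h : t₃ = true → a 0 2 = a 0 3) :
    goodCount (4 + m) N (altern (columnChoice t₁ t₂ t₃) a) = goodCount (4 + m) N a := by
  have htri : ∀ i c, i ≤ c → c < 4 → a i c = triangle (a 0 2) (a 0 3) (a 1 3) i c := by
    intro i c h1 h2
    rcases (show c = i ∨ c = i + 1 ∨ (i = 0 ∧ c = 2) ∨ (i = 0 ∧ c = 3) ∨ (i = 1 ∧ c = 3) by omega)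
      with rfl | rfl | ⟨rfl, rfl⟩ | ⟨rfl, rfl⟩ | ⟨rfl, rfl⟩
    · rw [ha.diag _ (by omega)]
      interval_cases c <;> rfl
    · rw [ha.next _ (by omega)]
      have : i < 3 := by omega
      interval_cases i <;> rfl
    all_goals rfl
  refine goodCount_congr_of_perm (fun i c hc => ?_) ?_
  · obtain ⟨c, rfl⟩ := Nat.exists_eq_add_of_le' hc
    simp [altern, columnChoice]
  · rw [columnMasks_congr htri, columnMasks_congr fun i c h1 h2 => show
      altern (columnChoice t₁ t₂ t₃) a i c = altern (columnChoice t₁ t₂ t₃)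
        (triangle (a 0 2) (a 0 3) (a 1 3)) i c by rw [altern, altern, htri i c h1 h2]]
    exact List.isPerm_iff.1 (columnMasks_triangle _ _ _ _ _ _ h)

/-- The first few squares can be prescribed without changing the number of good scalings. -/
theorem exists_first_squares {q N : ℕ} (a : ℕ → ℕ → Bool) : ∃ b : ℕ → ℕ → Bool,
    goodCount (10 + q) N b = goodCount (10 + q) N a ∧
    (SquaresAgree q b ↔ SquaresAgree q a) ∧ (∀ i c, 4 ≤ c → square b i c = square a i c) ∧
    square b 0 1 = false ∧ square b 0 2 = false ∧
    (square b 1 2 = false → square b 0 3 = false) := by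
  obtain ⟨b, hb, hsq⟩ := exists_isNormal a
  have h22 := hb.diag 2 (by norm_num)
  have h12 := hb.next 1 (by norm_num)
  have h23 := hb.next 2 (by norm_num)
  let t₃ := decide (b 0 2 = b 0 3) && square b 0 3
  let t₂ := square b 0 2 ^^ t₃
  let t₁ := square b 0 1 ^^ t₂
  refine ⟨altern (columnChoice t₁ t₂ t₃) b, ?_, ?_, ?_, ?_, ?_, ?_⟩
  · rw [← goodCount_congr_square fun i c _ _ _ => hsq i c]
    have := goodCount_altern (m := 6 + q) (N := N) hb (t₁ := t₁) (t₂ := t₂) (t₃ := t₃) (by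
      intro h
      simp only [t₃, Bool.and_eq_true, decide_eq_true_eq] at h
      exact h.1)
    rwa [show 4 + (6 + q) = 10 + q by ring] at this
  · rw [squaresAgree_altern, squaresAgree_congr fun i c _ _ _ => hsq i c]
  · intro i c hc
    obtain ⟨c, rfl⟩ := Nat.exists_eq_add_of_le' hc
    simp [square_altern, columnChoice, hsq]
  · simp [square_altern, columnChoice, t₁]
  · simp [square_altern, columnChoice, t₂]
  · simp only [square_altern, columnChoice, t₂, t₃]
    simp only [square, h22, h12, h23, zero_add, Nat.reduceAdd]
    generalize b 0 2 = x1; generalize b 0 3 = x2; generalize b 1 3 = x3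
    generalize b 0 4 = x4; generalize b 1 4 = x5
    revert x1 x2 x3 x4 x5
    decide

/-! ### Thirteen elements -/

/-- The bitset `x`, complemented if `y` holds. -/
def complIf (k : ℕ) (y : Bool) (x : ℕ) : ℕ := bif y then x ^^^ oneBits k else x

theorem complIf_lt {k x : ℕ} (hx : x < 2 ^ 2 ^ k) (y : Bool) : complIf k y x < 2 ^ 2 ^ k := by
  cases y
  · exact hx
  · exact Nat.xor_lt_two_pow hx (oneBits_lt k)

theorem testBit_complIf {k b : ℕ} (hb : b < 2 ^ k) (y : Bool) (x : ℕ) :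
    (complIf k y x).testBit b = (x.testBit b ^^ y) := by
  cases y
  · simp [complIf]
  · simp [complIf, testBit_oneBits hb]

/-- The matrices in normal form for `13` elements whose ends are reduced, with the given constant
entries. As `a 0 3 = a 1 3 = p`, the entry in row `0`, column `4` may differ from that in row `1`
only if `p` holds, which is recorded by `y`; the entries of row `7` are equal to `w`. -/
def board13 (p y r s t u w : Bool) : ℕ → ℕ → ℕ := boardOfRows
  [[0, 0, 0, constBits 13 p, complIf 13 y (varBits 13 0)],
    [0, 0, constBits 13 p, varBits 13 0, constBits 13 r],
    [0, 0, varBits 13 1, varBits 13 2, varBits 13 3],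
    [0, 0, varBits 13 4, varBits 13 5, varBits 13 6],
    [0, 0, varBits 13 7, varBits 13 8, varBits 13 9],
    [0, 0, varBits 13 10, varBits 13 11, varBits 13 12],
    [0, 0, constBits 13 s, constBits 13 t, constBits 13 u],
    [0, 0, constBits 13 w, constBits 13 w, constBits 13 w]]

theorem board13_lt (p y r s t u w : Bool) (i c : ℕ) :
    board13 p y r s t u w i c < 2 ^ 2 ^ 13 := by
  refine boardOfRows_lt (by positivity) ?_ i c
  have h0 : 0 < 2 ^ 2 ^ 13 := by positivity
  have h1 := complIf_lt (varBits_lt 13 0) y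
  simp only [List.forall_mem_cons, List.not_mem_nil, false_imp_iff, implies_true, and_true,
    varBits_lt, constBits_lt, h0, h1]

theorem board13_check_false_false (r s t u w : Bool) (hw : w = true → t ≠ u) :
    boardCheck 3 6 13 6 79 (board13 false false r s t u w) = true := by
  rcases w with _ | _
  · rcases r with _ | _ <;> rcases s with _ | _ <;> rcases t with _ | _ <;>
      rcases u with _ | _ <;> decide +kernel
  · obtain rfl : t = !u := Bool.eq_not.2 (hw rfl)
    rcases r with _ | _ <;> rcases s with _ | _ <;> rcases u with _ | _ <;> decide +kernel

theorem board13_check_true_false (r s t u w : Bool) (hw : w = true → t ≠ u) :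
    boardCheck 3 6 13 6 79 (board13 true false r s t u w) = true := by
  rcases w with _ | _
  · rcases r with _ | _ <;> rcases s with _ | _ <;> rcases t with _ | _ <;>
      rcases u with _ | _ <;> decide +kernel
  · obtain rfl : t = !u := Bool.eq_not.2 (hw rfl)
    rcases r with _ | _ <;> rcases s with _ | _ <;> rcases u with _ | _ <;> decide +kernel

theorem board13_check_true_true (r s t u w : Bool) (hw : w = true → t ≠ u) :
    boardCheck 3 6 13 6 79 (board13 true true r s t u w) = true := by
  rcases w with _ | _
  · rcases r with _ | _ <;> rcases s with _ | _ <;> rcases t with _ | _ <;>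
      rcases u with _ | _ <;> decide +kernel
  · obtain rfl : t = !u := Bool.eq_not.2 (hw rfl)
    rcases r with _ | _ <;> rcases s with _ | _ <;> rcases u with _ | _ <;> decide +kernel

theorem board13_check {p y r s t u w : Bool} (hy : y = true → p = true) (hw : w = true → t ≠ u) :
    boardCheck 3 6 13 6 79 (board13 p y r s t u w) = true := by
  rcases p with _ | _ <;> rcases y with _ | _
  · exact board13_check_false_false r s t u w hw
  · exact absurd (hy rfl) (by decide)
  · exact board13_check_true_false r s t u w hw
  · exact board13_check_true_true r s t u w hw

/-- The conditions on the first and on the last squares that the symmetries allow to impose. -/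
structure HasReducedEnds (a : ℕ → ℕ → Bool) : Prop where
  first₁ : square a 0 1 = false
  first₂ : square a 0 2 = false
  first₃ : square a 1 2 = false → square a 0 3 = false
  last₁ : square a 7 10 = false
  last₂ : square a 7 9 = false
  last₃ : square a 6 9 = false → square a 7 8 = false

theorem exists_board13 {a : ℕ → ℕ → Bool} (ha : IsNormal a) (hr : HasReducedEnds a) :
    ∃ p y r s t u w, (y = true → p = true) ∧ (w = true → t ≠ u) ∧ ∃ b < 2 ^ 13,
    ∀ i c, i ≤ 8 → i ≤ c → c ≤ i + 3 + 1 → a i c = (board13 p y r s t u w i c).testBit b := by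
  obtain ⟨h1, h2, h3, h4, h5, h6⟩ := hr
  have e1 := ha.diag 1 (by norm_num)
  have e2 := ha.diag 2 (by norm_num)
  have e8 := ha.diag 8 (by norm_num)
  have f0 := ha.next 0 (by norm_num)
  have f1 := ha.next 1 (by norm_num)
  have f2 := ha.next 2 (by norm_num)
  have f7 := ha.next 7 (by norm_num)
  have g9 := ha.last 9 (by norm_num)
  have g10 := ha.last 10 (by norm_num)
  have g11 := ha.last 11 (by norm_num)
  simp only [square, zero_add, Nat.reduceAdd] at h1 h2 h3 h4 h5 h6 f0 f1 f2 f7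
  have a02 : a 0 2 = false := by simpa [f0, e1, f1] using h1
  have a03 : a 0 3 = a 1 3 := by simpa [a02, f1] using h2
  have hy : (a 0 4 ^^ a 1 4) = true → a 1 3 = true := by
    intro h
    by_contra h13
    rw [Bool.not_eq_true] at h13
    have := h3 (by simp [f1, e2, f2, h13])
    rw [a03, Bool.xor_self, Bool.false_xor, h] at this
    exact absurd this (by decide)
  have hkey : ∀ x y : Bool, ((x ^^ false) ^^ (y ^^ false)) = false → y = x := by decide
  have a711 : a 7 11 = a 7 10 := hkey _ _ (by rwa [g10, g11] at h4)
  have a710 : a 7 10 = a 7 9 := hkey _ _ (by rwa [g9, g10] at h5)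
  have hw : a 7 9 = true → a 6 9 ≠ a 6 10 := by
    intro h h'
    have := h6 (by simp [a710, h'])
    simp [f7, e8, g9, h] at this
  let v : Fin 13 → Bool := fun j => if j.val = 0 then a 1 4 else
    a (2 + (j - 1) / 3) (2 + (j - 1) / 3 + (2 + (j - 1) % 3))
  have hb : Nat.ofBits v < 2 ^ 13 := Nat.ofBits_lt_two_pow v
  have hv0 : (varBits 13 0).testBit (Nat.ofBits v) = a 1 4 := by
    rw [testBit_varBits (by norm_num) hb, Nat.testBit_ofBits_lt v 0 (by norm_num)]
    rfl
  have hv : ∀ j, j < 13 → j ≠ 0 → (varBits 13 j).testBit (Nat.ofBits v) =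
      a (2 + (j - 1) / 3) (2 + (j - 1) / 3 + (2 + (j - 1) % 3)) := fun j hj h0 => by
    rw [testBit_varBits hj hb, Nat.testBit_ofBits_lt v j hj]
    simp [v, h0]
  have hx : (complIf 13 (a 0 4 ^^ a 1 4) (varBits 13 0)).testBit (Nat.ofBits v) = a 0 4 := by
    rw [testBit_complIf hb, hv0]
    cases a 0 4 <;> cases a 1 4 <;> rfl
  refine ⟨a 1 3, a 0 4 ^^ a 1 4, a 1 5, a 6 8, a 6 9, a 6 10, a 7 9, hy, hw, Nat.ofBits v, hb,
    fun i c hi hic hc => ?_⟩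
  obtain ⟨j, rfl⟩ := Nat.exists_eq_add_of_le hic
  rw [board13, boardOfRows, Nat.add_sub_cancel_left]
  rcases hi.lt_or_eq with hi' | rfl
  · have hj : j < 5 := by omega
    interval_cases j
    · rw [add_zero, ha.diag i hi]
      interval_cases i <;> simp
    · rw [ha.next i hi]
      interval_cases i <;> simp
    · interval_cases i <;> simp [hv, testBit_constBits hb, a02]
    · interval_cases i <;> simp [hv, hv0, testBit_constBits hb, a03, a710]
    · interval_cases i <;> simp [hv, hx, testBit_constBits hb, a710, a711]
  · rw [ha.last _ hic]
    simp

theorem square_rotate {a : ℕ → ℕ → Bool} {n i c : ℕ} (hi : i ≤ 7) (hc : c + 2 ≤ n) :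
    square (rotate n a) i c = square a (7 - i) (n - 2 - c) := by
  simp only [square, rotate]
  rw [show 8 - i = 7 - i + 1 by omega, show 8 - (i + 1) = 7 - i by omega,
    show n - 1 - c = n - 2 - c + 1 by omega, show n - 1 - (c + 1) = n - 2 - c by omega]
  generalize a _ _ = x1; generalize a _ _ = x2; generalize a _ _ = x3; generalize a _ _ = x4
  revert x1 x2 x3 x4
  decide

theorem squaresAgree_rotate {q : ℕ} (a : ℕ → ℕ → Bool) :
    SquaresAgree q (rotate (10 + q) a) ↔ SquaresAgree q a := by
  have key : ∀ a, SquaresAgree q a → SquaresAgree q (rotate (10 + q) a) := by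
    intro a h i c hi h1 h2
    rw [square_rotate (by omega) (by omega), square_rotate (by omega) (by omega)]
    have := h (6 - i) (10 + q - 2 - c) (by omega) (by omega) (by omega)
    rw [show 6 - i + 1 = 7 - i by omega] at this
    rw [show 7 - (i + 1) = 6 - i by omega, this]
  refine ⟨fun h => ?_, key a⟩
  have h' := key _ h
  rwa [squaresAgree_congr (b := a)] at h'
  intro i c h1 h2 h3
  rw [square_rotate h1 (by omega), square_rotate (by omega) (by omega)]
  congr 1 <;> omega

/-- The symmetry of the first columns, applied at both ends with the help of a half turn. -/
theorem exists_hasReducedEnds {N : ℕ} (a : ℕ → ℕ → Bool) : ∃ b : ℕ → ℕ → Bool,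
    goodCount 13 N b = goodCount 13 N a ∧ (SquaresAgree 3 b ↔ SquaresAgree 3 a) ∧
    IsNormal b ∧ HasReducedEnds b := by
  obtain ⟨b, hb1, hb2, -, hb3, hb4, hb5⟩ := exists_first_squares (q := 3) (N := N) a
  obtain ⟨c, hc1, hc2, hc3, hc4, hc5, hc6⟩ :=
    exists_first_squares (q := 3) (N := N) (rotate (10 + 3) b)
  obtain ⟨d, hd1, hd2⟩ := exists_isNormal c
  refine ⟨d, ?_, ?_, hd1, ?_⟩
  · rw [goodCount_congr_square (q := 3) fun i c _ _ _ => hd2 i c, hc1, goodCount_rotate, hb1]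
  · rw [squaresAgree_congr fun i c _ _ _ => hd2 i c, hc2, squaresAgree_rotate, hb2]
  · refine ⟨?_, ?_, ?_, ?_, ?_, ?_⟩ <;> simp only [hd2]
    · exact hc4
    · exact hc5
    · exact hc6
    · rw [hc3 _ _ (by norm_num), square_rotate (by norm_num) (by norm_num)]
      exact hb3
    · rw [hc3 _ _ (by norm_num), square_rotate (by norm_num) (by norm_num)]
      exact hb4
    · rw [hc3 _ _ (by norm_num), square_rotate (by norm_num) (by norm_num), hc3 _ _ (by norm_num),
        square_rotate (by norm_num) (by norm_num)]
      exact hb5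

/-- The bound for `3`-neighborly reorientations of `13` elements. -/
theorem goodCount_thirteen_three (a : ℕ → ℕ → Bool) :
    goodCount 13 6 a ≤ 2 * 79 ∧ (goodCount 13 6 a = 2 * 79 ↔ SquaresAgree 3 a) := by
  obtain ⟨b, hb1, hb2, hb3, hb4⟩ := exists_hasReducedEnds (N := 6) a
  obtain ⟨p, y, r, s, t, u, w, hy, hw, x, hx, hfam⟩ := exists_board13 hb3 hb4
  have := goodCount_of_boardCheck (by norm_num) (by norm_num) (board13_lt p y r s t u w)
    (board13_check hy hw) hx hfam
  rwa [hb1, hb2] at this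

/-! ### Circuits of Lawrence oriented matroids -/

namespace OrientedMatroid

/-- The sign of a Boolean: `true` stands for `-1`. -/
def boolSign (b : Bool) : SignType := bif b then -1 else 1

theorem boolSign_xor (b c : Bool) : boolSign (b ^^ c) = boolSign b * boolSign c := by
  revert b c
  decide

theorem boolSign_ne_zero (b : Bool) : boolSign b ≠ 0 := by
  revert b
  decide

/-- The sign vectors that are the circuits of a Lawrence oriented matroid of rank `9` with sign
matrix `a`, where `true` stands for `-1`. -/
def IsLawrenceVec {n : ℕ} (a : ℕ → ℕ → Bool) (X : Fin n → SignType) : Prop :=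
  ∃ x : Fin 10 → Fin n, StrictMono x ∧ (∀ e, X e ≠ 0 ↔ e ∈ Set.range x) ∧
    ∀ m : Fin 9, X (x m.succ) =
      -(boolSign (a m (x m.castSucc) ^^ a m (x m.succ)) * X (x m.castSucc))

theorem isLawrenceVec_false {n : ℕ} (X : Fin n → SignType) :
    IsLawrenceVec (fun _ _ => false) X ↔ IsAlternatingVec 9 n X := by
  simp [IsLawrenceVec, IsAlternatingVec, boolSign]

theorem eq_or_eq_neg_of_recurrence {n : ℕ} {X Y : Fin n → SignType} {x : Fin 10 → Fin n}
    {s : Fin 9 → SignType} (hX : ∀ e, X e ≠ 0 ↔ e ∈ Set.range x)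
    (hY : ∀ e, Y e ≠ 0 ↔ e ∈ Set.range x)
    (hXs : ∀ m : Fin 9, X (x m.succ) = -(s m * X (x m.castSucc)))
    (hYs : ∀ m : Fin 9, Y (x m.succ) = -(s m * Y (x m.castSucc))) : X = Y ∨ X = -Y := by
  have hc : ∀ u v : SignType, u ≠ 0 → v ≠ 0 → ∃ θ : SignType, (θ = 1 ∨ θ = -1) ∧ u = θ * v := by
    decide
  obtain ⟨θ, hθ, h0⟩ := hc (X (x 0)) (Y (x 0)) ((hX _).2 ⟨0, rfl⟩) ((hY _).2 ⟨0, rfl⟩)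
  have hall : ∀ m, X (x m) = θ * Y (x m) := by
    intro m
    induction m using Fin.induction with
    | zero => exact h0
    | succ m ih =>
      rw [hXs, hYs, ih, mul_neg, mul_left_comm]
  have hall' : ∀ e, X e = θ * Y e := by
    intro e
    by_cases he : e ∈ Set.range x
    · obtain ⟨m, rfl⟩ := he
      exact hall m
    · have h1 := mt (hX e).1 he
      have h2 := mt (hY e).1 he
      push Not at h1 h2
      rw [h1, h2, mul_zero]
  rcases hθ with rfl | rfl
  · left
    funext e
    rw [hall', one_mul]
  · right
    funext e
    rw [hall', Pi.neg_apply, neg_one_mul]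

theorem IsUniform.indep_of_card_le {E : Type*} [Fintype E] {M : OrientedMatroid E} {r : ℕ}
    (h : M.IsUniform r) {S : Finset E} (hS : #S ≤ r) : M.Indep S := by
  classical
  intro X hX
  by_contra hno
  push Not at hno
  have hsub : ({e | X e ≠ 0} : Finset E) ⊆ S := fun e he => hno e (by simpa using he)
  have h1 := card_le_card hsub
  rw [h.2 X hX] at h1
  omega

theorem IsUniform.card_le_of_indep {E : Type*} [Fintype E] {M : OrientedMatroid E} {r : ℕ}
    (h : M.IsUniform r) {S : Finset E} (hS : M.Indep S) : #S ≤ r :=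
  h.1.2 ⟨S, hS, rfl⟩

theorem IsUniform.isBase_iff {E : Type*} [Fintype E] {M : OrientedMatroid E} {r : ℕ}
    (h : M.IsUniform r) {B : Finset E} : M.IsBase B ↔ #B = r := by
  classical
  refine ⟨fun hB => ?_, fun hB => ⟨h.indep_of_card_le hB.le, fun S hS hBS => ?_⟩⟩
  · by_contra hne
    have hlt : #B < r := lt_of_le_of_ne (h.card_le_of_indep hB.1) hne
    obtain ⟨S, -, hS⟩ := h.1.1
    obtain ⟨e, -, he⟩ := Finset.exists_mem_notMem_of_card_lt_card (hS ▸ hlt : #B < #S)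
    have h1 := hB.2 (h.indep_of_card_le (S := insert e B)
      (by rw [card_insert_of_notMem he]; omega)) (Finset.subset_insert e B)
    exact he (h1 (mem_insert_self e B))
  · exact (Finset.eq_of_subset_of_card_le hBS (hB ▸ h.card_le_of_indep hS)).ge

/-- Every set of `r + 1` elements of a uniform oriented matroid of rank `r` supports a circuit. -/
theorem IsUniform.exists_circuit {E : Type*} [Fintype E] {M : OrientedMatroid E} {r : ℕ}
    (h : M.IsUniform r) {S : Finset E} (hS : #S = r + 1) :
    ∃ X ∈ M.circuits, ∀ e, X e ≠ 0 ↔ e ∈ S := by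
  classical
  have hdep : ¬ M.Indep S := fun hS' => by
    have := h.card_le_of_indep hS'
    omega
  rw [Indep] at hdep
  push Not at hdep
  obtain ⟨X, hX, hXS⟩ := hdep
  have hsub : ({e | X e ≠ 0} : Finset E) ⊆ S := fun e he => hXS e (by simpa using he)
  have heq := Finset.eq_of_subset_of_card_le hsub (by rw [hS, h.2 X hX])
  refine ⟨X, hX, fun e => ?_⟩
  rw [← heq]
  simp

/-- Leaving out neighboring members of a sequence gives tuples that differ in one position. -/
theorem succAbove_castSucc_eq_update {n : ℕ} (x : Fin 10 → Fin n) (m : Fin 9) :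
    x ∘ m.castSucc.succAbove = Function.update (x ∘ m.succ.succAbove) m (x m.succ) := by
  funext j
  rcases eq_or_ne j m with rfl | hj
  · simp
  · rw [Function.update_of_ne hj, Function.comp, Function.comp]
    congr 1
    rcases lt_or_gt_of_ne hj with hlt | hgt
    · rw [Fin.succAbove_of_castSucc_lt _ _ (by simpa using hlt),
        Fin.succAbove_of_castSucc_lt _ _ (by
          rw [Fin.lt_def] at hlt ⊢
          simp only [Fin.val_castSucc, Fin.val_succ]
          omega)]
    · rw [Fin.succAbove_of_le_castSucc _ _ (by
          rw [Fin.lt_def] at hgt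
          rw [Fin.le_def]
          simp only [Fin.val_castSucc]
          omega),
        Fin.succAbove_of_le_castSucc _ _ (by
          rw [Fin.lt_def] at hgt
          rw [Fin.le_def]
          simp only [Fin.val_castSucc, Fin.val_succ]
          omega)]

/-- The circuits of a Lawrence oriented matroid, from the pivoting rule for pairs of bases that
differ in two neighboring elements of a circuit. -/
theorem circuits_of_isBasisOrientation {n : ℕ} {M : OrientedMatroid (Fin n)} (hM : M.IsUniform 9)
    {a : ℕ → ℕ → Bool} {χ : (Fin 9 → Fin n) → SignType} (hχ : M.IsBasisOrientation χ)
    (hprod : ∀ j : Fin 9 → Fin n, StrictMono j → χ j = ∏ i : Fin 9, boolSign (a i (j i)))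
    (X : Fin n → SignType) : X ∈ M.circuits ↔ IsLawrenceVec a X := by
  have hcancel : ∀ p t w : SignType, p * w = t * w → w ≠ 0 → p = t := by decide
  have hsolve : ∀ u v p q : SignType, p = -(v * u) * q → p ≠ 0 → u = -(q * p * v) := by
    decide
  classical
  -- Signs of consecutive elements of a circuit.
  have hrec : ∀ (x : Fin 10 → Fin n), StrictMono x → ∀ Y ∈ M.circuits,
      (∀ e, Y e ≠ 0 ↔ e ∈ Set.range x) → ∀ m : Fin 9, Y (x m.succ) =
        -(boolSign (a m (x m.castSucc) ^^ a m (x m.succ)) * Y (x m.castSucc)) := by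
    intro x hx Y hY hYx m
    have hmono : ∀ p : Fin 10, StrictMono (x ∘ p.succAbove) := fun p =>
      hx.comp (Fin.strictMono_succAbove p)
    have h1 := hprod _ (hmono m.succ)
    have h2 := hprod _ (hmono m.castSucc)
    have hne : ∀ j : Fin 9 → Fin n, ∏ i : Fin 9, boolSign (a i (j i)) ≠ 0 := fun j =>
      Finset.prod_ne_zero_iff.2 fun i _ => boolSign_ne_zero _
    have hm : (x ∘ m.succ.succAbove) m = x m.castSucc := by simp
    have h3 := hχ.pivot (x ∘ m.succ.succAbove) m (x m.succ)
      (by rw [hm]; exact (hx (Fin.castSucc_lt_succ)).ne') (by rw [h1]; exact hne _)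
      (by rw [← succAbove_castSucc_eq_update, h2]; exact hne _) Y hY (fun g hg => by
        obtain ⟨p, rfl⟩ := (hYx g).1 hg
        rcases eq_or_ne p m.succ with rfl | hp
        · exact Or.inl rfl
        · obtain ⟨j, rfl⟩ := Fin.exists_succAbove_eq hp
          exact Or.inr ⟨j, rfl⟩)
    rw [← succAbove_castSucc_eq_update, h1, h2, hm] at h3
    rw [← Finset.mul_prod_erase _ _ (mem_univ m), ← Finset.mul_prod_erase _ _ (mem_univ m)] at h3
    have hrest : ∏ i ∈ univ.erase m, boolSign (a i ((x ∘ m.castSucc.succAbove) i)) =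
        ∏ i ∈ univ.erase m, boolSign (a i ((x ∘ m.succ.succAbove) i)) := by
      refine Finset.prod_congr rfl fun i hi => ?_
      rw [succAbove_castSucc_eq_update, Function.update_of_ne (Finset.ne_of_mem_erase hi)]
    have hrest0 : ∏ i ∈ univ.erase m, boolSign (a i ((x ∘ m.succ.succAbove) i)) ≠ 0 :=
      Finset.prod_ne_zero_iff.2 fun i _ => boolSign_ne_zero _
    rw [hrest, show (x ∘ m.castSucc.succAbove) m = x m.succ by simp, hm] at h3
    rw [boolSign_xor]
    rw [← mul_assoc] at h3
    exact hsolve _ _ _ _ (hcancel _ _ _ h3 hrest0) (boolSign_ne_zero _)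
  constructor
  · intro hX
    have hcard := hM.2 X hX
    let x := ({e | X e ≠ 0} : Finset (Fin n)).orderEmbOfFin hcard
    have hx : ∀ e, X e ≠ 0 ↔ e ∈ Set.range x := by
      intro e
      rw [Finset.range_orderEmbOfFin]
      simp
    exact ⟨x, x.strictMono, hx, hrec x x.strictMono X hX hx⟩
  · rintro ⟨x, hx, hXx, hXs⟩
    obtain ⟨Y, hY, hYx⟩ := hM.exists_circuit (S := univ.image x)
      (by rw [card_image_of_injective _ hx.injective, card_univ, Fintype.card_fin])
    have hYx' : ∀ e, Y e ≠ 0 ↔ e ∈ Set.range x := fun e => by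
      rw [hYx]
      simp
    rcases eq_or_eq_neg_of_recurrence hXx hYx' hXs (hrec x hx Y hY hYx') with rfl | rfl
    · exact hY
    · exact M.neg_mem _ hY

theorem IsLOM.exists_isLawrenceVec {n : ℕ} {M : OrientedMatroid (Fin n)} (hM : M.IsLOM 9) :
    ∃ a : ℕ → ℕ → Bool, ∀ X, X ∈ M.circuits ↔ IsLawrenceVec a X := by
  obtain ⟨hu, A, χ, hA, hχ, hprod⟩ := hM
  refine ⟨fun i c => if h : i < 9 ∧ c < n then decide (A ⟨i, h.1⟩ ⟨c, h.2⟩ = -1) else false,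
    circuits_of_isBasisOrientation hu hχ fun j hj => ?_⟩
  rw [hprod j hj]
  refine Finset.prod_congr rfl fun i _ => ?_
  rw [dif_pos ⟨i.2, (j i).2⟩]
  have h := hA i (j i)
  revert h
  simp only [Fin.eta]
  generalize A i (j i) = u
  revert u
  decide

end OrientedMatroid

/-! ### Counting neighborly reorientations -/

namespace OrientedMatroid

/-- A circuit has `10` elements, so having more than `k` elements of one sign means having at most
`9 - k` of the other. -/
theorem isNeighborly_iff_isGood {n k : ℕ} (hk : k ≤ 9) {M : OrientedMatroid (Fin n)}
    {a : ℕ → ℕ → Bool} (hM : ∀ X, X ∈ M.circuits ↔ IsLawrenceVec a X) (v : Fin n → Bool) :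
    (M.reorient {c | v c = true}).IsNeighborly k ↔
      IsGood n (9 - k) fun i c => a i c ^^ extendVec v c := by
  have hR : ∀ (X : Fin n → SignType) c, reorientVec {c | v c = true} X c =
      boolSign (v c) * X c := by
    intro X c
    simp only [reorientVec, Finset.mem_filter, Finset.mem_univ, true_and]
    cases v c <;> simp [boolSign]
  have hcirc : ∀ X, X ∈ (M.reorient {c | v c = true}).circuits ↔
      IsLawrenceVec a (reorientVec {c | v c = true} X) := fun X => hM _
  have key : ∀ (s t x y e f : Bool), (t = !((s ^^ (x ^^ e)) ^^ (y ^^ f))) ↔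
      boolSign f * (-boolSign t) = -(boolSign (x ^^ y) * (boolSign e * (-boolSign s))) := by
    decide
  have hpos : ∀ s : Bool, -boolSign s = 1 ↔ s = true := by decide
  have hneg : ∀ s : Bool, -boolSign s = -1 ↔ (!s) = true := by decide
  have hne : ∀ s : Bool, -boolSign s ≠ 0 := by decide
  have hsign : ∀ u : SignType, u ≠ 0 → u = -boolSign (decide (u = 1)) := by decide
  -- The signs of a vector along an enumeration of its support.
  have hcount : ∀ (x : Fin 10 → Fin n) (s : ℕ → Bool) (X : Fin n → SignType),
      Function.Injective x → (∀ e, X e ≠ 0 → e ∈ Set.range x) →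
      (∀ m : Fin 10, X (x m) = -boolSign (s m)) →
      #{e | X e = 1} = #{m ∈ range 10 | s m = true} ∧
        #{e | X e = -1} = #{m ∈ range 10 | (!s m) = true} := by
    intro x s X hx hXx hXs
    have hgen : ∀ (u : SignType) (P : Bool → Prop) [DecidablePred P], u ≠ 0 →
        (∀ b, -boolSign b = u ↔ P b) →
        #{e | X e = u} = #{m ∈ range 10 | P (s m)} := by
      intro u P _ hu hP
      have h1 : ({e | X e = u} : Finset (Fin n)) =
          ({m : Fin 10 | P (s m)} : Finset (Fin 10)).image x := by
        ext e
        simp only [Finset.mem_filter, Finset.mem_univ, true_and, Finset.mem_image]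
        constructor
        · intro he
          obtain ⟨m, rfl⟩ := hXx e (he ▸ hu)
          exact ⟨m, (hP _).1 (by rw [← hXs, he]), rfl⟩
        · rintro ⟨m, hm, rfl⟩
          rw [hXs]
          exact (hP _).2 hm
      rw [h1, card_image_of_injective _ hx]
      refine Finset.card_bij (fun m _ => m.val) ?_ ?_ ?_
      · intro m hm
        simpa using hm
      · intro m _ m' _ h
        exact Fin.ext h
      · intro m hm
        rw [Finset.mem_filter, Finset.mem_range] at hm
        exact ⟨⟨m, hm.1⟩, by simpa using hm.2, rfl⟩
    exact ⟨hgen 1 _ (by decide) hpos, hgen (-1) (fun b => (!b) = true) (by decide) hneg⟩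
  constructor
  · intro h x s hx hn hs
    have hlt : ∀ m : Fin 10, x m < n := fun m => by
      have := index_bounds hx hn m.2
      omega
    let y : Fin 10 → Fin n := fun m => ⟨x m, hlt m⟩
    have hy : StrictMono y := fun m m' hm => hx m m' hm m'.2
    let X : Fin n → SignType := Function.extend y (fun m => -boolSign (s m)) 0
    have hXy : ∀ m : Fin 10, X (y m) = -boolSign (s m) := fun m => hy.injective.extend_apply _ _ m
    have hXx : ∀ e, X e ≠ 0 ↔ e ∈ Set.range y := by
      intro e
      constructor
      · intro he
        by_contra hr
        exact he (Function.extend_apply' _ _ _ hr)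
      · rintro ⟨m, rfl⟩
        rw [hXy]
        exact hne _
    obtain ⟨h1, h2⟩ := hcount y s X hy.injective (fun e => (hXx e).1) hXy
    have h3 := h X ((hcirc X).2 ⟨y, hy, fun e => by rw [reorientVec_ne_zero, hXx], fun m => ?_⟩)
    · have h4 := card_filter_not s
      rw [h1, h2] at h3
      omega
    · have h5 : s (m + 1) = !((s m ^^ (a m (x m) ^^ extendVec v (x m))) ^^
          (a m (x (m + 1)) ^^ extendVec v (x (m + 1)))) := hs m m.2
      rw [show extendVec v (x m) = v (y m.castSucc) from extendVec_of_lt v (hlt m.castSucc),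
        show extendVec v (x (m + 1)) = v (y m.succ) from extendVec_of_lt v (hlt m.succ), key] at h5
      rw [hR, hR, hXy, hXy]
      exact h5
  · intro h X hX
    rw [hcirc] at hX
    obtain ⟨x, hx, hXx, hXs⟩ := hX
    have hXx' : ∀ e, X e ≠ 0 ↔ e ∈ Set.range x := fun e => by
      rw [← hXx, reorientVec_ne_zero]
    let x' : ℕ → ℕ := fun m => if h : m < 10 then x ⟨m, h⟩ else 0
    let s : ℕ → Bool := fun m => if h : m < 10 then decide (X (x ⟨m, h⟩) = 1) else false
    have hs : ∀ m : Fin 10, X (x m) = -boolSign (s m) := fun m => by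
      simp only [s, dif_pos m.2, Fin.eta]
      exact hsign _ ((hXx' _).2 ⟨m, rfl⟩)
    obtain ⟨h1, h2⟩ := hcount x s X hx.injective (fun e => (hXx' e).1) hs
    have h3 := h x' s ?_ ?_ ?_
    · have h4 := card_filter_not s
      rw [h1, h2]
      omega
    · intro m m' h3 h4
      simp only [x', dif_pos h4, dif_pos (h3.trans h4)]
      exact hx h3
    · simp only [x', dif_pos (show 9 < 10 by norm_num)]
      exact Fin.is_lt _
    · intro m hm
      have h5 := hXs ⟨m, hm⟩
      rw [hR, hR, hs, hs] at h5
      simp only [x', dif_pos (show m < 10 by omega), dif_pos (show m + 1 < 10 by omega)]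
      rw [extendVec_of_lt _ (Fin.is_lt _), extendVec_of_lt _ (Fin.is_lt _), key]
      exact h5

theorem numNeighborly_eq_goodCount {n k : ℕ} (hk : k ≤ 9) {M : OrientedMatroid (Fin n)}
    {a : ℕ → ℕ → Bool} (hM : ∀ X, X ∈ M.circuits ↔ IsLawrenceVec a X) :
    M.numNeighborly k = goodCount n (9 - k) a := by
  classical
  rw [numNeighborly, goodCount, ← Set.ncard_coe_finset]
  symm
  refine Set.ncard_congr (fun v _ => ({c | v c = true} : Finset (Fin n))) ?_ ?_ ?_
  · intro v hv
    rw [Finset.mem_coe, Finset.mem_filter] at hv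
    exact (isNeighborly_iff_isGood hk hM v).2 hv.2
  · intro v w _ _ h
    funext c
    have := congrArg (c ∈ ·) h
    simp only [Finset.mem_filter, Finset.mem_univ, true_and, eq_iff_iff] at this
    exact Bool.eq_iff_iff.2 this
  · intro R hR
    have h : ({c | decide (c ∈ R) = true} : Finset (Fin n)) = R := by
      ext c
      simp
    refine ⟨fun c => decide (c ∈ R), ?_, h⟩
    rw [Finset.mem_coe, Finset.mem_filter]
    refine ⟨Finset.mem_univ _, (isNeighborly_iff_isGood hk hM _).1 ?_⟩
    rw [h]
    exact hR

end OrientedMatroid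

/-! ### The chirotope of the alternating oriented matroid -/

namespace OrientedMatroid

/-- The sign of the Vandermonde determinant at a tuple. -/
noncomputable def vandermondeSign {r n : ℕ} (x : Fin r → Fin n) : SignType :=
  SignType.sign (Matrix.vandermonde fun i => ((x i : ℕ) : ℤ)).det

theorem vandermondeSign_swap {r n : ℕ} (x : Fin r → Fin n) {i j : Fin r} (h : i ≠ j) :
    vandermondeSign (x ∘ Equiv.swap i j) = -vandermondeSign x := by
  have h1 : (Matrix.vandermonde fun l => (((x ∘ Equiv.swap i j) l : ℕ) : ℤ)) =
      (Matrix.vandermonde fun l => ((x l : ℕ) : ℤ)).submatrix (Equiv.swap i j) id := rfl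
  rw [vandermondeSign, h1, Matrix.det_permute, Equiv.Perm.sign_swap h, vandermondeSign]
  simp [Left.sign_neg]

theorem vandermondeSign_ne_zero_iff {r n : ℕ} (x : Fin r → Fin n) :
    vandermondeSign x ≠ 0 ↔ Function.Injective x := by
  rw [vandermondeSign, sign_ne_zero, Matrix.det_vandermonde_ne_zero_iff]
  refine ⟨fun h i j hij => h (by simp only [hij]), fun h i j hij => h (Fin.ext ?_)⟩
  have hij' : ((x i : ℕ) : ℤ) = ((x j : ℕ) : ℤ) := hij
  exact_mod_cast hij'

/-- The sign of the difference of two elements. -/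
noncomputable def diffSign {n : ℕ} (e g : Fin n) : SignType :=
  SignType.sign (((g : ℕ) : ℤ) - ((e : ℕ) : ℤ))

theorem diffSign_of_lt {n : ℕ} {e g : Fin n} (h : e < g) : diffSign e g = 1 := by
  rw [Fin.lt_def] at h
  exact sign_pos (by omega)

theorem diffSign_of_gt {n : ℕ} {e g : Fin n} (h : g < e) : diffSign e g = -1 := by
  rw [Fin.lt_def] at h
  exact sign_neg (by omega)

theorem vandermondeSign_eq_prod {r n : ℕ} (x : Fin r → Fin n) :
    vandermondeSign x = ∏ i, ∏ j ∈ Ioi i, diffSign (x i) (x j) := by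
  rw [vandermondeSign, Matrix.det_vandermonde, ← signHom_apply, map_prod]
  refine Finset.prod_congr rfl fun i _ => ?_
  rw [map_prod]
  rfl

theorem vandermondeSign_update_zero {r n : ℕ} (x : Fin (r + 1) → Fin n) (f : Fin n) :
    vandermondeSign (Function.update x 0 f) * ∏ j ∈ univ.erase 0, diffSign (x 0) (x j) =
      vandermondeSign x * ∏ j ∈ univ.erase 0, diffSign f (x j) := by
  have hIoi : (Ioi 0 : Finset (Fin (r + 1))) = univ.erase 0 := by
    ext j
    simp
  rw [vandermondeSign_eq_prod, vandermondeSign_eq_prod, Fin.prod_univ_succ, Fin.prod_univ_succ,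
    hIoi, Function.update_self,
    Finset.prod_congr rfl fun j (hj : j ∈ univ.erase 0) => by
      rw [Function.update_of_ne (Finset.ne_of_mem_erase hj)]]
  have hrest : ∀ i : Fin r, ∏ j ∈ Ioi i.succ, diffSign (Function.update x 0 f i.succ)
      (Function.update x 0 f j) = ∏ j ∈ Ioi i.succ, diffSign (x i.succ) (x j) := by
    intro i
    rw [Function.update_of_ne (Fin.succ_ne_zero i)]
    refine Finset.prod_congr rfl fun j hj => ?_
    rw [Function.update_of_ne ((Fin.zero_le _).trans_lt (Finset.mem_Ioi.1 hj)).ne']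
  simp only [hrest]
  ac_rfl

/-- The effect of a change in one position. -/
theorem vandermondeSign_update {r n : ℕ} (x : Fin r → Fin n) (i : Fin r) (f : Fin n) :
    vandermondeSign (Function.update x i f) * ∏ j ∈ univ.erase i, diffSign (x i) (x j) =
      vandermondeSign x * ∏ j ∈ univ.erase i, diffSign f (x j) := by
  obtain ⟨r, rfl⟩ : ∃ r', r = r' + 1 := ⟨r - 1, by have := i.2; omega⟩
  rcases eq_or_ne i 0 with rfl | hi
  · exact vandermondeSign_update_zero x f
  · have h := vandermondeSign_update_zero (x ∘ Equiv.swap i 0) f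
    have h1 : Function.update (x ∘ Equiv.swap i 0) 0 f =
        Function.update x i f ∘ Equiv.swap i 0 := by
      rw [Function.update_comp_equiv, Equiv.symm_swap, Equiv.swap_apply_left]
    have h2 : ∀ e, ∏ j ∈ univ.erase 0, diffSign e ((x ∘ Equiv.swap i 0) j) =
        ∏ j ∈ univ.erase i, diffSign e (x j) := by
      intro e
      refine Finset.prod_bij (fun j _ => Equiv.swap i 0 j) ?_ ?_ ?_ ?_
      · intro j hj
        rw [Finset.mem_erase] at hj ⊢
        refine ⟨fun h => hj.1 ?_, Finset.mem_univ _⟩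
        rw [← (Equiv.swap i 0).injective.eq_iff, h, Equiv.swap_apply_right]
      · intro j _ j' _ h
        exact (Equiv.swap i 0).injective h
      · intro j hj
        rw [Finset.mem_erase] at hj
        refine ⟨Equiv.swap i 0 j, ?_, Equiv.swap_apply_self _ _ _⟩
        rw [Finset.mem_erase]
        refine ⟨fun h => hj.1 ?_, Finset.mem_univ _⟩
        rw [← (Equiv.swap i 0).injective.eq_iff, h, Equiv.swap_apply_left]
      · intro j _
        rfl
    rw [h1, h2, h2, vandermondeSign_swap _ hi, vandermondeSign_swap _ hi] at h
    simp only [Function.comp, Equiv.swap_apply_right, neg_mul] at h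
    exact neg_injective h

/-- The signs of an alternating vector, as products of differences over its support. -/
theorem IsAlternatingVec.eq_mul_prod {r n : ℕ} {X : Fin n → SignType}
    (h : IsAlternatingVec r n X) {T : Finset (Fin n)} (hT : ∀ e, X e ≠ 0 ↔ e ∈ T) :
    ∃ θ : SignType, θ ≠ 0 ∧ ∀ e ∈ T, X e = θ * ∏ g ∈ T.erase e, diffSign e g := by
  obtain ⟨s, hs, hX, halt⟩ := h
  have hTs : T = univ.map ⟨s, hs.injective⟩ := by
    ext e
    rw [← hT, hX]
    simp
  have hprod : ∀ m, ∏ g ∈ T.erase (s m), diffSign (s m) g = (-1) ^ (m : ℕ) := by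
    intro m
    have h1 : T.erase (s m) = (univ.erase m).map ⟨s, hs.injective⟩ := by
      rw [hTs, Finset.map_erase]
      rfl
    rw [h1, Finset.prod_map]
    simp only [Function.Embedding.coeFn_mk]
    have h2 : ∀ l ∈ univ.erase m, diffSign (s m) (s l) = if l < m then -1 else 1 := by
      intro l hl
      rcases lt_or_gt_of_ne (Finset.ne_of_mem_erase hl) with hlt | hgt
      · rw [if_pos hlt, diffSign_of_gt (hs hlt)]
      · rw [if_neg hgt.not_gt, diffSign_of_lt (hs hgt)]
    rw [Finset.prod_congr rfl h2, Finset.prod_ite, Finset.prod_const_one, mul_one,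
      Finset.prod_const]
    congr 1
    have h3 : (univ.erase m).filter (· < m) = Iio m := by
      ext l
      simp only [Finset.mem_filter, Finset.mem_erase, Finset.mem_univ, and_true, Finset.mem_Iio]
      exact ⟨fun h => h.2, fun h => ⟨h.ne, h⟩⟩
    rw [h3, Fin.card_Iio]
  refine ⟨X (s 0), (hX _).2 ⟨0, rfl⟩, fun e he => ?_⟩
  obtain ⟨m, rfl⟩ := (hX e).1 ((hT e).2 he)
  rw [hprod]
  clear he
  induction m using Fin.induction with
  | zero => simp
  | succ m ih =>
    rw [halt, ih, Fin.val_succ, Fin.val_castSucc, pow_succ]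
    simp

theorem isUniform_alternating {r n : ℕ} (hrn : r ≤ n) : (alternating r n).IsUniform r := by
  have hcard : ∀ X ∈ (alternating r n).circuits, #{e | X e ≠ 0} = r + 1 := by
    rintro X ⟨s, hs, hX, -⟩
    have : ({e | X e ≠ 0} : Finset (Fin n)) = univ.image s := by
      ext e
      simp [hX]
    rw [this, card_image_of_injective _ hs.injective, card_univ, Fintype.card_fin]
  refine ⟨⟨?_, ?_⟩, hcard⟩
  · obtain ⟨S, hS⟩ := Finset.exists_subset_card_eq (s := (univ : Finset (Fin n))) (n := r)
      (by simpa using hrn)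
    refine ⟨S, fun X hX => ?_, hS.2⟩
    by_contra hno
    push Not at hno
    have hsub : ({e | X e ≠ 0} : Finset (Fin n)) ⊆ S := fun e he => hno e (by simpa using he)
    have := card_le_card hsub
    rw [hcard X hX, hS.2] at this
    omega
  · rintro m ⟨S, hS, rfl⟩
    by_contra hlt
    push Not at hlt
    obtain ⟨T, hTS, hT⟩ := Finset.exists_subset_card_eq (s := S) (n := r + 1) hlt
    let x := T.orderEmbOfFin hT
    obtain ⟨Z, hZ, hZx⟩ := exists_isAlternatingVec (r := r)
      (fun i => x ⟨min i r, by omega⟩) 1 (by decide) (fun i hi => x.strictMono (by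
        rw [Fin.lt_def]
        simp only
        omega))
    obtain ⟨e, he, heS⟩ := hS Z hZ
    obtain ⟨i, -, rfl, -⟩ := hZx e he
    exact heS (hTS (Finset.orderEmbOfFin_mem T hT _))

theorem isBasisOrientation_alternating {r n : ℕ} (hrn : r ≤ n) :
    (alternating r n).IsBasisOrientation (vandermondeSign (r := r)) where
  alternating x i j hij := vandermondeSign_swap x hij
  ne_zero_iff x := by
    rw [vandermondeSign_ne_zero_iff, (isUniform_alternating hrn).isBase_iff]
    refine ⟨fun h => ⟨h, ?_⟩, fun h => h.1⟩
    rw [card_image_of_injective _ h, card_univ, Fintype.card_fin]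
  pivot x i f hf hx hx' X hX hXs := by
    rw [vandermondeSign_ne_zero_iff] at hx hx'
    have hfx : f ∉ Set.range x := by
      rintro ⟨j, rfl⟩
      have hji : j ≠ i := fun h => hf (by rw [h])
      have := hx' (a₁ := j) (a₂ := i) (by
        rw [Function.update_of_ne hji, Function.update_self])
      exact hji this
    have hT : ∀ e, X e ≠ 0 ↔ e ∈ insert f (univ.image x) := by
      have hsub : ({e | X e ≠ 0} : Finset (Fin n)) ⊆ insert f (univ.image x) := fun e he => by
        have := hXs e (by simpa using he)
        simpa using this
      have := Finset.eq_of_subset_of_card_le hsub (by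
        rw [(isUniform_alternating hrn).2 X hX, card_insert_of_notMem (by simpa using hfx),
          card_image_of_injective _ hx, card_univ, Fintype.card_fin])
      intro e
      rw [← this]
      simp
    obtain ⟨θ, hθ, hXe⟩ := IsAlternatingVec.eq_mul_prod hX hT
    have hxi : ∏ g ∈ (insert f (univ.image x)).erase (x i), diffSign (x i) g =
        diffSign (x i) f * ∏ j ∈ univ.erase i, diffSign (x i) (x j) := by
      rw [Finset.erase_insert_of_ne hf, Finset.prod_insert, ← Finset.image_erase hx,
        Finset.prod_image hx.injOn]
      simp only [Finset.mem_erase, Finset.mem_image, Finset.mem_univ, true_and, not_and]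
      exact fun _ h => hfx h
    have hf' : ∏ g ∈ (insert f (univ.image x)).erase f, diffSign f g =
        diffSign f (x i) * ∏ j ∈ univ.erase i, diffSign f (x j) := by
      rw [Finset.erase_insert (by simpa using hfx), Finset.prod_image hx.injOn,
        Finset.mul_prod_erase _ (fun j => diffSign f (x j)) (mem_univ i)]
    have h1 := vandermondeSign_update x i f
    rw [hXe (x i) (by simp), hXe f (by simp), hxi, hf']
    have hne : ∀ e g : Fin n, e ≠ g → diffSign e g ≠ 0 := fun e g h => by
      rcases lt_or_gt_of_ne h with h | h
      · rw [diffSign_of_lt h]; decide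
      · rw [diffSign_of_gt h]; decide
    have h2 : diffSign (x i) f = -diffSign f (x i) := by
      rcases lt_or_gt_of_ne hf with h | h
      · rw [diffSign_of_lt h, diffSign_of_gt h]
      · rw [diffSign_of_lt h, diffSign_of_gt h, neg_neg]
    have h3 := hne f (x i) hf
    have h4 : ∏ j ∈ univ.erase i, diffSign (x i) (x j) ≠ 0 :=
      Finset.prod_ne_zero_iff.2 fun j hj => hne _ _ fun h =>
        Finset.ne_of_mem_erase hj (hx h).symm
    rw [h2]
    revert h1 h3 h4 hθ
    generalize vandermondeSign (Function.update x i f) = u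
    generalize vandermondeSign x = v
    generalize diffSign f (x i) = p
    generalize ∏ j ∈ univ.erase i, diffSign (x i) (x j) = q
    generalize ∏ j ∈ univ.erase i, diffSign f (x j) = w
    have hsq : ∀ θ : SignType, θ ≠ 0 → θ * θ = 1 := by decide
    intro hθ h1 h3 h4
    calc u = u * q * q := by rw [mul_assoc, hsq q h4, mul_one]
      _ = v * w * q := by rw [h1]
      _ = (θ * θ) * (p * p) * (v * w * q) := by rw [hsq θ hθ, hsq p h3, one_mul, one_mul]
      _ = -(θ * (-p * q) * (θ * (p * w))) * v := by
        simp only [neg_mul, mul_neg, neg_neg]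
        ac_rfl

end OrientedMatroid

/-! ### Lawrence oriented matroids with constant squares in each column -/

namespace OrientedMatroid

/-- The oriented matroid obtained by renaming the elements. -/
def relabel {E : Type*} (M : OrientedMatroid E) (π : Equiv.Perm E) : OrientedMatroid E where
  circuits := {X | X ∘ π.symm ∈ M.circuits}
  zero_notMem h := M.zero_notMem h
  neg_mem X hX := M.neg_mem _ hX
  incomparable X hX Y hY h := by
    have hinj : Function.Injective fun X : E → SignType => X ∘ π.symm :=
      π.symm.surjective.injective_comp_right
    rcases M.incomparable _ hX _ hY fun e he => h _ he with h1 | h1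
    · exact Or.inl (hinj h1)
    · exact Or.inr (hinj h1)
  elimination X hX Y hY hXY e hXe hYe := by
    have hinj : Function.Injective fun X : E → SignType => X ∘ π.symm :=
      π.symm.surjective.injective_comp_right
    obtain ⟨Z, hZ, hZe, hZf⟩ := M.elimination _ hX _ hY (fun h => hXY (hinj h)) (π e)
      (by simpa using hXe) (by simpa using hYe)
    refine ⟨Z ∘ π, ?_, hZe, fun f => ?_⟩
    · rw [Set.mem_ofPred_eq, Function.comp_assoc, Equiv.self_comp_symm, Function.comp_id]
      exact hZ
    · have := hZf (π f)
      simpa using this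

theorem mem_circuits_relabel {E : Type*} {M : OrientedMatroid E} {π : Equiv.Perm E}
    {X : E → SignType} : X ∈ (M.relabel π).circuits ↔ X ∘ π.symm ∈ M.circuits := Iff.rfl

theorem indep_relabel_iff {E : Type*} {M : OrientedMatroid E} {π : Equiv.Perm E} {S : Finset E} :
    (M.relabel π).Indep S ↔ M.Indep (S.map π.toEmbedding) := by
  constructor
  · intro h X hX
    obtain ⟨e, he, heS⟩ := h (X ∘ π) (by
      rwa [mem_circuits_relabel, Function.comp_assoc, Equiv.self_comp_symm, Function.comp_id])
    exact ⟨π e, he, by simpa using heS⟩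
  · intro h X hX
    obtain ⟨e, he, heS⟩ := h _ hX
    refine ⟨π.symm e, he, fun h' => heS ?_⟩
    rw [Finset.mem_map_equiv]
    exact h'

theorem IsUniform.relabel {E : Type*} [Fintype E] {M : OrientedMatroid E} {r : ℕ}
    (h : M.IsUniform r) (π : Equiv.Perm E) : (M.relabel π).IsUniform r := by
  refine ⟨⟨?_, ?_⟩, fun X hX => ?_⟩
  · obtain ⟨S, hS, hr⟩ := h.1.1
    refine ⟨S.map π.symm.toEmbedding, ?_, by rw [card_map, hr]⟩
    rw [indep_relabel_iff, Finset.map_map]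
    convert hS
    ext e
    simp
  · rintro m ⟨S, hS, rfl⟩
    rw [indep_relabel_iff] at hS
    rw [← card_map π.toEmbedding]
    exact h.card_le_of_indep hS
  · rw [← h.2 _ hX]
    refine Finset.card_equiv π fun e => ?_
    simp

theorem IsBasisOrientation.relabel {E : Type*} [Fintype E] [DecidableEq E] {M : OrientedMatroid E}
    {r : ℕ} (h : M.IsUniform r) {χ : (Fin r → E) → SignType} (hχ : M.IsBasisOrientation χ)
    (π : Equiv.Perm E) : (M.relabel π).IsBasisOrientation fun x => χ (π ∘ x) where
  alternating x i j hij := hχ.alternating (π ∘ x) i j hij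
  ne_zero_iff x := by
    rw [hχ.ne_zero_iff, h.isBase_iff, (h.relabel π).isBase_iff, π.injective.of_comp_iff,
      ← Finset.image_image, card_image_of_injective _ π.injective]
  pivot x i f hf hx hx' X hX hXs := by
    rw [Function.comp_update] at hx' ⊢
    have := hχ.pivot (π ∘ x) i (π f) (fun h => hf (π.injective h)) hx hx' _ hX (fun g hg => by
      rcases hXs _ hg with h1 | ⟨j, hj⟩
      · exact Or.inl (by rw [← h1, Equiv.apply_symm_apply])
      · exact Or.inr ⟨j, by rw [Function.comp, hj, Equiv.apply_symm_apply]⟩)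
    simpa using this

/-- The position of `c` if the elements of `τ` are moved behind the others and reversed. -/
def foldedPosition (τ : ℕ → Bool) (n c : ℕ) : ℕ :=
  if τ c then n - 1 - Nat.count (fun j => τ j = true) c else Nat.count (fun j => ¬ τ j = true) c

theorem count_add_count_not (τ : ℕ → Bool) (c : ℕ) :
    Nat.count (fun j => τ j = true) c + Nat.count (fun j => ¬ τ j = true) c = c := by
  induction c with
  | zero => rfl
  | succ c ih =>
    rw [Nat.count_succ, Nat.count_succ]
    split_ifs <;> omega

theorem foldedPosition_lt {τ : ℕ → Bool} {n c : ℕ} (h : c < n) : foldedPosition τ n c < n := by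
  have := count_add_count_not τ c
  rw [foldedPosition]
  split_ifs <;> omega

theorem foldedPosition_lt_of_lt {τ : ℕ → Bool} {n c c' : ℕ} (h : c < c') (h' : c' < n) :
    if τ c then foldedPosition τ n c' < foldedPosition τ n c
    else foldedPosition τ n c < foldedPosition τ n c' := by
  have h1 := count_add_count_not τ c
  have h2 := count_add_count_not τ c'
  have h3 := Nat.count_succ (fun j => τ j = true) c
  have h4 := Nat.count_succ (fun j => ¬ τ j = true) c
  have h5 := Nat.count_monotone (fun j => τ j = true) (show c + 1 ≤ c' from h)
  have h6 := Nat.count_monotone (fun j => ¬ τ j = true) (show c + 1 ≤ c' from h)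
  simp only [foldedPosition]
  split_ifs at h3 h4 ⊢ <;> omega

theorem foldedPosition_injective (τ : ℕ → Bool) (n : ℕ) :
    Function.Injective fun c : Fin n =>
      (⟨foldedPosition τ n c, foldedPosition_lt c.2⟩ : Fin n) := by
  have key : ∀ c c' : Fin n, c < c' → foldedPosition τ n c ≠ foldedPosition τ n c' := by
    intro c c' h
    have := foldedPosition_lt_of_lt (τ := τ) (Fin.lt_def.1 h) c'.2
    split_ifs at this <;> omega
  intro c c' h
  rw [Fin.mk.injEq] at h
  rcases lt_trichotomy c c' with h1 | h1 | h1
  · exact absurd h (key _ _ h1)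
  · exact h1
  · exact absurd h.symm (key _ _ h1)

/-- The permutation that moves the elements of `τ` behind the others and reverses their order. -/
noncomputable def foldPerm (τ : ℕ → Bool) (n : ℕ) : Equiv.Perm (Fin n) :=
  Equiv.ofBijective _ (Finite.injective_iff_bijective.1 (foldedPosition_injective τ n))

/-- An element of `τ` comes after all later elements, any other element before them. -/
theorem diffSign_foldPerm {τ : ℕ → Bool} {n : ℕ} {c c' : Fin n} (h : c < c') :
    diffSign (foldPerm τ n c) (foldPerm τ n c') = boolSign (τ c) := by
  have h1 := foldedPosition_lt_of_lt (τ := τ) (Fin.lt_def.1 h) c'.2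
  cases hc : τ c
  · rw [hc, if_neg (by decide)] at h1
    exact diffSign_of_lt (Fin.lt_def.2 h1)
  · rw [hc, if_pos rfl] at h1
    exact diffSign_of_gt (Fin.lt_def.2 h1)

/-- The sign matrix whose columns in `τ` alternate, and whose other columns are constant. -/
def stripes (τ : ℕ → Bool) : ℕ → ℕ → Bool := altern τ fun _ _ => false

theorem square_stripes (τ : ℕ → Bool) (i c : ℕ) : square (stripes τ) i c = (τ c ^^ τ (c + 1)) := by
  rw [stripes, square_altern]
  simp [square]

/-- The Lawrence oriented matroid with sign matrix `stripes τ`, realized by an alternating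
oriented matroid with the elements renamed. -/
noncomputable def folded (τ : ℕ → Bool) (n : ℕ) : OrientedMatroid (Fin n) :=
  (alternating 9 n).relabel (foldPerm τ n)

theorem vandermondeSign_foldPerm {n : ℕ} (τ : ℕ → Bool) (j : Fin 9 → Fin n) (hj : StrictMono j) :
    vandermondeSign (foldPerm τ n ∘ j) = ∏ i : Fin 9, boolSign (stripes τ i (j i)) := by
  have hpow : ∀ (i : Fin 9) (b : Bool),
      boolSign b ^ (9 - 1 - (i : ℕ)) = boolSign (false ^^ (Nat.testBit i 0 && b)) := by decide
  rw [vandermondeSign_eq_prod]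
  refine Finset.prod_congr rfl fun i _ => ?_
  have h : ∀ l ∈ Ioi i, diffSign ((foldPerm τ n ∘ j) i) ((foldPerm τ n ∘ j) l) =
      boolSign (τ (j i)) := fun l hl => diffSign_foldPerm (hj (Finset.mem_Ioi.1 hl))
  rw [Finset.prod_congr rfl h, Finset.prod_const, Fin.card_Ioi, hpow]
  rfl

theorem isBasisOrientation_folded {n : ℕ} (hn : 9 ≤ n) (τ : ℕ → Bool) :
    (folded τ n).IsBasisOrientation fun x : Fin 9 → Fin n => vandermondeSign (foldPerm τ n ∘ x) :=
  (isBasisOrientation_alternating hn).relabel (isUniform_alternating hn) _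

theorem isUniform_folded {n : ℕ} (hn : 9 ≤ n) (τ : ℕ → Bool) : (folded τ n).IsUniform 9 :=
  (isUniform_alternating hn).relabel _

theorem isLOM_folded {n : ℕ} (hn : 9 ≤ n) (τ : ℕ → Bool) : (folded τ n).IsLOM 9 :=
  ⟨isUniform_folded hn τ, fun i c => boolSign (stripes τ i c), _, fun _ _ => boolSign_ne_zero _,
    isBasisOrientation_folded hn τ, vandermondeSign_foldPerm τ⟩

theorem mem_circuits_folded {n : ℕ} (hn : 9 ≤ n) (τ : ℕ → Bool) (X : Fin n → SignType) :
    X ∈ (folded τ n).circuits ↔ IsLawrenceVec (stripes τ) X :=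
  circuits_of_isBasisOrientation (isUniform_folded hn τ) (isBasisOrientation_folded hn τ)
    (vandermondeSign_foldPerm τ) X

/-! ### Reorientation classes -/

theorem mem_circuits_reorient {E : Type*} [DecidableEq E] {M : OrientedMatroid E} {R : Finset E}
    {X : E → SignType} : X ∈ (M.reorient R).circuits ↔ reorientVec R X ∈ M.circuits := Iff.rfl

theorem mem_reorientationClass_self {E : Type*} [DecidableEq E] (M : OrientedMatroid E) :
    M ∈ M.reorientationClass := by
  refine ⟨∅, ?_⟩
  ext X
  have : reorientVec ∅ X = X := by
    funext e
    simp [reorientVec]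
  rw [mem_circuits_reorient, this]

theorem reorient_reorient {E : Type*} [DecidableEq E] (M : OrientedMatroid E) (R R' : Finset E) :
    (M.reorient R).reorient R' = M.reorient (symmDiff R R') := by
  ext X
  simp only [mem_circuits_reorient]
  have : reorientVec R (reorientVec R' X) = reorientVec (symmDiff R R') X := by
    funext e
    simp only [reorientVec, Finset.mem_symmDiff]
    by_cases h : e ∈ R <;> by_cases h' : e ∈ R' <;> simp [h, h']
  rw [this]

theorem reorient_self {E : Type*} [DecidableEq E] (M : OrientedMatroid E) (R : Finset E) :
    (M.reorient R).reorient R = M := by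
  ext X
  rw [mem_circuits_reorient, mem_circuits_reorient, reorientVec_reorientVec]

theorem reorientationClass_reorient {E : Type*} [DecidableEq E] (M : OrientedMatroid E)
    (R : Finset E) : (M.reorient R).reorientationClass = M.reorientationClass := by
  ext M'
  constructor
  · rintro ⟨R', rfl⟩
    exact ⟨_, reorient_reorient M R R'⟩
  · rintro ⟨R', rfl⟩
    refine ⟨symmDiff R R', ?_⟩
    rw [← reorient_reorient, reorient_self]

/-- Scaling rows does not change the circuits, and scaling columns reorients. -/
theorem isLawrenceVec_scale {n : ℕ} {a : ℕ → ℕ → Bool} (ρ σ : ℕ → Bool) (X : Fin n → SignType) :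
    IsLawrenceVec (fun i c => (a i c ^^ ρ i) ^^ σ c) X ↔
      IsLawrenceVec a (reorientVec {c | σ c = true} X) := by
  have hR : ∀ c : Fin n, reorientVec {c : Fin n | σ c = true} X c = boolSign (σ c) * X c := by
    intro c
    simp only [reorientVec, Finset.mem_filter, Finset.mem_univ, true_and]
    cases σ c <;> simp [boolSign]
  have key : ∀ (u v r s t : Bool) (x y : SignType),
      (x = -(boolSign (((u ^^ r) ^^ s) ^^ ((v ^^ r) ^^ t)) * y)) ↔
      boolSign t * x = -(boolSign (u ^^ v) * (boolSign s * y)) := by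
    intro u v r s t x y
    have h : (((u ^^ r) ^^ s) ^^ ((v ^^ r) ^^ t)) = ((u ^^ v) ^^ (s ^^ t)) := by
      revert u v r s t
      decide
    rw [h]
    simp only [boolSign_xor]
    have hc : ∀ (s t : Bool) (x y p : SignType), x = -(p * (boolSign s * boolSign t) * y) ↔
        boolSign t * x = -(p * (boolSign s * y)) := by decide
    exact hc _ _ _ _ _
  simp only [IsLawrenceVec, reorientVec_ne_zero]
  simp only [hR, key]

/-- Only the entries with `i ≤ c ≤ i + q + 1` in row `i` matter for the circuits. -/
theorem IsLawrenceVec.congr {q : ℕ} {a b : ℕ → ℕ → Bool} {X : Fin (10 + q) → SignType}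
    (h : IsLawrenceVec a X) (hab : ∀ i c, i ≤ 8 → i ≤ c → c ≤ i + q + 1 → a i c = b i c) :
    IsLawrenceVec b X := by
  obtain ⟨x, hx, hX, hs⟩ := h
  refine ⟨x, hx, hX, fun m => ?_⟩
  have hb : ∀ m : Fin 10, (m : ℕ) ≤ x m ∧ (x m : ℕ) + 10 ≤ 10 + q + m := by
    intro m
    have := index_bounds (n := 10 + q) (x := fun m => if h : m < 10 then x ⟨m, h⟩ else 0)
      (fun m m' h1 h2 => by
        simp only [dif_pos h2, dif_pos (h1.trans h2)]
        exact hx h1) (by simp) m.2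
    simpa using this
  have h1 := hb m.castSucc
  have h2 := hb m.succ
  simp only [Fin.val_castSucc, Fin.val_succ] at h1 h2
  rw [hs m, hab _ _ (by omega) (by omega) (by omega), hab _ _ (by omega) (by omega) (by omega)]

/-- The circuits determine the squares. -/
theorem square_eq_of_isLawrenceVec_iff {q : ℕ} {a b : ℕ → ℕ → Bool}
    (h : ∀ X : Fin (10 + q) → SignType, IsLawrenceVec a X → IsLawrenceVec b X) {i c : ℕ}
    (hi : i ≤ 7) (h1 : i + 1 ≤ c) (h2 : c ≤ i + q) : square a i c = square b i c := by
  have key : ∀ i c, i ≤ 8 → i ≤ c → c ≤ i + q →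
      (a i c ^^ a i (c + 1)) = (b i c ^^ b i (c + 1)) := by
    intro i c hi hic hc
    -- A circuit in which `c` and `c + 1` are the elements in positions `i` and `i + 1`.
    let x : Fin 10 → Fin (10 + q) := fun m =>
      ⟨if m.val < i then m else m + (c - i), by
        have := m.2
        split_ifs <;> omega⟩
    have hx : StrictMono x := by
      intro m m' hm
      have hm' : m.val < m'.val := hm
      simp only [x, Fin.mk_lt_mk]
      split_ifs <;> omega
    let s : Fin 10 → SignType := fun m => Fin.induction (motive := fun _ => SignType) 1
      (fun m y => -(boolSign (a m (x m.castSucc) ^^ a m (x m.succ)) * y)) m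
    have hs : ∀ m : Fin 9, s m.succ =
        -(boolSign (a m (x m.castSucc) ^^ a m (x m.succ)) * s m.castSucc) := fun m =>
      Fin.induction_succ ..
    have hs0 : ∀ m, s m ≠ 0 := by
      intro m
      induction m using Fin.induction with
      | zero => exact one_ne_zero
      | succ m ih =>
        rw [hs]
        have hc : ∀ u v : SignType, u ≠ 0 → v ≠ 0 → -(u * v) ≠ 0 := by decide
        exact hc _ _ (boolSign_ne_zero _) ih
    let X : Fin (10 + q) → SignType := Function.extend x s 0
    have hX : ∀ m, X (x m) = s m := fun m => hx.injective.extend_apply s _ m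
    have hsupp : ∀ e, X e ≠ 0 ↔ e ∈ Set.range x := by
      intro e
      constructor
      · intro he
        by_contra hne
        exact he (Function.extend_apply' s _ e fun ⟨m, hm⟩ => hne ⟨m, hm⟩)
      · rintro ⟨m, rfl⟩
        rw [hX]
        exact hs0 m
    obtain ⟨x', hx', hsupp', hs'⟩ := h X ⟨x, hx, hsupp, fun m => by rw [hX, hX, hs]⟩
    have hxx : x' = x := by
      rw [← StrictMono.range_inj hx' hx]
      ext e
      rw [← hsupp, hsupp']
    subst hxx
    have h3 := hs' ⟨i, by omega⟩
    rw [hX, hX, hs] at h3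
    have hc : ∀ (u v : Bool) (y : SignType), y ≠ 0 → -(boolSign u * y) = -(boolSign v * y) →
        u = v := by decide
    have h4 := hc _ _ _ (hs0 _) h3
    have hxi : ((x (Fin.castSucc ⟨i, by omega⟩) : Fin (10 + q)) : ℕ) = c := by
      simp only [x, Fin.val_castSucc]
      rw [if_neg (lt_irrefl i)]
      omega
    have hxi' : ((x (Fin.succ ⟨i, by omega⟩) : Fin (10 + q)) : ℕ) = c + 1 := by
      simp only [x, Fin.val_succ]
      rw [if_neg (by omega)]
      omega
    rw [hxi, hxi'] at h4
    exact h4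
  have e1 := key i c (by omega) (by omega) h2
  have e2 := key (i + 1) c (by omega) h1 (by omega)
  simp only [square]
  revert e1 e2
  generalize a i c = x1; generalize a (i + 1) c = x2; generalize a i (c + 1) = x3
  generalize a (i + 1) (c + 1) = x4; generalize b i c = y1; generalize b (i + 1) c = y2
  generalize b i (c + 1) = y3; generalize b (i + 1) (c + 1) = y4
  revert x1 x2 x3 x4 y1 y2 y3 y4
  decide

end OrientedMatroid

/-! ### Counting the extremal classes -/

namespace OrientedMatroid

/-- The set of columns described by `v`, which starts at column `2`: columns `0` and `1` are
not in the set. -/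
def columnSet {m : ℕ} (v : Fin m → Bool) (c : ℕ) : Bool :=
  if 2 ≤ c then extendVec v (c - 2) else false

theorem columnSet_add_two {m : ℕ} (v : Fin m → Bool) (j : Fin m) :
    columnSet v (j + 2) = v j := by
  rw [columnSet, if_pos (by omega), Nat.add_sub_cancel, extendVec_of_lt v j.2]

theorem columnSet_false {m : ℕ} : columnSet (fun _ : Fin m => false) = fun _ => false := by
  funext c
  simp [columnSet, extendVec]

theorem stripes_false : stripes (fun _ => false) = fun _ _ => false := by
  funext i c
  simp [stripes, altern]

theorem folded_false {n : ℕ} (hn : 9 ≤ n) : folded (fun _ => false) n = alternating 9 n := by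
  ext X
  rw [mem_circuits_folded hn, stripes_false, isLawrenceVec_false]
  rfl

theorem mem_circuits_alternating {n : ℕ} (X : Fin n → SignType) :
    X ∈ (alternating 9 n).circuits ↔ IsLawrenceVec (fun _ _ => false) X :=
  (isLawrenceVec_false X).symm

theorem squaresAgree_stripes (q : ℕ) (τ : ℕ → Bool) : SquaresAgree q (stripes τ) := by
  intro i c _ _ _
  rw [square_stripes, square_stripes]

theorem square_eq_of_squaresAgree {q : ℕ} {a : ℕ → ℕ → Bool} (h : SquaresAgree q a) {i j c : ℕ}
    (hij : i ≤ j) (hj : j ≤ 7) (h1 : j + 1 ≤ c) (h2 : c ≤ i + q) :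
    square a i c = square a j c := by
  induction j, hij using Nat.le_induction with
  | base => rfl
  | succ j hij ih =>
    rw [ih (by omega) (by omega)]
    exact h j c (by omega) (by omega) (by omega)

/-- A matrix whose squares agree in each column has the squares of a striped matrix. -/
theorem exists_columnSet {q : ℕ} {a : ℕ → ℕ → Bool} (h : SquaresAgree q a) :
    ∃ v : Fin (q + 7) → Bool, ∀ i c, i ≤ 7 → i + 1 ≤ c → c ≤ i + q →
      square (stripes (columnSet v)) i c = square a i c := by
  -- Column `c` is in the set if the number of `true` squares in the columns before it is odd.
  let D : ℕ → Bool := fun c => square a (min (c - 1) 7) c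
  let t : ℕ → Bool := fun j => Nat.rec false (fun j x => x ^^ D (j + 1)) j
  have ht : ∀ j, t (j + 1) = (t j ^^ D (j + 1)) := fun j => rfl
  refine ⟨fun j => t (j + 1), fun i c hi h1 h2 => ?_⟩
  have hcol : ∀ c, 1 ≤ c → c ≤ q + 8 → columnSet (fun j : Fin (q + 7) => t (j + 1)) c =
      t (c - 1) := by
    intro c hc hc'
    obtain rfl | ⟨j, rfl⟩ : c = 1 ∨ ∃ j, c = j + 2 := by
      rcases Nat.lt_or_ge c 2 with h | h
      · left; omega
      · exact Or.inr ⟨c - 2, by omega⟩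
    · rfl
    · exact columnSet_add_two _ ⟨j, by omega⟩
  obtain ⟨c, rfl⟩ : ∃ d, c = d + 1 := ⟨c - 1, by omega⟩
  rw [square_stripes, hcol _ (by omega) (by omega), hcol _ (by omega) (by omega),
    square_eq_of_squaresAgree (j := min c 7) h (by omega) (by omega) (by omega) h2]
  simp only [Nat.add_sub_cancel]
  rw [ht]
  cases t c <;> simp [D]

/-- Equality of classes forces equality of the sets of columns, as the squares are invariant
under reorientation. -/
theorem columnSet_injective {q : ℕ} (hq : 1 ≤ q) {v w : Fin (q + 7) → Bool}
    (h : folded (columnSet v) (10 + q) ∈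
      (folded (columnSet w) (10 + q)).reorientationClass) : v = w := by
  obtain ⟨R, hR⟩ := h
  let σ : ℕ → Bool := fun c => if h : c < 10 + q then decide (⟨c, h⟩ ∈ R) else false
  have hσ : ({c : Fin (10 + q) | σ c = true} : Finset (Fin (10 + q))) = R := by
    ext c
    simp [σ]
  have hcirc : ∀ X : Fin (10 + q) → SignType, IsLawrenceVec (stripes (columnSet v)) X →
      IsLawrenceVec (fun i c => (stripes (columnSet w) i c ^^ false) ^^ σ c) X := by
    intro X hX
    rw [isLawrenceVec_scale (fun _ => false) σ, hσ, ← mem_circuits_folded (by omega),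
      ← mem_circuits_reorient, ← hR, mem_circuits_folded (by omega)]
    exact hX
  have hsq : ∀ c, 1 ≤ c → c ≤ q + 7 → (columnSet v c ^^ columnSet v (c + 1)) =
      (columnSet w c ^^ columnSet w (c + 1)) := by
    intro c hc hc'
    have := square_eq_of_isLawrenceVec_iff hcirc (i := min (c - 1) 7) (c := c) (by omega)
      (by omega) (by omega)
    rwa [square_scale (fun _ => false) σ, square_stripes, square_stripes] at this
  have hall : ∀ c, c ≤ q + 7 → columnSet v (c + 1) = columnSet w (c + 1) := by
    intro c
    induction c with
    | zero => intro _; rfl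
    | succ c ih =>
      intro hc
      have h1 := hsq (c + 1) (by omega) hc
      rw [ih (by omega)] at h1
      exact Bool.xor_right_inj.1 h1
  funext j
  rw [← columnSet_add_two v j, ← columnSet_add_two w j]
  exact hall (j + 1) (by omega)

/-- A Lawrence oriented matroid whose squares agree is a reorientation of a folded one. -/
theorem exists_folded_reorient {q : ℕ} {a : ℕ → ℕ → Bool} {M : OrientedMatroid (Fin (10 + q))}
    (hM : ∀ X, X ∈ M.circuits ↔ IsLawrenceVec a X) (h : SquaresAgree q a) :
    ∃ (v : Fin (q + 7) → Bool) (R : Finset (Fin (10 + q))),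
      M = (folded (columnSet v) (10 + q)).reorient R := by
  obtain ⟨v, hv⟩ := exists_columnSet h
  obtain ⟨ρ, σ, hab⟩ := exists_scaling_of_square_eq hv
  refine ⟨v, ({c : Fin (10 + q) | σ c = true} : Finset (Fin (10 + q))), ?_⟩
  ext X
  rw [hM, mem_circuits_reorient, mem_circuits_folded (by omega), ← isLawrenceVec_scale ρ σ]
  exact ⟨fun h => h.congr hab, fun h => h.congr fun i c h1 h2 h3 => (hab i c h1 h2 h3).symm⟩

/-- If the number of good sign patterns is at most `2 * C`, with equality exactly for matrices
whose squares agree, then `C_9(10 + q)` is extremal, and the other extremal classes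
correspond to the nonempty sets of columns. -/
theorem numNeighborly_le_and_ncard {q N k C : ℕ} (hq : 1 ≤ q) (hk : k ≤ 9) (hN : 9 - k = N)
    (H : ∀ a, goodCount (10 + q) N a ≤ 2 * C ∧
      (goodCount (10 + q) N a = 2 * C ↔ SquaresAgree q a)) :
    (∀ M : OrientedMatroid (Fin (10 + q)), M.IsLOM 9 →
        M ∉ (alternating 9 (10 + q)).reorientationClass →
        M.numNeighborly k ≤ cyclicCount 9 (10 + q) k) ∧
      (extremalClasses 9 (10 + q) k).ncard = 2 ^ (q + 7) - 1 := by
  subst hN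
  have hcyc : cyclicCount 9 (10 + q) k = 2 * C := by
    rw [cyclicCount, numNeighborly_eq_goodCount hk mem_circuits_alternating, (H _).2,
      ← stripes_false]
    exact squaresAgree_stripes q _
  refine ⟨fun M hM _ => ?_, ?_⟩
  · obtain ⟨a, ha⟩ := hM.exists_isLawrenceVec
    rw [hcyc, numNeighborly_eq_goodCount hk ha]
    exact (H a).1
  · have hne : ∀ v : Fin (q + 7) → Bool, v ≠ (fun _ => false) →
        folded (columnSet v) (10 + q) ∉ (alternating 9 (10 + q)).reorientationClass := by
      intro v hv hmem
      rw [← folded_false (by omega), ← columnSet_false (m := q + 7)] at hmem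
      exact hv (columnSet_injective hq hmem)
    have himage : extremalClasses 9 (10 + q) k =
        (fun v : Fin (q + 7) → Bool => (folded (columnSet v) (10 + q)).reorientationClass) ''
          {fun _ => false}ᶜ := by
      ext K
      constructor
      · rintro ⟨M, hM, hMC, hMk, rfl⟩
        obtain ⟨a, ha⟩ := hM.exists_isLawrenceVec
        rw [hcyc, numNeighborly_eq_goodCount hk ha, (H a).2] at hMk
        obtain ⟨v, R, rfl⟩ := exists_folded_reorient ha hMk
        refine ⟨v, ?_, (reorientationClass_reorient _ R).symm⟩
        rintro rfl
        rw [columnSet_false, folded_false (by omega)] at hMC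
        exact hMC ⟨R, rfl⟩
      · rintro ⟨v, hv, rfl⟩
        refine ⟨_, isLOM_folded (by omega) (columnSet v), hne v hv, ?_, rfl⟩
        rw [hcyc, numNeighborly_eq_goodCount hk (mem_circuits_folded (by omega) _), (H _).2]
        exact squaresAgree_stripes q _
    rw [himage, Set.ncard_image_of_injective, Set.ncard_compl, Set.ncard_singleton,
      Nat.card_eq_fintype_card, Fintype.card_fun, Fintype.card_bool, Fintype.card_fin]
    intro v w hvw
    refine columnSet_injective hq ?_
    rw [show (folded (columnSet w) (10 + q)).reorientationClass = _ from hvw.symm]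
    exact mem_reorientationClass_self _

end OrientedMatroid

theorem mainTheorem10 :
    -- rank 9, 12 elements, k = 2
    ((∀ M : OrientedMatroid (Fin 12), M.IsLOM 9 →
        M ∉ (OrientedMatroid.alternating 9 12).reorientationClass →
        M.numNeighborly 2 ≤ OrientedMatroid.cyclicCount 9 12 2) ∧
      (OrientedMatroid.extremalClasses 9 12 2).ncard = 511) ∧
    -- rank 9, 12 elements, k = 3
    ((∀ M : OrientedMatroid (Fin 12), M.IsLOM 9 →
        M ∉ (OrientedMatroid.alternating 9 12).reorientationClass →
        M.numNeighborly 3 ≤ OrientedMatroid.cyclicCount 9 12 3) ∧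
      (OrientedMatroid.extremalClasses 9 12 3).ncard = 511) ∧
    -- rank 9, 13 elements, k = 3
    ((∀ M : OrientedMatroid (Fin 13), M.IsLOM 9 →
        M ∉ (OrientedMatroid.alternating 9 13).reorientationClass →
        M.numNeighborly 3 ≤ OrientedMatroid.cyclicCount 9 13 3) ∧
      (OrientedMatroid.extremalClasses 9 13 3).ncard = 1023) := by
  exact ⟨OrientedMatroid.numNeighborly_le_and_ncard (q := 2) (by decide) (by decide) rfl
      goodCount_twelve_two,
    OrientedMatroid.numNeighborly_le_and_ncard (q := 2) (by decide) (by decide) rfl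
      goodCount_twelve_three,
    OrientedMatroid.numNeighborly_le_and_ncard (q := 3) (by decide) (by decide) rfl
      goodCount_thirteen_three⟩
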